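/- Let $U=[0,1]^3$ with periodic boundary conditions (the flat torus of volume $1$), let $0<T<\infty$, and let $0\le f_0\in L^1(U\times\mathbb R^3)$ and $0\le g_0\in L^1(\mathbb R^3)$ be probability densities with $$\int_{U\times\mathbb R^3} f_0(x,v)(1+|v|^2)\,dx\,dv<\infty,\qquad \int_{\mathbb R^3} g_0(v)(1+|v|^2)\,dv<\infty,\qquad \operatorname*{ess\,sup}_{v\in\mathbb R^3} g_0(v)(1+|v|^{3+\eta})<\infty$$ for some $\eta>0$ (for instance $\eta=1$). For $f\in L^1(U\times\mathbb R^3)$ define the gain and loss terms $$Q^+[f](x,v)=\int_{\mathbb S^2}\int_{\mathbb R^3} f(x,v')\,g_0(\bar v')\,[(v-\bar v)\cdot\nu]_+\,d\bar v\,d\nu,\qquad Q^-[f](x,v)=f(x,v)\int_{\mathbb S^2}\int_{\mathbb R^3} g_0(\bar v)\,[(v-\bar v)\cdot\nu]_+\,d\bar v\,d\nu,$$ where $v'=v+\nu\cdot(\bar v-v)\,\nu$ and $\bar v'=\bar v-\nu\cdot(\bar v-v)\,\nu$. Let $Af=-v\cdot\partial_x f-Q^-[f]$, in the sense of distributions on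 $U\times\mathbb R^3$, with domain $D(A)=\{f\in L^1(U\times\mathbb R^3): v\cdot\partial_x f+Q^-[f]\in L^1(U\times\mathbb R^3)\}$; let $Bf=Q^+[f]$ with domain $D(B)=\{f\in L^1(U\times\mathbb R^3): Q^+[f]\in L^1(U\times\mathbb R^3)\}$; and let $A+B$ have domain $D(A)\cap D(B)$. For an operator $L:D(L)\subset L^1(U\times\mathbb R^3)\to L^1(U\times\mathbb R^3)$, a mild solution on $[0,T]$ of $\partial_t u=Lu$, $u(0)=u_0$, is a Bochner integrable function $u:[0,T]\to L^1(U\times\mathbb R^3)$ such that for all $t\in[0,T]$ $$\int_0^t u(\theta)\,d\theta\in D(L)\quad\text{and}\quad L\int_0^t u(\theta)\,d\theta=u(t)-u_0 .$$ Then the linear Boltzmann equation $$\partial_t f_t=-v\cdot\partial_x f_t+Q^+[f_t]-Q^-[f_t]=(A+B)f_t,\qquad f_{t=0}=f_0,$$ has a unique mild solution $f:[0,T]\to L^1(U\times\mathbb R^3)$. More precisely, $A+B$ is closable, there is a mild solution $f$ for $L=A+B$, it is continuous in time, and every mild solution for $L=\overline{A+B}$ (in particular every mild solution for $L=A+B$)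 with initial value $f_0$ coincides with $f$ on $[0,T]$. Moreover, for every $t\in[0,T]$, $$f_t\ge 0\ \text{a.e.},\qquad \int_{U\times\mathbb R^3} f_t(x,v)\,dx\,dv=1,\qquad \int_{U\times\mathbb R^3} f_t(x,v)(1+|v|)\,dx\,dv<\infty,\qquad f_t\in D(B).$$ -/

import Mathlib

open MeasureTheory Set
open scoped ContDiff

noncomputable section

namespace LinBoltz

/-- Velocity space `ℝ³` with its Euclidean norm. -/
abbrev Vel := EuclideanSpace ℝ (Fin 3)

/-- `U = [0,1]³` with periodic boundary conditions: the flat torus, of total volume one. -/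
abbrev Torus := Fin 3 → UnitAddCircle

/-- The phase space `U × ℝ³`, with the product of the Lebesgue measures. -/
abbrev Phase := Torus × Vel

/-- The Banach space `L¹(U × ℝ³)`. -/
abbrev L1Phase := Lp ℝ 1 (volume : Measure Phase)

/-- The Banach space `L¹(ℝ³)`. -/
abbrev L1Vel := Lp ℝ 1 (volume : Measure Vel)

/-- The unit sphere `𝕊²`. -/
abbrev Sph := Metric.sphere (0 : Vel) 1

/-- The surface measure `dν` on `𝕊²` (of total mass `4π`). -/
abbrev sphMeasure : Measure Sph := (volume : Measure Vel).toSphere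

/-- The measure `dv̄ dν` on `𝕊² × ℝ³`. -/
abbrev collMeasure : Measure (Sph × Vel) := sphMeasure.prod volume

instance : IsFiniteMeasure sphMeasure := inferInstance

instance : SFinite sphMeasure := inferInstance

instance : SFinite collMeasure := inferInstance

/-! ### Test functions on the torus and the streaming derivative -/

/-- The covering map `ℝ³ → U`. -/
def torusProj (y : Fin 3 → ℝ) : Torus := fun i => (y i : UnitAddCircle)

/-- The covering map `ℝ³ × ℝ³ → U × ℝ³`. -/
def cover (p : (Fin 3 → ℝ) × Vel) : Phase := (torusProj p.1, p.2)

/-- Test functions: smooth compactly supported functions on `U × ℝ³`; smoothness is smoothness of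
the lift to the universal cover. -/
def IsTestFunction (φ : Phase → ℝ) : Prop :=
  ContDiff ℝ ∞ (fun p => φ (cover p)) ∧ HasCompactSupport φ

/-- `(v · ∂ₓ φ)(x, v)`, the derivative of `s ↦ φ(x + s v, v)` at `s = 0`. -/
def streamDeriv (φ : Phase → ℝ) (z : Phase) : ℝ :=
  deriv (fun s : ℝ => φ (z.1 + torusProj (fun i => s * z.2 i), z.2)) 0

lemma isOpenQuotientMap_cover : IsOpenQuotientMap cover := by
  have h1 : IsOpenQuotientMap torusProj :=
    IsOpenQuotientMap.piMap (f := fun (_ : Fin 3) (y : ℝ) => (y : UnitAddCircle))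
      (fun _ => QuotientAddGroup.isOpenQuotientMap_mk)
  exact h1.prodMap IsOpenQuotientMap.id

lemma continuous_cover : Continuous cover := isOpenQuotientMap_cover.continuous

lemma torusProj_add (y y' : Fin 3 → ℝ) : torusProj (y + y') = torusProj y + torusProj y' := by
  funext i
  simp [torusProj]

lemma IsTestFunction.continuous {φ : Phase → ℝ} (h : IsTestFunction φ) : Continuous φ :=
  isOpenQuotientMap_cover.isQuotientMap.continuous_iff.2 h.1.continuous

lemma streamDeriv_cover {φ : Phase → ℝ} (h : IsTestFunction φ) (p : (Fin 3 → ℝ) × Vel) :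
    streamDeriv φ (cover p) =
      fderiv ℝ (fun q => φ (cover q)) p ((fun i => p.2 i), 0) := by
  have hd : HasFDerivAt (fun q => φ (cover q)) (fderiv ℝ (fun q => φ (cover q)) p) p :=
    (h.1.differentiable (by simp) p).hasFDerivAt
  have hc : HasDerivAt (fun s : ℝ => p + s • (((fun i => p.2 i), 0) : (Fin 3 → ℝ) × Vel))
      ((fun i => p.2 i), 0) 0 := by
    simpa using ((hasDerivAt_id (0 : ℝ)).smul_const
      (((fun i => p.2 i), 0) : (Fin 3 → ℝ) × Vel)).const_add p
  have hd' : HasFDerivAt (fun q => φ (cover q)) (fderiv ℝ (fun q => φ (cover q)) p)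
      (p + (0 : ℝ) • (((fun i => p.2 i), 0) : (Fin 3 → ℝ) × Vel)) := by simpa using hd
  have := (hd'.comp_hasDerivAt (0 : ℝ) hc).deriv
  rw [← this]
  unfold streamDeriv
  congr 1
  funext s
  simp only [cover, Function.comp, Prod.fst_add, Prod.snd_add, Prod.smul_fst, Prod.smul_snd,
    torusProj_add, smul_zero, add_zero]
  rfl

lemma IsTestFunction.continuous_streamDeriv {φ : Phase → ℝ} (h : IsTestFunction φ) :
    Continuous (streamDeriv φ) := by
  refine isOpenQuotientMap_cover.isQuotientMap.continuous_iff.2 ?_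
  have : streamDeriv φ ∘ cover = fun p : (Fin 3 → ℝ) × Vel =>
      fderiv ℝ (fun q => φ (cover q)) p ((fun i => p.2 i), 0) := by
    funext p
    exact streamDeriv_cover h p
  rw [this]
  exact (h.1.continuous_fderiv (by simp)).clm_apply (by fun_prop)

lemma IsTestFunction.hasCompactSupport_streamDeriv {φ : Phase → ℝ} (h : IsTestFunction φ) :
    HasCompactSupport (streamDeriv φ) := by
  have hK : IsCompact ((univ : Set Torus) ×ˢ (Prod.snd '' tsupport φ)) :=
    isCompact_univ.prod (h.2.isCompact.image continuous_snd)
  refine HasCompactSupport.intro hK ?_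
  rintro ⟨x, v⟩ hz
  have : (fun s : ℝ => φ (x + torusProj (fun i => s * v i), v)) = fun _ => 0 := by
    funext s
    apply image_eq_zero_of_notMem_tsupport
    intro hs
    exact hz ⟨mem_univ _, _, hs, rfl⟩
  simp [streamDeriv, this]

lemma integrable_mul_test {f : Phase → ℝ} (hf : LocallyIntegrable f volume) {φ : Phase → ℝ}
    (h : Continuous φ) (h' : HasCompactSupport φ) : Integrable (fun z => f z * φ z) volume := by
  have := hf.integrable_smul_left_of_hasCompactSupport h h'
  refine this.congr (Filter.Eventually.of_forall fun z => ?_)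
  simp [mul_comm]

lemma locallyIntegrable_coe (f : L1Phase) : LocallyIntegrable f volume :=
  (L1.integrable_coeFn f).locallyIntegrable

/-! ### Test functions separate the elements of `L¹` -/

/-- The open unit cube times velocity space, a fundamental domain up to a null set. -/
def cell : Set ((Fin 3 → ℝ) × Vel) := (univ.pi fun _ => Ioo (0 : ℝ) 1) ×ˢ univ

lemma isOpen_cell : IsOpen cell :=
  (isOpen_set_pi finite_univ fun _ _ => isOpen_Ioo).prod isOpen_univ

lemma measurePreserving_cover : MeasurePreserving cover (volume.restrict cell) volume := by
  have h1 : MeasurePreserving ((↑) : ℝ → UnitAddCircle) (volume.restrict (Ioo (0 : ℝ) 1))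
      volume := by
    have := UnitAddCircle.measurePreserving_mk 0
    rwa [zero_add, ← restrict_Ioo_eq_restrict_Ioc] at this
  have h2 := measurePreserving_pi (ι := Fin 3) (fun _ => volume.restrict (Ioo (0 : ℝ) 1))
    (fun _ => (volume : Measure UnitAddCircle)) (fun _ => h1)
  have h3 := h2.prod (MeasurePreserving.id (volume : Measure Vel))
  rw [← Measure.restrict_pi_pi] at h3
  have h4 : ((Measure.pi fun _ : Fin 3 => (volume : Measure ℝ)).restrict
      (univ.pi fun _ => Ioo (0 : ℝ) 1)).prod (volume : Measure Vel)
      = (volume : Measure ((Fin 3 → ℝ) × Vel)).restrict cell := by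
    conv_lhs => rw [← Measure.restrict_univ (μ := (volume : Measure Vel))]
    rw [Measure.prod_restrict]
    rfl
  rw [h4] at h3
  exact h3

/-- The inverse of the covering map on the cell. -/
def cellRep (z : Phase) : (Fin 3 → ℝ) × Vel :=
  (fun i => (AddCircle.equivIoc (1 : ℝ) 0 (z.1 i) : ℝ), z.2)

lemma cellRep_cover {p : (Fin 3 → ℝ) × Vel} (hp : p ∈ cell) : cellRep (cover p) = p := by
  refine Prod.ext ?_ rfl
  funext i
  have hi : p.1 i ∈ Ioo (0 : ℝ) 1 := hp.1 i (mem_univ i)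
  have := AddCircle.equivIoc_coe_of_mem (p := (1 : ℝ)) (a := 0) (y := p.1 i)
    ⟨hi.1, by simpa using hi.2.le⟩
  simp only [cellRep, cover, torusProj]
  rw [this]

lemma isTestFunction_cellRep {ψ : (Fin 3 → ℝ) × Vel → ℝ} (hψ : ContDiff ℝ ∞ ψ)
    (hc : HasCompactSupport ψ) (hs : tsupport ψ ⊆ cell) :
    IsTestFunction (fun z => ψ (cellRep z)) := by
  have hcov : ∀ z, cover (cellRep z) = z := by
    intro z
    refine Prod.ext ?_ rfl
    funext i
    simp only [cellRep, cover, torusProj]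
    exact (AddCircle.equivIoc (1 : ℝ) 0).symm_apply_apply (z.1 i)
  have hK : IsCompact (cover '' tsupport ψ) := hc.isCompact.image continuous_cover
  have hzero : ∀ z, z ∉ cover '' tsupport ψ → ψ (cellRep z) = 0 := by
    intro z hz
    apply image_eq_zero_of_notMem_tsupport
    intro h
    exact hz ⟨_, h, hcov z⟩
  refine ⟨?_, HasCompactSupport.intro hK hzero⟩
  rw [contDiff_iff_contDiffAt]
  intro p
  by_cases hp : cover p ∈ cover '' tsupport ψ
  · obtain ⟨q, hq, hqp⟩ := hp
    have hcont : ContDiff ℝ ∞ (fun p' : (Fin 3 → ℝ) × Vel => p' + (q - p)) := by fun_prop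
    have hper : ∀ p', cover (p' + (q - p)) = cover p' := by
      intro p'
      have h1 : torusProj q.1 = torusProj p.1 := congrArg (fun z : Phase => z.1) hqp
      have h2 : q.2 = p.2 := congrArg (fun z : Phase => z.2) hqp
      refine Prod.ext ?_ (by simp [cover, h2])
      have h3 : torusProj (q.1 - p.1) = 0 := by
        have := torusProj_add (q.1 - p.1) p.1
        rw [sub_add_cancel, h1] at this
        exact left_eq_add.1 (this.trans (add_comm _ _))
      simp [cover, torusProj_add, h3]
    have hev : ∀ᶠ p' in nhds p, p' + (q - p) ∈ cell := by
      apply hcont.continuous.continuousAt.eventually_mem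
      apply isOpen_cell.mem_nhds
      simpa using hs hq
    refine ((hψ.comp hcont).contDiffAt (x := p)).congr_of_eventuallyEq ?_
    filter_upwards [hev] with p' hp'
    simp only [Function.comp]
    rw [← hper p', cellRep_cover hp']
  · have hev : ∀ᶠ p' in nhds p, cover p' ∉ cover '' tsupport ψ :=
      continuous_cover.continuousAt.eventually_mem (hK.isClosed.isOpen_compl.mem_nhds hp)
    refine (contDiffAt_const (c := (0 : ℝ))).congr_of_eventuallyEq ?_
    filter_upwards [hev] with p' hp'
    exact hzero _ hp'

lemma eq_zero_of_integral_test (h : L1Phase)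
    (hh : ∀ φ, IsTestFunction φ → ∫ z, h z * φ z = 0) : h = 0 := by
  have hmp := measurePreserving_cover
  have hint : IntegrableOn (fun p => h (cover p)) cell volume :=
    hmp.integrable_comp_of_integrable (L1.integrable_coeFn h)
  have key : ∀ᵐ p ∂(volume : Measure ((Fin 3 → ℝ) × Vel)), p ∈ cell → h (cover p) = 0 := by
    refine isOpen_cell.ae_eq_zero_of_integral_contDiff_smul_eq_zero
      hint.locallyIntegrableOn ?_
    intro ψ hψ hc hs
    have ht := isTestFunction_cellRep hψ hc hs
    have h0 := hh _ ht
    have hF : AEStronglyMeasurable (fun z => h z * ψ (cellRep z)) (volume : Measure Phase) :=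
      (Lp.aestronglyMeasurable h).mul ht.continuous.aestronglyMeasurable
    have h1 : ∀ F : Phase → ℝ, AEStronglyMeasurable F volume →
        ∫ z, F z = ∫ p in cell, F (cover p) := by
      intro F hF
      rw [← hmp.map_eq] at hF ⊢
      exact integral_map hmp.measurable.aemeasurable hF
    rw [h1 _ hF] at h0
    · rw [← setIntegral_eq_integral_of_forall_compl_eq_zero (s := cell), ← h0]
      · refine setIntegral_congr_fun isOpen_cell.measurableSet ?_
        intro p hp
        simp only [smul_eq_mul]
        rw [cellRep_cover hp, mul_comm]
      · intro p hp
        rw [image_eq_zero_of_notMem_tsupport (fun hm => hp (hs hm)), zero_smul]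
  have key2 : ∀ᵐ p ∂((volume : Measure ((Fin 3 → ℝ) × Vel)).restrict cell),
      h (cover p) = 0 := by
    rwa [ae_restrict_iff' isOpen_cell.measurableSet]
  have key3 : ∀ᵐ z ∂(volume : Measure Phase), h z = 0 := by
    have h1 : MeasurableSet {z | h z = 0} :=
      (Lp.stronglyMeasurable h).measurable (measurableSet_singleton 0)
    have h2 := (ae_map_iff hmp.measurable.aemeasurable h1).2 key2
    rwa [hmp.map_eq] at h2
  exact (Lp.eq_zero_iff_ae_eq_zero).2 key3

/-! ### The loss term and the operator `A` -/

/-- `[(v - v̄) · ν]₊` -/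
def collKernel (v : Vel) (p : Sph × Vel) : ℝ := max (inner ℝ (v - p.2) (p.1 : Vel)) 0

/-- The collision frequency `∫_{𝕊²} ∫_{ℝ³} g(v̄) [(v - v̄) · ν]₊ dv̄ dν`. -/
def collRate (g : L1Vel) (v : Vel) : ℝ := ∫ p, g p.2 * collKernel v p ∂collMeasure

/-- The loss term `Q⁻[f]`. -/
def loss (g : L1Vel) (f : L1Phase) (z : Phase) : ℝ := f z * collRate g z.2

/-- `h = -v · ∂ₓ f - Q⁻[f]` in the sense of distributions on `U × ℝ³`. -/
def IsTransportLoss (g : L1Vel) (f h : L1Phase) : Prop :=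
  LocallyIntegrable (loss g f) volume ∧
    ∀ φ, IsTestFunction φ →
      (∫ z, f z * streamDeriv φ z) - ∫ z, loss g f z * φ z = ∫ z, h z * φ z

lemma loss_add (g : L1Vel) (f f' : L1Phase) :
    loss g (f + f') =ᵐ[volume] fun z => loss g f z + loss g f' z := by
  filter_upwards [Lp.coeFn_add f f'] with z hz
  simp only [loss, hz, Pi.add_apply, add_mul]

lemma loss_smul (g : L1Vel) (c : ℝ) (f : L1Phase) :
    loss g (c • f) =ᵐ[volume] fun z => c * loss g f z := by
  filter_upwards [Lp.coeFn_smul c f] with z hz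
  simp only [loss, hz, Pi.smul_apply, smul_eq_mul, mul_assoc]

lemma IsTransportLoss.add {g : L1Vel} {f f' h h' : L1Phase} (H : IsTransportLoss g f h)
    (H' : IsTransportLoss g f' h') : IsTransportLoss g (f + f') (h + h') := by
  refine ⟨(locallyIntegrable_congr (loss_add g f f')).2 (H.1.add H'.1), fun φ hφ => ?_⟩
  have e1 : ∫ z, (f + f') z * streamDeriv φ z
      = (∫ z, f z * streamDeriv φ z) + ∫ z, f' z * streamDeriv φ z := by
    rw [← integral_add
      (integrable_mul_test (locallyIntegrable_coe f) hφ.continuous_streamDeriv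
        hφ.hasCompactSupport_streamDeriv)
      (integrable_mul_test (locallyIntegrable_coe f') hφ.continuous_streamDeriv
        hφ.hasCompactSupport_streamDeriv)]
    refine integral_congr_ae ?_
    filter_upwards [Lp.coeFn_add f f'] with z hz
    simp only [hz, Pi.add_apply, add_mul]
  have e2 : ∫ z, loss g (f + f') z * φ z
      = (∫ z, loss g f z * φ z) + ∫ z, loss g f' z * φ z := by
    rw [← integral_add (integrable_mul_test H.1 hφ.continuous hφ.2)
      (integrable_mul_test H'.1 hφ.continuous hφ.2)]
    refine integral_congr_ae ?_
    filter_upwards [loss_add g f f'] with z hz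
    simp only [hz, add_mul]
  have e3 : ∫ z, (h + h') z * φ z = (∫ z, h z * φ z) + ∫ z, h' z * φ z := by
    rw [← integral_add (integrable_mul_test (locallyIntegrable_coe h) hφ.continuous hφ.2)
      (integrable_mul_test (locallyIntegrable_coe h') hφ.continuous hφ.2)]
    refine integral_congr_ae ?_
    filter_upwards [Lp.coeFn_add h h'] with z hz
    simp only [hz, Pi.add_apply, add_mul]
  have a := H.2 φ hφ
  have b := H'.2 φ hφ
  rw [e1, e2, e3]
  linarith

lemma IsTransportLoss.smul {g : L1Vel} {f h : L1Phase} (c : ℝ) (H : IsTransportLoss g f h) :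
    IsTransportLoss g (c • f) (c • h) := by
  refine ⟨(locallyIntegrable_congr (loss_smul g c f)).2 (H.1.smul c), fun φ hφ => ?_⟩
  have e1 : ∫ z, (c • f) z * streamDeriv φ z = c * ∫ z, f z * streamDeriv φ z := by
    rw [← integral_const_mul]
    refine integral_congr_ae ?_
    filter_upwards [Lp.coeFn_smul c f] with z hz
    simp only [hz, Pi.smul_apply, smul_eq_mul, mul_assoc]
  have e2 : ∫ z, loss g (c • f) z * φ z = c * ∫ z, loss g f z * φ z := by
    rw [← integral_const_mul]
    refine integral_congr_ae ?_
    filter_upwards [loss_smul g c f] with z hz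
    simp only [hz, mul_assoc]
  have e3 : ∫ z, (c • h) z * φ z = c * ∫ z, h z * φ z := by
    rw [← integral_const_mul]
    refine integral_congr_ae ?_
    filter_upwards [Lp.coeFn_smul c h] with z hz
    simp only [hz, Pi.smul_apply, smul_eq_mul, mul_assoc]
  rw [e1, e2, e3, ← H.2 φ hφ]
  ring

lemma IsTransportLoss.unique {g : L1Vel} {f h h' : L1Phase} (H : IsTransportLoss g f h)
    (H' : IsTransportLoss g f h') : h = h' := by
  rw [← sub_eq_zero]
  refine eq_zero_of_integral_test _ fun φ hφ => ?_
  have e : ∫ z, (h - h') z * φ z = (∫ z, h z * φ z) - ∫ z, h' z * φ z := by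
    rw [← integral_sub (integrable_mul_test (locallyIntegrable_coe h) hφ.continuous hφ.2)
      (integrable_mul_test (locallyIntegrable_coe h') hφ.continuous hφ.2)]
    refine integral_congr_ae ?_
    filter_upwards [Lp.coeFn_sub h h'] with z hz
    simp only [hz, Pi.sub_apply, sub_mul]
  rw [e, ← H.2 φ hφ, ← H'.2 φ hφ, sub_self]

lemma isTransportLoss_zero (g : L1Vel) : IsTransportLoss g 0 0 := by
  have h0 : loss g 0 =ᵐ[volume] fun _ => (0 : ℝ) := by
    filter_upwards [Lp.coeFn_zero ℝ 1 (volume : Measure Phase)] with z hz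
    simp only [loss, hz, Pi.zero_apply, zero_mul]
  have h1 : ∀ F : Phase → ℝ, ∫ z, (0 : L1Phase) z * F z = 0 := by
    intro F
    refine integral_eq_zero_of_ae ?_
    filter_upwards [Lp.coeFn_zero ℝ 1 (volume : Measure Phase)] with z hz
    simp only [hz, Pi.zero_apply, zero_mul]
  refine ⟨(locallyIntegrable_congr h0).2 locallyIntegrable_zero, fun φ _ => ?_⟩
  have h2 : ∫ z, loss g 0 z * φ z = 0 := by
    refine integral_eq_zero_of_ae ?_
    filter_upwards [h0] with z hz
    simp only [hz, Pi.zero_apply, zero_mul]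
  rw [h1, h1, h2, sub_zero]

/-- The operator `A f = -v · ∂ₓ f - Q⁻[f]` (derivative in the sense of distributions), with its
maximal domain `D(A) = {f ∈ L¹ : v · ∂ₓ f + Q⁻[f] ∈ L¹}`. -/
def opA (g : L1Vel) : L1Phase →ₗ.[ℝ] L1Phase where
  domain :=
    { carrier := {f | ∃ h, IsTransportLoss g f h}
      add_mem' := fun ⟨_, h⟩ ⟨_, h'⟩ => ⟨_, h.add h'⟩
      zero_mem' := ⟨0, isTransportLoss_zero g⟩
      smul_mem' := fun c _ ⟨_, h⟩ => ⟨_, h.smul c⟩ }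
  toFun :=
    { toFun := fun f => f.2.choose
      map_add' := fun f f' =>
        (f + f').2.choose_spec.unique (f.2.choose_spec.add f'.2.choose_spec)
      map_smul' := fun c f => (c • f).2.choose_spec.unique (f.2.choose_spec.smul c) }

lemma opA_graph {g : L1Vel} {f h : L1Phase} :
    (f, h) ∈ (opA g).graph ↔ IsTransportLoss g f h := by
  rw [LinearPMap.mem_graph_iff]
  constructor
  · rintro ⟨y, rfl, rfl⟩
    exact y.2.choose_spec
  · intro H
    have hf : f ∈ (opA g).domain := ⟨h, H⟩
    exact ⟨⟨f, hf⟩, rfl, (Exists.choose_spec hf).unique H⟩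

/-! ### The gain term and the operator `B` -/

/-- The pre-collisional velocity `v' = v + ν · (v̄ - v) ν` of the tagged particle. -/
def preVel (v : Vel) (p : Sph × Vel) : Vel :=
  v + (inner ℝ (p.1 : Vel) (p.2 - v)) • (p.1 : Vel)

/-- The pre-collisional velocity `v̄' = v̄ - ν · (v̄ - v) ν` of the background particle. -/
def preVelBar (v : Vel) (p : Sph × Vel) : Vel :=
  p.2 - (inner ℝ (p.1 : Vel) (p.2 - v)) • (p.1 : Vel)

/-- The integrand `f(x, v') g(v̄') [(v - v̄) · ν]₊` of the gain term at `z = (x, v)`. -/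
def gainIntegrand (g : L1Vel) (f : L1Phase) (z : Phase) (p : Sph × Vel) : ℝ :=
  f (z.1, preVel z.2 p) * g (preVelBar z.2 p) * collKernel z.2 p

/-- The gain term `Q⁺[f]`. -/
def gain (g : L1Vel) (f : L1Phase) (z : Phase) : ℝ := ∫ p, gainIntegrand g f z p ∂collMeasure

/-- `Q⁺[f] ∈ L¹(U × ℝ³)`: the integral defining `Q⁺[f](x, v)` converges for almost every `(x, v)`
and the result is integrable. -/
def GainIntegrable (g : L1Vel) (f : L1Phase) : Prop :=
  (∀ᵐ z ∂(volume : Measure Phase), Integrable (gainIntegrand g f z) collMeasure) ∧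
    Integrable (gain g f) volume

/-- For fixed `ν`, the collision map `(v, v̄) ↦ (v', v̄')`. -/
def collMap (ν : Vel) : (Vel × Vel) →ₗ[ℝ] (Vel × Vel) where
  toFun q := (q.1 + (inner ℝ ν (q.2 - q.1)) • ν, q.2 - (inner ℝ ν (q.2 - q.1)) • ν)
  map_add' q q' := by
    refine Prod.ext ?_ ?_ <;>
    · simp only [Prod.fst_add, Prod.snd_add, inner_add_right, inner_sub_right]
      module
  map_smul' c q := by
    refine Prod.ext ?_ ?_ <;>
    · simp only [Prod.smul_fst, Prod.smul_snd, inner_smul_right, inner_sub_right, RingHom.id_apply]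
      module

lemma quasiMeasurePreserving_collMap (ν : Sph) :
    Measure.QuasiMeasurePreserving (collMap (ν : Vel))
      ((volume : Measure Vel).prod volume) ((volume : Measure Vel).prod volume) := by
  have hν : inner ℝ (ν : Vel) (ν : Vel) = (1 : ℝ) := by
    rw [real_inner_self_eq_norm_sq, norm_eq_of_mem_sphere]
    norm_num
  have hinv : collMap (ν : Vel) ∘ₗ collMap (ν : Vel) = LinearMap.id := by
    refine LinearMap.ext fun q => Prod.ext ?_ ?_ <;>
    · simp only [collMap, LinearMap.comp_apply, LinearMap.coe_mk, AddHom.coe_mk, LinearMap.id_apply,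
        inner_add_right, inner_sub_right, inner_smul_right, hν]
      module
  refine Measure.LinearMap.quasiMeasurePreserving _ _ fun h0 => ?_
  have := congrArg LinearMap.det hinv
  rw [LinearMap.det_comp, h0, LinearMap.det_id] at this
  norm_num at this

lemma measurable_preVel : Measurable fun q : Vel × (Sph × Vel) => preVel q.1 q.2 := by
  unfold preVel
  fun_prop

lemma ae_preVel {P : Phase → Prop} (hP : MeasurableSet {z | P z})
    (h : ∀ᵐ z ∂(volume : Measure Phase), P z) :
    ∀ᵐ z ∂(volume : Measure Phase), ∀ᵐ p ∂collMeasure, P (z.1, preVel z.2 p) := by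
  have hx : ∀ᵐ x ∂(volume : Measure Torus), ∀ᵐ v ∂(volume : Measure Vel), P (x, v) :=
    Measure.ae_ae_of_ae_prod h
  have hmx : ∀ x : Torus, MeasurableSet {q : Vel × (Sph × Vel) | P (x, preVel q.1 q.2)} :=
    fun x => measurableSet_preimage (measurable_const.prodMk measurable_preVel) hP
  have main : ∀ᵐ x ∂(volume : Measure Torus), ∀ᵐ q ∂(volume : Measure Vel).prod collMeasure,
      P (x, preVel q.1 q.2) := by
    filter_upwards [hx] with x hxx
    have h1 : ∀ ν : Sph, ∀ᵐ q ∂((volume : Measure Vel).prod volume), P (x, preVel q.1 (ν, q.2)) :=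
      fun ν => (Measure.quasiMeasurePreserving_fst.comp
        (quasiMeasurePreserving_collMap ν)).ae hxx
    have h2 : ∀ᵐ q ∂sphMeasure.prod ((volume : Measure Vel).prod (volume : Measure Vel)),
        P (x, preVel q.2.1 (q.1, q.2.2)) := by
      rw [Measure.ae_prod_iff_ae_ae]
      · exact Filter.Eventually.of_forall h1
      · exact (measurable_snd.fst.prodMk (measurable_fst.prodMk measurable_snd.snd)) (hmx x)
    have h3 : MeasurePreserving (fun q : Vel × (Sph × Vel) => (q.2.1, (q.1, q.2.2)))
        ((volume : Measure Vel).prod collMeasure)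
        (sphMeasure.prod ((volume : Measure Vel).prod (volume : Measure Vel))) := by
      have a := (measurePreserving_prodAssoc (volume : Measure Vel) sphMeasure
        (volume : Measure Vel)).symm MeasurableEquiv.prodAssoc
      have b := (Measure.measurePreserving_swap (μ := (volume : Measure Vel))
        (ν := sphMeasure)).prod (MeasurePreserving.id (volume : Measure Vel))
      have c := measurePreserving_prodAssoc sphMeasure (volume : Measure Vel)
        (volume : Measure Vel)
      exact c.comp (b.comp a)
    exact h3.quasiMeasurePreserving.ae h2
  have main2 : ∀ᵐ q ∂(volume : Measure Torus).prod ((volume : Measure Vel).prod collMeasure),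
      P (q.1, preVel q.2.1 q.2.2) := by
    rw [Measure.ae_prod_iff_ae_ae]
    · exact main
    · exact (measurable_fst.prodMk (measurable_preVel.comp measurable_snd)) hP
  have main3 := (measurePreserving_prodAssoc (volume : Measure Torus) (volume : Measure Vel)
    collMeasure).quasiMeasurePreserving.ae main2
  exact Measure.ae_ae_of_ae_prod main3

lemma gainIntegrand_add (g : L1Vel) (f f' : L1Phase) :
    ∀ᵐ z ∂(volume : Measure Phase), gainIntegrand g (f + f') z =ᵐ[collMeasure]
      fun p => gainIntegrand g f z p + gainIntegrand g f' z p := by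
  have hm : MeasurableSet {z | (f + f') z = f z + f' z} :=
    measurableSet_eq_fun (Lp.stronglyMeasurable _).measurable
      ((Lp.stronglyMeasurable f).measurable.add (Lp.stronglyMeasurable f').measurable)
  filter_upwards [ae_preVel hm (Lp.coeFn_add f f')] with z hz
  filter_upwards [hz] with p hp
  simp only [gainIntegrand, hp]
  ring

lemma gainIntegrand_smul (g : L1Vel) (c : ℝ) (f : L1Phase) :
    ∀ᵐ z ∂(volume : Measure Phase), gainIntegrand g (c • f) z =ᵐ[collMeasure]
      fun p => c * gainIntegrand g f z p := by
  have hm : MeasurableSet {z | (c • f) z = c * f z} :=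
    measurableSet_eq_fun (Lp.stronglyMeasurable _).measurable
      ((Lp.stronglyMeasurable f).measurable.const_mul c)
  filter_upwards [ae_preVel hm (Lp.coeFn_smul c f)] with z hz
  filter_upwards [hz] with p hp
  simp only [gainIntegrand, hp]
  ring

lemma GainIntegrable.gain_add {g : L1Vel} {f f' : L1Phase} (H : GainIntegrable g f)
    (H' : GainIntegrable g f') :
    gain g (f + f') =ᵐ[volume] fun z => gain g f z + gain g f' z := by
  filter_upwards [gainIntegrand_add g f f', H.1, H'.1] with z hz h1 h2
  exact (integral_congr_ae hz).trans (integral_add h1 h2)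

lemma gain_smul (g : L1Vel) (c : ℝ) (f : L1Phase) :
    gain g (c • f) =ᵐ[volume] fun z => c * gain g f z := by
  filter_upwards [gainIntegrand_smul g c f] with z hz
  exact (integral_congr_ae hz).trans (integral_const_mul c _)

lemma GainIntegrable.add {g : L1Vel} {f f' : L1Phase} (H : GainIntegrable g f)
    (H' : GainIntegrable g f') : GainIntegrable g (f + f') := by
  refine ⟨?_, (H.2.add H'.2).congr (H.gain_add H').symm⟩
  filter_upwards [gainIntegrand_add g f f', H.1, H'.1] with z hz h1 h2
  exact (h1.add h2).congr hz.symm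

lemma GainIntegrable.smul {g : L1Vel} {f : L1Phase} (c : ℝ) (H : GainIntegrable g f) :
    GainIntegrable g (c • f) := by
  refine ⟨?_, (H.2.const_mul c).congr (gain_smul g c f).symm⟩
  filter_upwards [gainIntegrand_smul g c f, H.1] with z hz h1
  exact (h1.const_mul c).congr hz.symm

lemma gainIntegrable_zero (g : L1Vel) : GainIntegrable g 0 := by
  have h0 : ∀ᵐ z ∂(volume : Measure Phase), gainIntegrand g 0 z =ᵐ[collMeasure] fun _ => 0 := by
    simpa using gainIntegrand_smul g 0 0
  have h1 : gain g 0 =ᵐ[volume] fun _ => 0 := by simpa using gain_smul g 0 0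
  refine ⟨?_, (integrable_zero _ _ _).congr h1.symm⟩
  filter_upwards [h0] with z hz
  exact (integrable_zero _ _ _).congr hz.symm

/-- `Q⁺[f]` as an element of `L¹(U × ℝ³)`. -/
def GainIntegrable.toL1 {g : L1Vel} {f : L1Phase} (H : GainIntegrable g f) : L1Phase :=
  Integrable.toL1 (gain g f) H.2

lemma GainIntegrable.coeFn_toL1 {g : L1Vel} {f : L1Phase} (H : GainIntegrable g f) :
    H.toL1 =ᵐ[volume] gain g f := Integrable.coeFn_toL1 H.2

lemma toL1_add {g : L1Vel} {f f' : L1Phase} (H : GainIntegrable g f) (H' : GainIntegrable g f') :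
    (H.add H').toL1 = H.toL1 + H'.toL1 := by
  refine Lp.ext ?_
  filter_upwards [(H.add H').coeFn_toL1, H.coeFn_toL1, H'.coeFn_toL1, H.gain_add H',
    Lp.coeFn_add H.toL1 H'.toL1] with z h1 h2 h3 h4 h5
  rw [h1, h5, Pi.add_apply, h2, h3, h4]

lemma toL1_smul {g : L1Vel} {f : L1Phase} (c : ℝ) (H : GainIntegrable g f) :
    (H.smul c).toL1 = c • H.toL1 := by
  refine Lp.ext ?_
  filter_upwards [(H.smul c).coeFn_toL1, H.coeFn_toL1, gain_smul g c f,
    Lp.coeFn_smul c H.toL1] with z h1 h2 h3 h4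
  rw [h1, h4, Pi.smul_apply, h2, h3, smul_eq_mul]

/-- The operator `B f = Q⁺[f]` with domain `D(B) = {f ∈ L¹ : Q⁺[f] ∈ L¹}`. -/
def opB (g : L1Vel) : L1Phase →ₗ.[ℝ] L1Phase where
  domain :=
    { carrier := {f | GainIntegrable g f}
      add_mem' := fun h h' => h.add h'
      zero_mem' := gainIntegrable_zero g
      smul_mem' := fun c _ h => h.smul c }
  toFun :=
    { toFun := fun f => f.2.toL1
      map_add' := fun f f' => toL1_add f.2 f'.2
      map_smul' := fun c f => toL1_smul c f.2 }

lemma opB_graph {g : L1Vel} {f h : L1Phase} :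
    (f, h) ∈ (opB g).graph ↔ GainIntegrable g f ∧ h =ᵐ[volume] gain g f := by
  rw [LinearPMap.mem_graph_iff]
  constructor
  · rintro ⟨y, rfl, rfl⟩
    exact ⟨y.2, GainIntegrable.coeFn_toL1 y.2⟩
  · rintro ⟨H, hh⟩
    exact ⟨⟨f, H⟩, rfl, Lp.ext ((GainIntegrable.coeFn_toL1 H).trans hh.symm)⟩

/-! ### Mild solutions and admissible data -/

/-- `u : [0,T] → L¹(U × ℝ³)` is a mild solution of `∂ₜ u = L u`, `u(0) = u₀`: for all `t ∈ [0,T]`,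
`∫₀ᵗ u(θ) dθ ∈ D(L)` and `L ∫₀ᵗ u(θ) dθ = u(t) - u₀`. The integral is a Bochner integral, so `u`
has to be integrable. Only the values of `u` on `[0,T]` matter. -/
structure IsMildSolution (L : L1Phase →ₗ.[ℝ] L1Phase) (u₀ : L1Phase) (T : ℝ)
    (u : ℝ → L1Phase) : Prop where
  integrable : IntegrableOn u (Icc 0 T) volume
  mild : ∀ t ∈ Icc 0 T, ∃ h : (∫ θ in (0 : ℝ)..t, u θ) ∈ L.domain,
    L ⟨∫ θ in (0 : ℝ)..t, u θ, h⟩ = u t - u₀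

/-- Admissible data. For `η = 1` the last condition reads `ess sup g₀(v) (1 + |v|⁴) < ∞`. -/
structure Admissible (η : ℝ) (f₀ : L1Phase) (g₀ : L1Vel) : Prop where
  f_nonneg : 0 ≤ f₀
  f_mass : ∫ z, f₀ z = 1
  g_nonneg : 0 ≤ g₀
  g_mass : ∫ v, g₀ v = 1
  f_moment : Integrable (fun z : Phase => f₀ z * (1 + ‖z.2‖ ^ 2)) volume
  g_moment : Integrable (fun v : Vel => g₀ v * (1 + ‖v‖ ^ 2)) volume
  g_bound : ∃ C : ℝ, ∀ᵐ v ∂(volume : Measure Vel), g₀ v * (1 + ‖v‖ ^ (3 + η)) ≤ C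

end LinBoltz

end

noncomputable section

namespace LinBoltz

open Filter Topology
open scoped ENNReal

/-! ### Lower semicontinuous extended seminorms -/

/-! The loss part `A` is inverted explicitly. `R = (λ - A)⁻¹` integrates along backward free
trajectories with damping `exp(-(λ + σ(v)) t)`, where `σ` is the collision frequency. The gain `B`
is as strong as the loss: the collision change of variables preserves the measure, so the integral
of `Q⁺[f]` equals that of `Q⁻[f]`, and `‖Q⁺[f]‖ ≤ ‖Q⁻[f]‖`. Hence `B` is no small perturbation. What
remains is the borderline estimate `λ‖R h‖ + ‖B R h‖ ≤ ‖h‖`. With `M = B R` it telescopes, so the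
series `J = ∑ R Mᵏ` converges and `λ‖J‖ ≤ 1` (Kato's method).

For `J` to invert `λ - L` with `L` the closure of `A + B`, the remainders `Mⁿ x` must tend to `0`.
This needs a Lyapunov functional, here `N(f) = ∫ |f| (1 + |v|)`. By conservation of energy, a
collision can raise the speed only by an amount controlled by the background velocity
(`collKernel_mul_preVel_le`), whence `N(M x) + λ N(R x) ≤ N(x) + C‖R x‖`. Summation gives `∑ N(R Mᵏ
x) < ∞` when `N(x) < ∞`. Since `σ` grows at most linearly, `‖M x‖ ≤ c N(R x)`, so `∑ Mᵏ x` converges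
absolutely for such `x`. By density and contractivity, `Mⁿ x → 0` for every `x`
(`IsKatoPair.tendsto_pow`). That `R` is also a left inverse rests on injectivity of `λ - A` on its
distributional domain, proved mode by mode with Fourier series in the position
(`eq_zero_of_isTransportLoss`).

The contractive resolvents `J` give a mild solution for the closure, as the limit of the Yosida
exponentials `exp(t(λ²J - λ))` (`exists_mild`), and dissipativity gives uniqueness (`mild_unique`).
Positivity, mass and the bound on `N` hold for `J`, pass to the exponentials through the power
series, and survive the limit because the cone is closed, the mass is continuous and `N` is lower
semicontinuous.

It remains to remove the closure. If `(x, y)` lies in the closed graph and `N(x), N(y) < ∞`, then `x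
= J(x - y) = R(∑ Mᵏ(x - y))` at `λ = 1`, so `x` lies in the range of `R` and hence in `D(A) ∩ D(B)`
(`mem_graph_of_weightNorm`). The time integral of the solution is such an `x`, with `y = f_t - f_0`.
-/

/-- A lower semicontinuous seminorm with values in `[0, ⊤]`. -/
structure IsLscSeminorm {X : Type*} [NormedAddCommGroup X] [NormedSpace ℝ X] (N : X → ℝ≥0∞) :
    Prop where
  add_le : ∀ x y, N (x + y) ≤ N x + N y
  smul_le : ∀ (r : ℝ) x, N (r • x) ≤ ENNReal.ofReal |r| * N x
  lsc : LowerSemicontinuous N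

/-! ### Abstract generation theory in a Banach space. -/

section Abstract

variable {X : Type*} [NormedAddCommGroup X] [NormedSpace ℝ X]

namespace IsLscSeminorm

variable {N : X → ℝ≥0∞}

lemma zero (hN : IsLscSeminorm N) : N 0 = 0 := by
  simpa using hN.smul_le 0 0

lemma sum_le (hN : IsLscSeminorm N) {ι : Type*} (s : Finset ι) (f : ι → X) :
    N (∑ i ∈ s, f i) ≤ ∑ i ∈ s, N (f i) := by
  classical
  induction s using Finset.induction_on with
  | empty => simp [hN.zero]
  | insert a s ha ih =>
    rw [Finset.sum_insert ha, Finset.sum_insert ha]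
    exact (hN.add_le _ _).trans (by gcongr)

lemma le_of_tendsto (hN : IsLscSeminorm N) {ι : Type*} {l : Filter ι} [l.NeBot] {f : ι → X} {a : X}
    (h : Tendsto f l (𝓝 a)) {c : ℝ≥0∞} (hc : ∀ᶠ i in l, N (f i) ≤ c) : N a ≤ c :=
  (hN.lsc.isClosed_preimage c).mem_of_tendsto h hc

lemma le_tsum_of_hasSum (hN : IsLscSeminorm N) {f : ℕ → X} {a : X} (h : HasSum f a) :
    N a ≤ ∑' i, N (f i) :=
  hN.le_of_tendsto (l := atTop) h
    (Eventually.of_forall fun s => (hN.sum_le s f).trans (ENNReal.sum_le_tsum s))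

lemma sub_lt_top (hN : IsLscSeminorm N) {x y : X} (hx : N x < ⊤) (hy : N y < ⊤) :
    N (x - y) < ⊤ := by
  have h1 : N (-y) < ⊤ := by
    have := hN.smul_le (-1) y
    simp only [neg_smul, one_smul, abs_neg, abs_one, ENNReal.ofReal_one, one_mul] at this
    exact this.trans_lt hy
  rw [sub_eq_add_neg]
  exact (hN.add_le _ _).trans_lt (ENNReal.add_lt_top.2 ⟨hx, h1⟩)

lemma smul_lt_top (hN : IsLscSeminorm N) (r : ℝ) {x : X} (hx : N x < ⊤) : N (r • x) < ⊤ :=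
  (hN.smul_le r x).trans_lt (ENNReal.mul_lt_top ENNReal.ofReal_lt_top hx)

lemma convex_sublevel (hN : IsLscSeminorm N) (c : ℝ≥0∞) : Convex ℝ {x | N x ≤ c} := by
  intro x hx y hy a b ha hb hab
  calc N (a • x + b • y) ≤ N (a • x) + N (b • y) := hN.add_le _ _
    _ ≤ ENNReal.ofReal |a| * c + ENNReal.ofReal |b| * c := by
        gcongr
        · exact (hN.smul_le a x).trans (by gcongr; exact hx)
        · exact (hN.smul_le b y).trans (by gcongr; exact hy)
    _ = c := by
        rw [abs_of_nonneg ha, abs_of_nonneg hb, ← add_mul, ← ENNReal.ofReal_add ha hb, hab]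
        simp

/-- Sublevel sets of `N` are closed and convex, so they contain averages of functions with values in
them; the integral is `t` times such an average. -/
lemma intervalIntegral_lt_top [CompleteSpace X] (hN : IsLscSeminorm N) {f : ℝ → X} {t : ℝ}
    (ht : 0 ≤ t) (hf : IntegrableOn f (Ioc 0 t)) {c : ℝ≥0∞} (hc : c < ⊤)
    (hfc : ∀ s ∈ Ioc 0 t, N (f s) ≤ c) : N (∫ s in (0 : ℝ)..t, f s) < ⊤ := by
  rcases ht.eq_or_lt with rfl | ht
  · simp [hN.zero]
  have hm := (hN.convex_sublevel c).set_average_mem (μ := volume) (t := Ioc 0 t)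
    (hN.lsc.isClosed_preimage c) (by simp [ht]) (by simp)
    ((ae_restrict_iff' measurableSet_Ioc).2 (Eventually.of_forall hfc)) hf
  rw [intervalIntegral.integral_of_le ht.le]
  have e : ∫ s in Ioc 0 t, f s = t • ⨍ s in Ioc 0 t, f s := by
    rw [setAverage_eq, smul_smul]
    simp [ht.le, ht.ne']
  rw [e]
  exact hN.smul_lt_top _ (lt_of_le_of_lt hm hc)

end IsLscSeminorm

lemma isLscSeminorm_enorm : IsLscSeminorm (fun x : X => ‖x‖ₑ) where
  add_le := enorm_add_le
  smul_le r x := by rw [enorm_smul, Real.enorm_eq_ofReal_abs]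
  lsc := continuous_enorm.lowerSemicontinuous

/-! ### Resolvent families -/

/-- `J λ` inverts `λ - L̄` for every `λ > 0`, with `‖J λ‖ ≤ 1 / λ`, and `L` is densely defined. -/
structure IsResolventFamily (L : X →ₗ.[ℝ] X) (J : ℝ → X →L[ℝ] X) : Prop where
  norm_le : ∀ lam, 0 < lam → ∀ x, lam * ‖J lam x‖ ≤ ‖x‖
  mem_closure : ∀ lam, 0 < lam → ∀ x, (J lam x, lam • J lam x - x) ∈ closure (L.graph : Set (X × X))
  left_inv : ∀ lam, 0 < lam → ∀ p ∈ L.graph, J lam (lam • p.1 - p.2) = p.1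
  dense : Dense (L.domain : Set X)

namespace IsResolventFamily

variable {L : X →ₗ.[ℝ] X} {J : ℝ → X →L[ℝ] X}

/-- The closed graph is the solution set of an equation in the bounded operator `J λ`, for any
single `λ`. Later arguments about the closure use this equation instead of approximating sequences.
-/
lemma mem_closure_iff (hJ : IsResolventFamily L J) {lam : ℝ} (hlam : 0 < lam) {p : X × X} :
    p ∈ closure (L.graph : Set (X × X)) ↔ J lam (lam • p.1 - p.2) = p.1 := by
  constructor
  · intro hp
    have hc : IsClosed {p : X × X | J lam (lam • p.1 - p.2) = p.1} :=
      isClosed_eq (by fun_prop) (by fun_prop)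
    exact closure_minimal (fun p hp => hJ.left_inv lam hlam p hp) hc hp
  · intro hp
    have := hJ.mem_closure lam hlam (lam • p.1 - p.2)
    rw [hp] at this
    simpa using this

lemma norm_smul_le (hJ : IsResolventFamily L J) {lam : ℝ} (hlam : 0 < lam) (x : X) :
    ‖lam • J lam x‖ ≤ ‖x‖ := by
  rw [norm_smul, Real.norm_of_nonneg hlam.le]
  exact hJ.norm_le lam hlam x

/-- For `y` in the domain, `λ J y - y = J (L y)` has norm at most `‖L y‖ / λ`. The operators `λ J`
are contractions, so density extends the limit to all `x`. -/
lemma tendsto_smul (hJ : IsResolventFamily L J) (x : X) :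
    Tendsto (fun n : ℕ => ((n : ℝ) + 1) • J (n + 1) x) atTop (𝓝 x) := by
  rw [Metric.tendsto_atTop]
  intro ε hε
  obtain ⟨y, hy, hxy⟩ := hJ.dense.exists_dist_lt x (show 0 < ε / 3 by positivity)
  obtain ⟨z, hz⟩ := LinearPMap.mem_domain_iff.1 hy
  obtain ⟨n₀, hn₀⟩ := exists_nat_gt (‖z‖ / (ε / 3))
  refine ⟨n₀, fun n hn => ?_⟩
  have hn1 : (0 : ℝ) < n + 1 := by positivity
  have h1 : ((n : ℝ) + 1) • J (n + 1) y - y = J (n + 1) z := by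
    have := hJ.left_inv (n + 1) hn1 _ hz
    simp only [map_sub, map_smul] at this
    rw [sub_eq_iff_eq_add', ← sub_eq_iff_eq_add, this]
  have h2 : ‖J (n + 1) z‖ < ε / 3 := by
    have := hJ.norm_le (n + 1) hn1 z
    have h3 : ‖z‖ < (n + 1) * (ε / 3) := by
      rw [div_lt_iff₀ (by positivity)] at hn₀
      refine hn₀.trans_le ?_
      gcongr
      have : (n₀ : ℝ) ≤ n := by exact_mod_cast hn
      linarith
    exact lt_of_mul_lt_mul_left (this.trans_lt h3) hn1.le
  rw [dist_eq_norm] at hxy ⊢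
  have h4 : ((n : ℝ) + 1) • J (n + 1) x - x = ((n : ℝ) + 1) • J (n + 1) (x - y)
      + J (n + 1) z - (x - y) := by
    rw [← h1, map_sub, smul_sub]
    abel
  rw [h4]
  have h5 := hJ.norm_smul_le hn1 (x - y)
  calc _ ≤ ‖((n : ℝ) + 1) • J (n + 1) (x - y)‖ + ‖J (n + 1) z‖ + ‖x - y‖ :=
        (norm_sub_le _ _).trans (by gcongr; exact norm_add_le _ _)
    _ < ε := by linarith

/-- Such a `y` satisfies `J λ y = 0` for every `λ`, while `λ J λ y → y`. This is what makes `L`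
closable. -/
lemma snd_eq_zero (hJ : IsResolventFamily L J) {y : X}
    (hy : ((0 : X), y) ∈ closure (L.graph : Set (X × X))) : y = 0 := by
  refine tendsto_nhds_unique (hJ.tendsto_smul y) (tendsto_const_nhds.congr fun n => ?_)
  have := (hJ.mem_closure_iff (show (0 : ℝ) < n + 1 by positivity)).1 hy
  simp only [smul_zero, zero_sub, map_neg, neg_eq_zero] at this
  simp [this]

lemma isClosable (hJ : IsResolventFamily L J) : L.IsClosable := by
  refine ⟨L.graph.topologicalClosure.toLinearPMap, (Submodule.toLinearPMap_graph_eq _ ?_).symm⟩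
  rintro ⟨x, y⟩ hxy (rfl : x = 0)
  exact hJ.snd_eq_zero hxy

lemma mem_graph_closure_iff (hJ : IsResolventFamily L J) {p : X × X} :
    p ∈ L.closure.graph ↔ p ∈ closure (L.graph : Set (X × X)) := by
  rw [← hJ.isClosable.graph_closure_eq_closure_graph]
  rfl

/-- Both orders of composition come from the resolvent identity `key`, divided by `λ - μ`. -/
lemma commute (hJ : IsResolventFamily L J) {lam μ : ℝ} (hl : 0 < lam) (hm : 0 < μ) :
    Commute (J lam) (J μ) := by
  have key : ∀ {a b : ℝ}, 0 < a → 0 < b → ∀ x, J b x = (a - b) • J a (J b x) + J a x := by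
    intro a b ha hb x
    have := (hJ.mem_closure_iff ha).1 (hJ.mem_closure b hb x)
    simp only [map_sub, map_smul] at this
    conv_lhs => rw [← this]
    module
  rcases eq_or_ne lam μ with rfl | hne
  · exact Commute.refl _
  ext x
  have h1 := key hl hm x
  have h2 := key hm hl x
  have h3 : (lam - μ) • J lam (J μ x) = (lam - μ) • J μ (J lam x) := by
    have : (lam - μ) • J lam (J μ x) = J μ x - J lam x := by
      conv_rhs => rw [h1]
      abel
    rw [this]
    conv_lhs => rw [h2]
    module
  exact smul_right_injective X (sub_ne_zero.2 hne) h3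

/-- This is the contraction bound for `J` at `λ = 1/s`, applied to `x = J(s⁻¹ x - y)`. -/
lemma dissipative (hJ : IsResolventFamily L J) {x y : X}
    (h : (x, y) ∈ closure (L.graph : Set (X × X))) {s : ℝ} (hs : 0 < s) : ‖x‖ ≤ ‖x - s • y‖ := by
  have h1 := (hJ.mem_closure_iff (inv_pos.2 hs)).1 h
  have h2 := hJ.norm_le s⁻¹ (inv_pos.2 hs) (s⁻¹ • x - y)
  simp only at h1
  rw [h1] at h2
  have h3 : s⁻¹ • x - y = s⁻¹ • (x - s • y) := by
    rw [smul_sub, smul_smul, inv_mul_cancel₀ hs.ne', one_smul]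
  rw [h3, norm_smul, Real.norm_of_nonneg (inv_pos.2 hs).le] at h2
  exact le_of_mul_le_mul_left h2 (inv_pos.2 hs)

/-- The Yosida approximation `λ² J - λ`. -/
def yosida (J : ℝ → X →L[ℝ] X) (lam : ℝ) : X →L[ℝ] X :=
  lam ^ 2 • J lam - lam • (1 : X →L[ℝ] X)

lemma yosida_apply (J : ℝ → X →L[ℝ] X) (lam : ℝ) (x : X) :
    yosida J lam x = lam • (lam • J lam x) - lam • x := by
  simp [yosida, sq, smul_smul]

lemma yosida_mem (hJ : IsResolventFamily L J) {lam : ℝ} (hlam : 0 < lam) (x : X) :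
    (lam • J lam x, yosida J lam x) ∈ closure (L.graph : Set (X × X)) := by
  rw [hJ.mem_closure_iff hlam, yosida_apply]
  simp

lemma yosida_eq (hJ : IsResolventFamily L J) {lam : ℝ} (hlam : 0 < lam) {x y : X}
    (h : (x, y) ∈ L.graph) : yosida J lam x = lam • J lam y := by
  have := hJ.left_inv lam hlam _ h
  simp only [map_sub, map_smul] at this
  rw [yosida_apply, ← smul_sub]
  congr 1
  rw [sub_eq_iff_eq_add', ← sub_eq_iff_eq_add, this]

lemma commute_yosida (hJ : IsResolventFamily L J) {a b : ℝ} (ha : 0 < a) (hb : 0 < b) :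
    Commute (yosida J a) (yosida J b) := by
  have h := hJ.commute ha hb
  unfold yosida
  refine Commute.sub_left (Commute.smul_left ?_ _) (Commute.smul_left (Commute.one_left _) _)
  exact Commute.sub_right (Commute.smul_right h _) (Commute.smul_right (Commute.one_right _) _)

/-! ### Uniqueness of mild solutions -/

/-- Dissipativity gives `‖Z(t)‖ ≤ ‖Z(t) - s W(t)‖ = ‖Z(t - s)‖ + o(s)`, so `‖Z‖` cannot increase.
Only derivatives from the left enter. -/
lemma eq_zero_of_hasDerivAt (hJ : IsResolventFamily L J) {T : ℝ} {Z W : ℝ → X}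
    (hZ : ContinuousOn Z (Icc 0 T)) (h0 : Z 0 = 0)
    (hd : ∀ t ∈ Ioc 0 T, HasDerivWithinAt Z (W t) (Iic t) t)
    (hmem : ∀ t ∈ Icc 0 T, (Z t, W t) ∈ closure (L.graph : Set (X × X))) :
    ∀ t ∈ Icc 0 T, Z t = 0 := by
  intro t ht
  have hmaps : MapsTo (fun s => t - s) (Icc 0 t) (Icc 0 T) := fun s hs =>
    ⟨by linarith [hs.2], by linarith [hs.1, ht.2]⟩
  have hc : ContinuousOn (fun s => -‖Z (t - s)‖) (Icc 0 t) :=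
    (hZ.comp (by fun_prop) hmaps).norm.neg
  -- The comparison principle concerns right slopes, so time runs backwards from `t`. The barrier is
  -- the constant `-‖Z t‖`, and the conclusion at `s = t` reads `-‖Z 0‖ ≤ -‖Z t‖`.
  have main := image_le_of_liminf_slope_right_le_deriv_boundary (f := fun s => -‖Z (t - s)‖)
    (a := 0) (b := t) hc (B := fun _ => -‖Z t‖) (B' := fun _ => 0) (by simp) continuousOn_const
    (fun s _ => hasDerivWithinAt_const _ _ _) ?_ (right_mem_Icc.2 ht.1)
  · simp only [sub_self, h0, norm_zero, neg_zero] at main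
    exact norm_le_zero_iff.1 (by linarith)
  intro s hs r hr
  have hs' : t - s ∈ Ioc 0 T := ⟨by linarith [hs.2], by linarith [hs.1, ht.2]⟩
  have hlo := (hasDerivWithinAt_iff_isLittleO.1 (hd _ hs')).def (show 0 < r / 2 by positivity)
  have hev : ∀ᶠ z in 𝓝[>] s, t - z ∈ {u | ‖Z u - Z (t - s) - (u - (t - s)) • W (t - s)‖
      ≤ r / 2 * ‖u - (t - s)‖} := by
    have htend : Tendsto (fun z => t - z) (𝓝[>] s) (𝓝[≤] (t - s)) := by
      refine tendsto_nhdsWithin_iff.2 ⟨?_, ?_⟩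
      · exact (Continuous.tendsto (by fun_prop) s).mono_left nhdsWithin_le_nhds
      · filter_upwards [self_mem_nhdsWithin] with z hz
        have : s < z := hz
        exact mem_Iic.2 (by linarith)
    exact htend hlo
  refine Eventually.frequently ?_
  filter_upwards [hev, self_mem_nhdsWithin] with z hz hzs
  have hzs' : 0 < z - s := sub_pos.2 hzs
  have e1 : t - z - (t - s) = -(z - s) := by ring
  simp only [e1, norm_neg, Real.norm_of_nonneg hzs'.le] at hz
  have hdis := hJ.dissipative (hmem _ ⟨hs'.1.le, hs'.2⟩) hzs'
  have h3 : ‖Z (t - s) - (z - s) • W (t - s)‖ ≤ ‖Z (t - z)‖ + r / 2 * (z - s) := by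
    have : Z (t - s) - (z - s) • W (t - s)
        = Z (t - z) - (Z (t - z) - Z (t - s) - (-(z - s)) • W (t - s)) := by module
    rw [this]
    exact (norm_sub_le _ _).trans (by gcongr)
  rw [slope_def_field, div_lt_iff₀ hzs']
  nlinarith

/-- As `w` is only integrable, its primitive `W` need not be differentiable at every time. A second
integration gives a function `Z` with derivative `W` that still solves the equation, so `Z = 0`.
Then `(0, W t)` and afterwards `(0, w t)` lie in the closed graph, which forces both to vanish. -/
lemma mild_unique [CompleteSpace X] (hJ : IsResolventFamily L J) {T : ℝ} {w : ℝ → X}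
    (hw : IntegrableOn w (Icc 0 T))
    (hmem : ∀ t ∈ Icc 0 T, (∫ s in (0 : ℝ)..t, w s, w t) ∈ closure (L.graph : Set (X × X))) :
    ∀ t ∈ Icc 0 T, w t = 0 := by
  intro t₀ ht₀
  have hT : 0 ≤ T := ht₀.1.trans ht₀.2
  set W : ℝ → X := fun t => ∫ s in (0 : ℝ)..t, w s with hWdef
  have hW : ContinuousOn W (Icc 0 T) := by
    have := intervalIntegral.continuousOn_primitive_interval (μ := volume) (f := w) (a := 0)
      (b := T) (by rwa [uIcc_of_le hT])
    rwa [uIcc_of_le hT] at this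
  have hWi : ∀ t ∈ Icc 0 T, IntervalIntegrable W volume 0 t := fun t ht =>
    ContinuousOn.intervalIntegrable (by
      rw [uIcc_of_le ht.1]
      exact hW.mono (Icc_subset_Icc_right ht.2))
  have hwi : ∀ t ∈ Icc 0 T, IntervalIntegrable w volume 0 t := fun t ht => by
    rw [intervalIntegrable_iff_integrableOn_Icc_of_le ht.1]
    exact hw.mono_set (Icc_subset_Icc_right ht.2)
  have hZmem : ∀ t ∈ Icc 0 T,
      (∫ s in (0 : ℝ)..t, W s, W t) ∈ closure (L.graph : Set (X × X)) := by
    intro t ht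
    rw [hJ.mem_closure_iff one_pos]
    -- The closed operator is moved through the integral by way of the bounded operator `J 1`.
    have h1 : ∫ s in (0 : ℝ)..t, W s = ∫ s in (0 : ℝ)..t, J 1 ((1 : ℝ) • W s - w s) := by
      refine intervalIntegral.integral_congr fun s hs => ?_
      rw [uIcc_of_le ht.1] at hs
      exact ((hJ.mem_closure_iff one_pos).1 (hmem s ⟨hs.1, hs.2.trans ht.2⟩)).symm
    simp only [one_smul] at h1 ⊢
    rw [ContinuousLinearMap.intervalIntegral_comp_comm _ ((hWi t ht).sub (hwi t ht)),
      intervalIntegral.integral_sub (hWi t ht) (hwi t ht)] at h1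
    exact h1.symm
  have hZ0 : ∀ t ∈ Icc 0 T, ∫ s in (0 : ℝ)..t, W s = 0 := by
    refine hJ.eq_zero_of_hasDerivAt (Z := fun t => ∫ s in (0 : ℝ)..t, W s) (W := W) ?_ (by simp) ?_
      hZmem
    · have := intervalIntegral.continuousOn_primitive_interval (μ := volume) (f := W) (a := 0)
        (b := T) (by rw [uIcc_of_le hT]; exact hW.integrableOn_Icc)
      rwa [uIcc_of_le hT] at this
    · intro t ht
      have htT : t ∈ Icc 0 T := ⟨ht.1.le, ht.2⟩
      have hWt : ContinuousWithinAt W (Iic t) t := by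
        have h1 : ContinuousWithinAt W (Icc 0 t) t :=
          (hW t htT).mono (Icc_subset_Icc_right ht.2)
        exact h1.mono_of_mem_nhdsWithin (Icc_mem_nhdsLE ht.1)
      refine intervalIntegral.integral_hasDerivWithinAt_right (hWi t htT) ?_ hWt
      refine ⟨Icc 0 t, Icc_mem_nhdsLE ht.1, ?_⟩
      exact (hW.mono (Icc_subset_Icc_right ht.2)).aestronglyMeasurable measurableSet_Icc
  have hW0 : ∀ t ∈ Icc 0 T, W t = 0 := fun t ht =>
    hJ.snd_eq_zero (by rw [← hZ0 t ht]; exact hZmem t ht)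
  exact hJ.snd_eq_zero (by rw [← hW0 t₀ ht₀]; exact hmem t₀ ht₀)

end IsResolventFamily

/-! ### Exponentials of bounded operators -/

variable [CompleteSpace X]

lemma hasSum_exp_apply (J : X →L[ℝ] X) (s : ℝ) (x : X) :
    HasSum (fun k : ℕ => ((k.factorial : ℝ)⁻¹ * s ^ k) • (J ^ k) x) (NormedSpace.exp (s • J) x) := by
  have h := (NormedSpace.exp_series_hasSum_exp' (𝕂 := ℝ) (s • J)).mapL
    (ContinuousLinearMap.apply ℝ X x)
  refine h.congr_fun ?_ |> fun h => h
  intro k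
  simp [smul_pow, smul_smul]

lemma IsLscSeminorm.exp_le {N : X → ℝ≥0∞} (hN : IsLscSeminorm N) (J : X →L[ℝ] X) {c s : ℝ}
    (hc : 0 ≤ c) (hs : 0 ≤ s) (h : ∀ x, N (J x) ≤ ENNReal.ofReal c * N x) (x : X) :
    N (NormedSpace.exp (s • J) x) ≤ ENNReal.ofReal (Real.exp (s * c)) * N x := by
  have hk : ∀ k : ℕ, N ((J ^ k) x) ≤ ENNReal.ofReal (c ^ k) * N x := by
    intro k
    induction k with
    | zero => simp
    | succ k ih =>
      rw [pow_succ', pow_succ', ENNReal.ofReal_mul hc, mul_assoc]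
      exact (h _).trans (mul_le_mul_right ih _)
  refine (hN.le_tsum_of_hasSum (hasSum_exp_apply J s x)).trans ?_
  have hs' : HasSum (fun k : ℕ => (k.factorial : ℝ)⁻¹ * s ^ k * c ^ k) (Real.exp (s * c)) := by
    have := NormedSpace.exp_series_hasSum_exp' (𝕂 := ℝ) (s * c)
    rw [← Real.exp_eq_exp_ℝ] at this
    simpa [mul_pow, mul_assoc] using this
  rw [← hs'.tsum_eq, ENNReal.ofReal_tsum_of_nonneg (fun k => by positivity) hs'.summable,
    ← ENNReal.tsum_mul_right]
  refine ENNReal.tsum_le_tsum fun k => (hN.smul_le _ _).trans ?_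
  rw [abs_of_nonneg (by positivity), ENNReal.ofReal_mul (p := (k.factorial : ℝ)⁻¹ * s ^ k)
    (by positivity), mul_assoc]
  gcongr
  exact hk k

/-- The exponential `exp(t (λ² J - λ))` of the Yosida approximation built from a resolvent `J`. -/
def yosidaExp (J : X →L[ℝ] X) (lam t : ℝ) : X →L[ℝ] X :=
  NormedSpace.exp (t • (lam ^ 2 • J - lam • (1 : X →L[ℝ] X)))

lemma exp_add_of_commute_real {A B : X →L[ℝ] X} (h : Commute A B) :
    NormedSpace.exp (A + B) = NormedSpace.exp A * NormedSpace.exp B := by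
  let _ : NormedAlgebra ℚ (X →L[ℝ] X) := NormedAlgebra.restrictScalars ℚ ℝ _
  exact NormedSpace.exp_add_of_commute h

/-- Splitting off the scalar `exp(-tλ)` leaves, for `t ≥ 0`, a power series in `J` with nonnegative
coefficients. Invariant cones and seminorm bounds are read off from it. -/
lemma yosidaExp_eq (J : X →L[ℝ] X) (lam t : ℝ) :
    yosidaExp J lam t = Real.exp (-(t * lam)) • NormedSpace.exp ((t * lam ^ 2) • J) := by
  have e : t • (lam ^ 2 • J - lam • (1 : X →L[ℝ] X))
      = (t * lam ^ 2) • J + algebraMap ℝ (X →L[ℝ] X) (-(t * lam)) := by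
    rw [Algebra.algebraMap_eq_smul_one]
    module
  have h1 : NormedSpace.exp (algebraMap ℝ (X →L[ℝ] X) (-(t * lam)))
      = algebraMap ℝ (X →L[ℝ] X) (Real.exp (-(t * lam))) := by
    rw [Real.exp_eq_exp_ℝ]
    exact (NormedSpace.algebraMap_exp_comm (𝕂 := ℝ) (-(t * lam))).symm
  rw [yosidaExp, e, exp_add_of_commute_real (Algebra.commute_algebraMap_right _ _), h1,
    Algebra.algebraMap_eq_smul_one, mul_smul_comm, mul_one]

/-- The growth rate is `-λ + λ² (1 + C/λ)/λ = C`, which no longer depends on `λ`; this uniformity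
lets the bound pass to the limit. -/
lemma IsLscSeminorm.yosidaExp_le {N : X → ℝ≥0∞} (hN : IsLscSeminorm N) (J : X →L[ℝ] X)
    {C lam t : ℝ} (hC : 0 ≤ C) (hlam : 0 < lam) (ht : 0 ≤ t)
    (h : ∀ x, N (J x) ≤ ENNReal.ofReal ((1 + C / lam) / lam) * N x) (x : X) :
    N (yosidaExp J lam t x) ≤ ENNReal.ofReal (Real.exp (t * C)) * N x := by
  rw [yosidaExp_eq, smul_apply]
  refine (hN.smul_le _ _).trans ?_
  have := hN.exp_le J (c := (1 + C / lam) / lam) (s := t * lam ^ 2) (by positivity) (by positivity)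
    h x
  refine (mul_le_mul_right this _).trans ?_
  rw [← mul_assoc, ← ENNReal.ofReal_mul (abs_nonneg _), abs_of_pos (Real.exp_pos _),
    ← Real.exp_add]
  have e : -(t * lam) + t * lam ^ 2 * ((1 + C / lam) / lam) = t * C := by
    field_simp
    ring
  rw [e]

namespace IsResolventFamily

variable {L : X →ₗ.[ℝ] X} {J : ℝ → X →L[ℝ] X}

/-! ### Existence of mild solutions by Yosida approximation -/

lemma norm_yosidaExp_le (hJ : IsResolventFamily L J) {lam t : ℝ} (hlam : 0 < lam) (ht : 0 ≤ t)
    (x : X) : ‖yosidaExp (J lam) lam t x‖ ≤ ‖x‖ := by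
  have := isLscSeminorm_enorm.yosidaExp_le (J lam) (C := 0) le_rfl hlam ht (fun y => ?_) x
  · rw [mul_zero, Real.exp_zero, ENNReal.ofReal_one, one_mul] at this
    simpa [enorm_le_iff_norm_le] using this
  · simp only [zero_div, add_zero]
    rw [← ofReal_norm, ← ofReal_norm, ← ENNReal.ofReal_mul (by positivity)]
    refine ENNReal.ofReal_le_ofReal ?_
    rw [one_div, inv_mul_eq_div, le_div_iff₀ hlam, mul_comm]
    exact hJ.norm_le lam hlam y

/-- The path `F(s) = exp((t - s) Y_b) exp(s Y_a) x` interpolates between the two exponentials. Since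
the Yosida approximations commute, `F'(s)` is a product of two contractions applied to `(Y_a - Y_b)
x`. -/
lemma norm_yosidaExp_sub_le (hJ : IsResolventFamily L J) {a b t : ℝ} (ha : 0 < a) (hb : 0 < b)
    (ht : 0 ≤ t) (x : X) :
    ‖yosidaExp (J a) a t x - yosidaExp (J b) b t x‖ ≤ ‖yosida J a x - yosida J b x‖ * t := by
  set D := yosida J a - yosida J b with hD
  have hcom := hJ.commute_yosida hb ha
  have hcomm : Commute (yosida J b) D := hcom.sub_right (Commute.refl _)
  -- In this equivalent form only one factor depends on `s`.
  let F : ℝ → X := fun s => (NormedSpace.exp (t • yosida J b) * NormedSpace.exp (s • D)) x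
  have hF : ∀ s, F s = yosidaExp (J b) b (t - s) (yosidaExp (J a) a s x) := by
    intro s
    have e1 : t • yosida J b + s • D = (t - s) • yosida J b + s • yosida J a := by
      rw [hD]; module
    simp only [F]
    rw [← exp_add_of_commute_real ((hcomm.smul_left t).smul_right s), e1,
      exp_add_of_commute_real ((hcom.smul_left _).smul_right _)]
    rfl
  have hder : ∀ s, HasDerivAt F
      ((NormedSpace.exp (t • yosida J b) * NormedSpace.exp (s • D)) (D x)) s := by
    intro s
    have h1 := hasDerivAt_exp_smul_const (𝕂 := ℝ) D s
    have h2 := (h1.const_mul (NormedSpace.exp (t • yosida J b)))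
    have h3 := (ContinuousLinearMap.apply ℝ X x).hasFDerivAt.comp_hasDerivAt s h2
    exact h3
  have hF' : ∀ s ∈ Ico 0 t,
      ‖(NormedSpace.exp (t • yosida J b) * NormedSpace.exp (s • D)) (D x)‖ ≤ ‖D x‖ := by
    intro s hs
    have e1 : t • yosida J b + s • D = (t - s) • yosida J b + s • yosida J a := by
      rw [hD]; module
    rw [← exp_add_of_commute_real ((hcomm.smul_left t).smul_right s), e1,
      exp_add_of_commute_real ((hcom.smul_left _).smul_right _)]
    exact (hJ.norm_yosidaExp_le hb (by linarith [hs.2]) _).trans (hJ.norm_yosidaExp_le ha hs.1 _)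
  have := norm_image_sub_le_of_norm_deriv_le_segment' (f := F) (a := 0) (b := t) (C := ‖D x‖)
    (fun s _ => (hder s).hasDerivWithinAt) hF' t (right_mem_Icc.2 ht)
  rw [hF t, hF 0] at this
  simpa [yosidaExp, hD] using this

/-- On the domain, `Y_λ y = λ J (L y)` converges, hence is Cauchy, and the preceding estimate
applies with a factor `t ≤ |T| + 1`. Contractivity carries this to the closure of the domain. -/
lemma uniformCauchySeqOn_yosidaExp (hJ : IsResolventFamily L J) (x : X) (T : ℝ) :
    UniformCauchySeqOn (fun (n : ℕ) t => yosidaExp (J (n + 1)) (n + 1) t x) atTop (Icc 0 T) := by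
  rw [Metric.uniformCauchySeqOn_iff]
  intro ε hε
  obtain ⟨y, hy, hxy⟩ := hJ.dense.exists_dist_lt x (show 0 < ε / 3 by positivity)
  obtain ⟨z, hz⟩ := LinearPMap.mem_domain_iff.1 hy
  rw [dist_eq_norm] at hxy
  have hcau := (hJ.tendsto_smul z).cauchySeq
  rw [Metric.cauchySeq_iff] at hcau
  obtain ⟨n₀, hn₀⟩ := hcau (ε / 3 / (|T| + 1)) (by positivity)
  refine ⟨n₀, fun m hm n hn t ht => ?_⟩
  have hm1 : (0 : ℝ) < m + 1 := by positivity
  have hn1 : (0 : ℝ) < n + 1 := by positivity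
  have h1 := hJ.norm_yosidaExp_sub_le hm1 hn1 ht.1 y
  rw [hJ.yosida_eq hm1 hz, hJ.yosida_eq hn1 hz, ← dist_eq_norm (_ • _)] at h1
  have h2 := hn₀ m hm n hn
  have h3 : ‖yosidaExp (J (m + 1)) (m + 1) t y - yosidaExp (J (n + 1)) (n + 1) t y‖ ≤ ε / 3 := by
    refine h1.trans ?_
    calc _ ≤ ε / 3 / (|T| + 1) * (|T| + 1) := by
          gcongr
          · exact ht.1
          · exact ht.2.trans (by linarith [le_abs_self T])
      _ = ε / 3 := by field_simp
  have h4 := hJ.norm_yosidaExp_le hm1 ht.1 (x - y)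
  have h5 := hJ.norm_yosidaExp_le hn1 ht.1 (x - y)
  rw [dist_eq_norm]
  have e : yosidaExp (J (m + 1)) (m + 1) t x - yosidaExp (J (n + 1)) (n + 1) t x
      = yosidaExp (J (m + 1)) (m + 1) t (x - y)
        + (yosidaExp (J (m + 1)) (m + 1) t y - yosidaExp (J (n + 1)) (n + 1) t y)
        - yosidaExp (J (n + 1)) (n + 1) t (x - y) := by
    simp only [map_sub]; abel
  rw [e]
  refine ((norm_sub_le _ _).trans (add_le_add_left (norm_add_le _ _) _)).trans_lt ?_
  linarith

lemma continuous_apply_exp (G : X →L[ℝ] X) (x : X) :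
    Continuous fun t : ℝ => NormedSpace.exp (t • G) x :=
  continuous_iff_continuousAt.2 fun t =>
    ((ContinuousLinearMap.apply ℝ X x).hasFDerivAt.comp_hasDerivAt t
      (hasDerivAt_exp_smul_const (𝕂 := ℝ) G t)).continuousAt

lemma integral_yosidaExp (J : ℝ → X →L[ℝ] X) (lam t : ℝ) (x : X) :
    yosida J lam (∫ s in (0 : ℝ)..t, yosidaExp (J lam) lam s x)
      = yosidaExp (J lam) lam t x - x := by
  have hc : Continuous fun s : ℝ => yosidaExp (J lam) lam s x :=
    continuous_apply_exp (yosida J lam) x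
  rw [← ContinuousLinearMap.intervalIntegral_comp_comm _ (hc.intervalIntegrable 0 t),
    intervalIntegral.integral_eq_sub_of_hasDerivAt (f := fun s => yosidaExp (J lam) lam s x)
      (f' := fun s => yosida J lam (yosidaExp (J lam) lam s x))
      (fun s _ => ?_) (((yosida J lam).continuous.comp hc).intervalIntegrable 0 t)]
  · simp [yosidaExp]
  · exact (ContinuousLinearMap.apply ℝ X x).hasFDerivAt.comp_hasDerivAt s
      (hasDerivAt_exp_smul_const' (𝕂 := ℝ) (yosida J lam) s)

theorem exists_mild (hJ : IsResolventFamily L J) (x : X) (T : ℝ) :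
    ∃ u : ℝ → X, ContinuousOn u (Icc 0 T) ∧
      (∀ t ∈ Icc 0 T,
        Tendsto (fun n : ℕ => yosidaExp (J (n + 1)) (n + 1) t x) atTop (𝓝 (u t))) ∧
      ∀ t ∈ Icc 0 T,
        (∫ s in (0 : ℝ)..t, u s, u t - x) ∈ closure (L.graph : Set (X × X)) := by
  have hcau := hJ.uniformCauchySeqOn_yosidaExp x T
  have hlim : ∀ t, ∃ y, t ∈ Icc 0 T →
      Tendsto (fun n : ℕ => yosidaExp (J (n + 1)) (n + 1) t x) atTop (𝓝 y) := by
    intro t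
    by_cases ht : t ∈ Icc 0 T
    · obtain ⟨y, hy⟩ := cauchySeq_tendsto_of_complete (hcau.cauchySeq ht)
      exact ⟨y, fun _ => hy⟩
    · exact ⟨0, fun h => absurd h ht⟩
  choose u hu using hlim
  have hunif := hcau.tendstoUniformlyOn_of_tendsto hu
  have hcont : ∀ n : ℕ, Continuous fun t : ℝ => yosidaExp (J (n + 1)) (n + 1) t x := fun n =>
    continuous_apply_exp (yosida J (n + 1)) x
  have huc : ContinuousOn u (Icc 0 T) :=
    hunif.continuousOn (Frequently.of_forall fun n => (hcont n).continuousOn)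
  refine ⟨u, huc, hu, fun t ht => ?_⟩
  set z : ℕ → X := fun n => ∫ s in (0 : ℝ)..t, yosidaExp (J (n + 1)) (n + 1) s x with hz
  have hzlim : Tendsto z atTop (𝓝 (∫ s in (0 : ℝ)..t, u s)) := by
    refine intervalIntegral.tendsto_integral_filter_of_dominated_convergence (fun _ => ‖x‖)
      (Eventually.of_forall fun n => (hcont n).aestronglyMeasurable)
      (Eventually.of_forall fun n => Eventually.of_forall fun s hs => ?_)
      intervalIntegrable_const (Eventually.of_forall fun s hs => ?_)
    · rw [uIoc_of_le ht.1] at hs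
      exact hJ.norm_yosidaExp_le (by positivity) hs.1.le x
    · rw [uIoc_of_le ht.1] at hs
      exact hu s ⟨hs.1.le, hs.2.trans ht.2⟩
  -- The integrals `z n` need not lie in the domain of the closure, so they are replaced by `λ J z
  -- n`, which have the same limit and are paired with `Y_λ z n` in the closed graph.
  have h1 : Tendsto (fun n : ℕ => ((n : ℝ) + 1) • J (n + 1) (z n)) atTop
      (𝓝 (∫ s in (0 : ℝ)..t, u s)) := by
    have h2 : Tendsto (fun n : ℕ => ((n : ℝ) + 1) • J (n + 1) (z n - ∫ s in (0 : ℝ)..t, u s)) atTop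
        (𝓝 0) := by
      refine squeeze_zero_norm (fun n => hJ.norm_smul_le (by positivity) _) ?_
      simpa using (hzlim.sub_const (∫ s in (0 : ℝ)..t, u s)).norm
    have h3 := h2.add (hJ.tendsto_smul (∫ s in (0 : ℝ)..t, u s))
    rw [zero_add] at h3
    refine h3.congr fun n => ?_
    rw [map_sub, smul_sub, sub_add_cancel]
  have h4 : Tendsto (fun n : ℕ => (((n : ℝ) + 1) • J (n + 1) (z n), yosida J (n + 1) (z n))) atTop
      (𝓝 (∫ s in (0 : ℝ)..t, u s, u t - x)) := by
    refine h1.prodMk_nhds (((hu t ht).sub_const x).congr fun n => ?_)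
    exact (integral_yosidaExp J (n + 1) t x).symm
  exact isClosed_closure.mem_of_tendsto h4
    (Eventually.of_forall fun n => hJ.yosida_mem (by positivity) _)

end IsResolventFamily

end Abstract

end LinBoltz

end

noncomputable section

namespace LinBoltz

open Filter Topology
open scoped ENNReal

/-! ### Perturbation series for the resolvent -/

section Kato

variable {X : Type*} [NormedAddCommGroup X] [NormedSpace ℝ X]

/-- `R` is the resolvent at `λ` of an operator `A` with `L = A + B`, and `M = B R`. The extended
seminorm `N` is a Lyapunov functional that controls `B`. -/
structure IsKatoPair (L : X →ₗ.[ℝ] X) (N : X → ℝ≥0∞) (C c lam : ℝ) (R M : X →L[ℝ] X) : Prop where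
  norm_le : ∀ x, lam * ‖R x‖ + ‖M x‖ ≤ ‖x‖
  mem_graph : ∀ x, (R x, lam • R x - x + M x) ∈ L.graph
  exists_of_mem : ∀ p ∈ L.graph, ∃ a, p.1 = R a ∧ p.2 = lam • p.1 - a + M a
  weight_le : ∀ x, N (M x) + ENNReal.ofReal lam * N (R x) ≤ N x + ENNReal.ofReal C * ‖R x‖ₑ
  enorm_le : ∀ x, ‖M x‖ₑ ≤ ENNReal.ofReal c * N (R x)

namespace IsKatoPair

variable {L : X →ₗ.[ℝ] X} {N : X → ℝ≥0∞} {C c lam : ℝ} {R M : X →L[ℝ] X}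

lemma norm_M_le (h : IsKatoPair L N C c lam R M) (hlam : 0 < lam) (x : X) : ‖M x‖ ≤ ‖x‖ := by
  have := h.norm_le x
  have : 0 ≤ lam * ‖R x‖ := by positivity
  linarith

lemma norm_pow_le (h : IsKatoPair L N C c lam R M) (hlam : 0 < lam) (n : ℕ) (x : X) :
    ‖(M ^ n) x‖ ≤ ‖x‖ := by
  induction n with
  | zero => simp
  | succ n ih =>
    rw [pow_succ']
    exact (h.norm_M_le hlam _).trans ih

/-- The estimate `norm_le`, applied to `Mⁿ x`, telescopes: the norm that `M` keeps is available for
the next term. -/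
lemma sum_norm_le (h : IsKatoPair L N C c lam R M) (n : ℕ) (x : X) :
    lam * ∑ k ∈ Finset.range n, ‖R ((M ^ k) x)‖ + ‖(M ^ n) x‖ ≤ ‖x‖ := by
  induction n with
  | zero => simp
  | succ n ih =>
    rw [Finset.sum_range_succ, mul_add]
    have h1 := h.norm_le ((M ^ n) x)
    have h2 : (M ^ (n + 1)) x = M ((M ^ n) x) := by
      rw [pow_succ']
      rfl
    rw [h2]
    linarith

lemma sum_range_norm_le (h : IsKatoPair L N C c lam R M) (hlam : 0 < lam) (n : ℕ) (x : X) :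
    ∑ k ∈ Finset.range n, ‖R ((M ^ k) x)‖ ≤ ‖x‖ / lam := by
  rw [le_div_iff₀ hlam, mul_comm]
  have := h.sum_norm_le n x
  have := norm_nonneg ((M ^ n) x)
  linarith

lemma summable_norm (h : IsKatoPair L N C c lam R M) (hlam : 0 < lam) (x : X) :
    Summable fun k => ‖R ((M ^ k) x)‖ :=
  summable_of_sum_range_le (fun _ => norm_nonneg _) fun n => h.sum_range_norm_le hlam n x

lemma tsum_norm_le (h : IsKatoPair L N C c lam R M) (hlam : 0 < lam) (x : X) :
    ∑' k, ‖R ((M ^ k) x)‖ ≤ ‖x‖ / lam :=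
  (h.summable_norm hlam x).tsum_le_of_sum_range_le fun n => h.sum_range_norm_le hlam n x

/-- The sum `J = ∑ R Mᵏ` of the perturbation series. -/
def resolvent [CompleteSpace X] (h : IsKatoPair L N C c lam R M) (hlam : 0 < lam) : X →L[ℝ] X :=
  LinearMap.mkContinuous
    { toFun := fun x => ∑' k, R ((M ^ k) x)
      map_add' := fun x y => by
        simp only [map_add]
        exact (h.summable_norm hlam x).of_norm.tsum_add (h.summable_norm hlam y).of_norm
      map_smul' := fun r x => by
        simp only [map_smul, RingHom.id_apply]
        exact (h.summable_norm hlam x).of_norm.tsum_const_smul r }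
    lam⁻¹ (fun x => by
      refine (norm_tsum_le_tsum_norm (h.summable_norm hlam x)).trans ?_
      rw [inv_mul_eq_div]
      exact h.tsum_norm_le hlam x)

lemma hasSum_resolvent [CompleteSpace X] (h : IsKatoPair L N C c lam R M) (hlam : 0 < lam) (x : X) :
    HasSum (fun k => R ((M ^ k) x)) (h.resolvent hlam x) :=
  (h.summable_norm hlam x).of_norm.hasSum

lemma norm_resolvent_le [CompleteSpace X] (h : IsKatoPair L N C c lam R M) (hlam : 0 < lam) (x : X) :
    lam * ‖h.resolvent hlam x‖ ≤ ‖x‖ := by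
  rw [mul_comm, ← le_div_iff₀ hlam]
  exact (norm_tsum_le_tsum_norm (h.summable_norm hlam x)).trans (h.tsum_norm_le hlam x)

/-- The same telescoping for `N`; the error terms `C‖R Mᵏ x‖` are summable by the unweighted
estimate. -/
lemma sum_weight_le (h : IsKatoPair L N C c lam R M) (n : ℕ) (x : X) :
    N ((M ^ n) x) + ENNReal.ofReal lam * ∑ k ∈ Finset.range n, N (R ((M ^ k) x))
      ≤ N x + ENNReal.ofReal C * ∑ k ∈ Finset.range n, ‖R ((M ^ k) x)‖ₑ := by
  induction n with
  | zero => simp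
  | succ n ih =>
    rw [Finset.sum_range_succ, mul_add, Finset.sum_range_succ, mul_add]
    have h1 := h.weight_le ((M ^ n) x)
    have h2 : (M ^ (n + 1)) x = M ((M ^ n) x) := by
      rw [pow_succ']
      rfl
    rw [h2]
    calc _ = (N (M ((M ^ n) x)) + ENNReal.ofReal lam * N (R ((M ^ n) x)))
          + ENNReal.ofReal lam * ∑ k ∈ Finset.range n, N (R ((M ^ k) x)) := by ring
      _ ≤ (N ((M ^ n) x) + ENNReal.ofReal C * ‖R ((M ^ n) x)‖ₑ)
          + ENNReal.ofReal lam * ∑ k ∈ Finset.range n, N (R ((M ^ k) x)) := by gcongr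
      _ = (N ((M ^ n) x) + ENNReal.ofReal lam * ∑ k ∈ Finset.range n, N (R ((M ^ k) x)))
          + ENNReal.ofReal C * ‖R ((M ^ n) x)‖ₑ := by ring
      _ ≤ _ := by
        rw [← add_assoc]
        gcongr

lemma tsum_weight_le (h : IsKatoPair L N C c lam R M) (hlam : 0 < lam) (x : X) :
    ENNReal.ofReal lam * ∑' k, N (R ((M ^ k) x))
      ≤ N x + ENNReal.ofReal C * ENNReal.ofReal (‖x‖ / lam) := by
  rw [← ENNReal.tsum_mul_left]
  refine ENNReal.tsum_le_of_sum_range_le fun n => ?_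
  rw [← Finset.mul_sum]
  refine (le_add_self.trans (h.sum_weight_le n x)).trans ?_
  gcongr
  simp only [← ofReal_norm]
  rw [← ENNReal.ofReal_sum_of_nonneg (fun _ _ => norm_nonneg _)]
  exact ENNReal.ofReal_le_ofReal (h.sum_range_norm_le hlam n x)

lemma tsum_weight_lt_top (h : IsKatoPair L N C c lam R M) (hlam : 0 < lam) {x : X}
    (hx : N x < ⊤) : ∑' k, N (R ((M ^ k) x)) < ⊤ := by
  have h1 : ENNReal.ofReal lam * ∑' k, N (R ((M ^ k) x)) < ⊤ :=
    (h.tsum_weight_le hlam x).trans_lt (ENNReal.add_lt_top.2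
      ⟨hx, ENNReal.mul_lt_top ENNReal.ofReal_lt_top ENNReal.ofReal_lt_top⟩)
  by_contra hcon
  rw [not_lt, top_le_iff] at hcon
  rw [hcon, ENNReal.mul_top (by simpa using hlam)] at h1
  exact lt_irrefl _ h1

/-- The norm in the error term is absorbed into `N`, which yields exactly the constant required by
`IsLscSeminorm.yosidaExp_le`. -/
lemma weight_resolvent_le [CompleteSpace X] (h : IsKatoPair L N C c lam R M) (hlam : 0 < lam)
    (hC : 0 ≤ C) (hN : IsLscSeminorm N) (hN1 : ∀ x, ‖x‖ₑ ≤ N x) (x : X) :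
    N (h.resolvent hlam x) ≤ ENNReal.ofReal ((1 + C / lam) / lam) * N x := by
  have h1 := (mul_le_mul_right (hN.le_tsum_of_hasSum (h.hasSum_resolvent hlam x))
    (ENNReal.ofReal lam)).trans (h.tsum_weight_le hlam x)
  have h2 : N x + ENNReal.ofReal C * ENNReal.ofReal (‖x‖ / lam)
      ≤ ENNReal.ofReal (1 + C / lam) * N x := by
    rw [ENNReal.ofReal_add zero_le_one (by positivity), ENNReal.ofReal_one, add_mul, one_mul]
    refine add_le_add le_rfl ?_
    calc ENNReal.ofReal C * ENNReal.ofReal (‖x‖ / lam)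
        = ENNReal.ofReal (C / lam) * ‖x‖ₑ := by
          rw [← ofReal_norm, ← ENNReal.ofReal_mul hC, ← ENNReal.ofReal_mul (by positivity)]
          congr 1
          ring
      _ ≤ _ := by gcongr; exact hN1 x
  rw [div_eq_inv_mul, ENNReal.ofReal_mul (by positivity), ENNReal.ofReal_inv_of_pos hlam, mul_assoc,
    mul_comm (ENNReal.ofReal lam)⁻¹, ← div_eq_mul_inv,
    ENNReal.le_div_iff_mul_le (by simp [hlam]) (by simp), mul_comm]
  exact h1.trans h2

lemma summable_pow [CompleteSpace X] (h : IsKatoPair L N C c lam R M) (hlam : 0 < lam) {x : X}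
    (hx : N x < ⊤) : Summable fun k => (M ^ k) x := by
  -- The bound `enorm_le` concerns only vectors of the form `M y`, so the term `k = 0` is set aside.
  rw [← summable_nat_add_iff 1]
  have h1 : ∑' k, ‖(M ^ (k + 1)) x‖ₑ ≤ ENNReal.ofReal c * ∑' k, N (R ((M ^ k) x)) := by
    rw [← ENNReal.tsum_mul_left]
    refine ENNReal.tsum_le_tsum fun k => ?_
    rw [pow_succ']
    exact h.enorm_le _
  have h2 := h1.trans_lt (ENNReal.mul_lt_top ENNReal.ofReal_lt_top (h.tsum_weight_lt_top hlam hx))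
  refine Summable.of_norm ?_
  have h3 := ENNReal.summable_toReal h2.ne
  simpa using h3

/-- For finite weight the series `∑ Mᵏ x` itself converges and `R` comes out of the sum. Thus `J x`
lies in the domain of `L`, not merely of its closure. -/
lemma resolvent_eq [CompleteSpace X] (h : IsKatoPair L N C c lam R M) (hlam : 0 < lam) {x : X}
    (hx : N x < ⊤) : h.resolvent hlam x = R (∑' k, (M ^ k) x) :=
  (h.hasSum_resolvent hlam x).unique ((h.summable_pow hlam hx).hasSum.mapL R)

lemma resolvent_mem_domain [CompleteSpace X] (h : IsKatoPair L N C c lam R M) (hlam : 0 < lam)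
    {x : X} (hx : N x < ⊤) : h.resolvent hlam x ∈ L.domain := by
  rw [h.resolvent_eq hlam hx]
  exact LinearPMap.mem_domain_of_mem_graph (h.mem_graph _)

/-- This is the decisive condition in Kato's method. On the dense set of finite weight, `Mⁿ x` is
the general term of a convergent series; elsewhere contractivity of the powers suffices. -/
lemma tendsto_pow [CompleteSpace X] (h : IsKatoPair L N C c lam R M) (hlam : 0 < lam)
    (hd : Dense {x | N x < ⊤}) (x : X) : Tendsto (fun n : ℕ => (M ^ n) x) atTop (𝓝 0) := by
  rw [Metric.tendsto_atTop]
  intro ε hε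
  obtain ⟨y, hy, hxy⟩ := hd.exists_dist_lt x (show 0 < ε / 2 by positivity)
  obtain ⟨n₀, hn₀⟩ := Metric.tendsto_atTop.1 (h.summable_pow hlam hy).tendsto_atTop_zero (ε / 2)
    (by positivity)
  refine ⟨n₀, fun n hn => ?_⟩
  have h1 := hn₀ n hn
  rw [dist_zero_right] at h1 ⊢
  rw [dist_eq_norm] at hxy
  have h2 : (M ^ n) x = (M ^ n) (x - y) + (M ^ n) y := by rw [← map_add, sub_add_cancel]
  rw [h2]
  have := norm_add_le ((M ^ n) (x - y)) ((M ^ n) y)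
  have := h.norm_pow_le hlam n (x - y)
  linarith

lemma tendsto_sum [CompleteSpace X] (h : IsKatoPair L N C c lam R M) (hlam : 0 < lam) (x : X) :
    Tendsto (fun n : ℕ => R (∑ k ∈ Finset.range n, (M ^ k) x)) atTop (𝓝 (h.resolvent hlam x)) := by
  simpa only [map_sum] using (h.hasSum_resolvent hlam x).tendsto_sum_nat

lemma sum_sub_map (y : ℕ → X) (M : X →L[ℝ] X)
    (hy : ∀ n, y (n + 1) = M (y n)) (n : ℕ) :
    ∑ k ∈ Finset.range n, y k - M (∑ k ∈ Finset.range n, y k) = y 0 - y n := by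
  rw [map_sum]
  simp only [← hy]
  rw [← Finset.sum_sub_distrib, Finset.sum_range_sub']

lemma pow_succ_apply (M : X →L[ℝ] X) (x : X) (n : ℕ) : (M ^ (n + 1)) x = M ((M ^ n) x) := by
  rw [pow_succ']
  rfl

/-- With `S = ∑_{k<n} Mᵏ x`, the pair `(R S, λ R S - S + M S)` is in the graph, and `S - M S = x -
Mⁿ x` tends to `x`. -/
lemma resolvent_mem_closure [CompleteSpace X] (h : IsKatoPair L N C c lam R M) (hlam : 0 < lam)
    (hd : Dense {x | N x < ⊤}) (x : X) :
    (h.resolvent hlam x, lam • h.resolvent hlam x - x) ∈ closure (L.graph : Set (X × X)) := by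
  have h1 := h.tendsto_sum hlam x
  have h2 : Tendsto (fun n : ℕ => lam • R (∑ k ∈ Finset.range n, (M ^ k) x) - (x - (M ^ n) x)) atTop
      (𝓝 (lam • h.resolvent hlam x - x)) := by
    have := (h1.const_smul lam).sub ((h.tendsto_pow hlam hd x).const_sub x)
    simpa using this
  refine mem_closure_of_tendsto (h1.prodMk_nhds h2) (Eventually.of_forall fun n => ?_)
  have h3 := h.mem_graph (∑ k ∈ Finset.range n, (M ^ k) x)
  have h4 := sum_sub_map (fun k => (M ^ k) x) M (pow_succ_apply M x) n
  simp only [pow_zero, one_apply_eq_self] at h4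
  rw [← h4]
  rw [sub_add] at h3
  exact h3

/-- A point of the graph has the form `R a` with `λ p.1 - p.2 = a - M a`, and the partial sums for
`J(a - M a)` telescope to `R(a - Mⁿ a)`. -/
lemma resolvent_left_inv [CompleteSpace X] (h : IsKatoPair L N C c lam R M) (hlam : 0 < lam)
    (hd : Dense {x | N x < ⊤}) {p : X × X} (hp : p ∈ L.graph) :
    h.resolvent hlam (lam • p.1 - p.2) = p.1 := by
  obtain ⟨a, h1, h2⟩ := h.exists_of_mem p hp
  have e : lam • p.1 - p.2 = a - M a := by rw [h2]; abel
  rw [e, h1]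
  have h3 := h.tendsto_sum hlam (a - M a)
  have h4 : Tendsto (fun n : ℕ => R (a - (M ^ n) a)) atTop (𝓝 (R a)) := by
    have := (R.continuous.tendsto _).comp ((h.tendsto_pow hlam hd a).const_sub a)
    simpa [Function.comp_def] using this
  refine tendsto_nhds_unique h3 (h4.congr fun n => ?_)
  congr 1
  have h5 : ∀ k, (M ^ k) (a - M a) = (M ^ k) a - (M ^ (k + 1)) a := by
    intro k
    rw [map_sub, pow_succ]
    rfl
  simp only [h5]
  rw [Finset.sum_range_sub']
  simp

/-- Conservation: a functional `m` with `λ m(R x) + m(M x) = m(x)` satisfies `λ m(J x) = m(x)`. -/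
lemma map_resolvent [CompleteSpace X] (h : IsKatoPair L N C c lam R M) (hlam : 0 < lam)
    (hd : Dense {x | N x < ⊤}) (m : X →L[ℝ] ℝ) (hm : ∀ x, lam * m (R x) + m (M x) = m x) (x : X) :
    lam * m (h.resolvent hlam x) = m x := by
  have h1 := ((m.continuous.tendsto _).comp (h.tendsto_sum hlam x)).const_mul lam
  have h2 : Tendsto (fun n : ℕ => m (x - (M ^ n) x)) atTop (𝓝 (m x)) := by
    have := (m.continuous.tendsto _).comp ((h.tendsto_pow hlam hd x).const_sub x)
    simpa [Function.comp_def] using this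
  refine tendsto_nhds_unique h1 (h2.congr fun n => ?_)
  have h4 := sum_sub_map (fun k => (M ^ k) x) M (pow_succ_apply M x) n
  simp only [pow_zero, one_apply_eq_self] at h4
  simp only [Function.comp]
  rw [← h4, map_sub, ← hm (∑ k ∈ Finset.range n, (M ^ k) x)]
  ring

/-- A closed convex cone invariant under `R` and `M` is invariant under `J`. -/
lemma resolvent_mem [CompleteSpace X] (h : IsKatoPair L N C c lam R M) (hlam : 0 < lam)
    {K : AddSubmonoid X} (hK : IsClosed (K : Set X)) (hR : ∀ x ∈ K, R x ∈ K)
    (hM : ∀ x ∈ K, M x ∈ K) {x : X} (hx : x ∈ K) : h.resolvent hlam x ∈ K := by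
  have hpow : ∀ k, (M ^ k) x ∈ K := by
    intro k
    induction k with
    | zero => simpa using hx
    | succ k ih =>
      rw [pow_succ_apply]
      exact hM _ ih
  exact hK.mem_of_tendsto (h.hasSum_resolvent hlam x)
    (Eventually.of_forall fun s => K.sum_mem fun k _ => hR _ (hpow k))

end IsKatoPair

/-! ### Invariants of the exponential of the Yosida approximation -/

/-- Here `m(Jᵏ x) = λ⁻ᵏ m(x)`, so the series sums to `exp(tλ) m(x)`, and the prefactor `exp(-tλ)`
cancels the growth. -/
lemma map_yosidaExp [CompleteSpace X] (J : X →L[ℝ] X) {lam : ℝ} (hlam : 0 < lam) (t : ℝ)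
    (m : X →L[ℝ] ℝ) (hm : ∀ x, lam * m (J x) = m x) (x : X) : m (yosidaExp J lam t x) = m x := by
  have hk : ∀ k : ℕ, m ((J ^ k) x) = (lam⁻¹) ^ k * m x := by
    intro k
    induction k with
    | zero => simp
    | succ k ih =>
      rw [IsKatoPair.pow_succ_apply, pow_succ', mul_assoc, ← ih, ← hm ((J ^ k) x)]
      field_simp
  have h1 := (hasSum_exp_apply J (t * lam ^ 2) x).mapL m
  have h2 : HasSum (fun k : ℕ => ((k.factorial : ℝ)⁻¹ * (t * lam) ^ k) * m x)
      (Real.exp (t * lam) * m x) := by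
    refine HasSum.mul_right _ ?_
    have := NormedSpace.exp_series_hasSum_exp' (𝕂 := ℝ) (t * lam)
    rw [← Real.exp_eq_exp_ℝ] at this
    simpa using this
  have h3 : m (NormedSpace.exp ((t * lam ^ 2) • J) x) = Real.exp (t * lam) * m x := by
    refine h1.unique (h2.congr_fun ?_ |> fun h => h)
    intro k
    rw [map_smul, hk k, smul_eq_mul, ← mul_assoc, mul_assoc _ _ (lam⁻¹ ^ k), ← mul_pow]
    congr 3
    field_simp
  rw [yosidaExp_eq, smul_apply, map_smul, h3, smul_eq_mul, ← mul_assoc, ← Real.exp_add]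
  simp

lemma yosidaExp_mem [CompleteSpace X] (J : X →L[ℝ] X) {lam t : ℝ} (hlam : 0 < lam) (ht : 0 ≤ t)
    {K : AddSubmonoid X} (hK : IsClosed (K : Set X)) (hsmul : ∀ r : ℝ, 0 ≤ r → ∀ x ∈ K, r • x ∈ K)
    (hJ : ∀ x ∈ K, J x ∈ K) {x : X} (hx : x ∈ K) : yosidaExp J lam t x ∈ K := by
  have hpow : ∀ k, (J ^ k) x ∈ K := by
    intro k
    induction k with
    | zero => simpa using hx
    | succ k ih =>
      rw [IsKatoPair.pow_succ_apply]
      exact hJ _ ih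
  rw [yosidaExp_eq, smul_apply]
  refine hsmul _ (Real.exp_pos _).le _ ?_
  exact hK.mem_of_tendsto (hasSum_exp_apply J (t * lam ^ 2) x)
    (Eventually.of_forall fun s => K.sum_mem fun k _ => hsmul _ (by positivity) _ (hpow k))

end Kato

end LinBoltz

end

noncomputable section

namespace LinBoltz

open Filter Topology
open scoped ENNReal

/-! ### Free streaming -/

/-- The free flow `(x, v) ↦ (x + t v, v)`. -/
def stream (t : ℝ) (z : Phase) : Phase := (z.1 + torusProj (fun i => t * z.2 i), z.2)

lemma continuous_torusProj : Continuous torusProj :=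
  continuous_pi fun i => (AddCircle.continuous_mk' 1).comp (continuous_apply i)

lemma continuous_stream : Continuous fun q : ℝ × Phase => stream q.1 q.2 := by
  unfold stream
  have h : Continuous fun q : ℝ × Phase => torusProj (fun i => q.1 * q.2.2 i) :=
    continuous_torusProj.comp (by fun_prop)
  fun_prop

lemma stream_stream (s t : ℝ) (z : Phase) : stream s (stream t z) = stream (s + t) z := by
  refine Prod.ext ?_ rfl
  simp only [stream, add_mul]
  rw [add_assoc, ← torusProj_add, add_comm (fun i => t * z.2 i)]
  rfl

@[simp] lemma stream_snd (t : ℝ) (z : Phase) : (stream t z).2 = z.2 := rfl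

@[simp] lemma stream_zero (z : Phase) : stream 0 z = z := by
  refine Prod.ext ?_ rfl
  funext i
  simp [stream, torusProj]

/-- For each fixed velocity the flow is a translation of the torus; the coordinates are swapped so
that the velocity is the base of the skew product. -/
lemma measurePreserving_stream (t : ℝ) :
    MeasurePreserving (stream t) (volume : Measure Phase) volume := by
  have h1 : MeasurePreserving (fun q : Vel × Torus => (q.1, q.2 + torusProj (fun i => t * q.1 i)))
      ((volume : Measure Vel).prod (volume : Measure Torus))
      ((volume : Measure Vel).prod (volume : Measure Torus)) := by
    refine (MeasurePreserving.id (volume : Measure Vel)).skew_product (μc := volume) (μd := volume)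
      (g := fun (v : Vel) (x : Torus) => x + torusProj (fun i => t * v i)) ?_ ?_
    · have h : Continuous fun q : Vel × Torus => torusProj (fun i => t * q.1 i) :=
        continuous_torusProj.comp (by fun_prop)
      exact Continuous.measurable (by fun_prop)
    · exact Eventually.of_forall fun v =>
        (measurePreserving_add_right (volume : Measure Torus) _).map_eq
  exact (Measure.measurePreserving_swap (μ := (volume : Measure Vel))
    (ν := (volume : Measure Torus))).comp (h1.comp (Measure.measurePreserving_swap
    (μ := (volume : Measure Torus)) (ν := (volume : Measure Vel))))

/-- The resolvent evaluates a representative along single trajectories. This lemma makes the result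
independent of the representative, up to null sets. -/
lemma ae_stream {P : Phase → Prop} (hP : MeasurableSet {z | P z})
    (h : ∀ᵐ z ∂(volume : Measure Phase), P z) (m : Measure ℝ) [SFinite m] :
    ∀ᵐ z ∂(volume : Measure Phase), ∀ᵐ t ∂m, P (stream (-t) z) := by
  have h1 : MeasurableSet {q : Phase × ℝ | P (stream (-q.2) q.1)} :=
    measurableSet_preimage ((continuous_stream.comp
      ((continuous_neg.comp continuous_snd).prodMk continuous_fst)).measurable) hP
  rw [Measure.ae_ae_comm h1]
  exact Eventually.of_forall fun t => (measurePreserving_stream (-t)).quasiMeasurePreserving.ae h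

/-! ### The resolvent of transport with absorption -/

lemma integral_exp_neg_mul_Ioi {a : ℝ} (ha : 0 < a) : ∫ t in Ioi (0 : ℝ), Real.exp (-a * t) = a⁻¹ := by
  rw [integral_exp_mul_Ioi (by linarith)]
  simp [neg_div_neg_eq]

lemma lintegral_exp_neg_mul_Ioi {a : ℝ} (ha : 0 < a) :
    ∫⁻ t in Ioi (0 : ℝ), ENNReal.ofReal (Real.exp (-a * t)) = ENNReal.ofReal a⁻¹ := by
  rw [← integral_exp_neg_mul_Ioi ha, ofReal_integral_eq_lintegral_ofReal]
  · exact integrableOn_exp_mul_Ioi (by linarith) 0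
  · exact Eventually.of_forall fun t => (Real.exp_pos _).le

variable (σ : Vel → ℝ) (lam : ℝ)

/-- The factor `exp(-(λ + σ(v)) t)`. -/
def decay (v : Vel) (t : ℝ) : ℝ := Real.exp (-(lam + σ v) * t)

lemma decay_pos (v : Vel) (t : ℝ) : 0 < decay σ lam v t := Real.exp_pos _

/-- `(R h)(x, v) = ∫₀^∞ exp(-(λ + σ(v)) t) h(x - t v, v) dt`. -/
def resolvFun (h : Phase → ℝ) (z : Phase) : ℝ :=
  ∫ t in Ioi (0 : ℝ), decay σ lam z.2 t * h (stream (-t) z)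

/-- The version of `resolvFun` for functions with values in `[0, ∞]`. -/
def resolvLintegral (F : Phase → ℝ≥0∞) (z : Phase) : ℝ≥0∞ :=
  ∫⁻ t in Ioi (0 : ℝ), ENNReal.ofReal (decay σ lam z.2 t) * F (stream (-t) z)

variable {σ lam}

lemma measurable_decay (hσ : Measurable σ) :
    Measurable fun q : Phase × ℝ => decay σ lam q.1.2 q.2 := by
  unfold decay
  fun_prop

lemma measurable_stream_neg : Measurable fun q : Phase × ℝ => stream (-q.2) q.1 :=
  (continuous_stream.comp ((continuous_neg.comp continuous_snd).prodMk continuous_fst)).measurable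

lemma measurable_resolvLintegral (hσ : Measurable σ) {F : Phase → ℝ≥0∞} (hF : Measurable F) :
    Measurable (resolvLintegral σ lam F) := by
  refine Measurable.lintegral_prod_right' (f := fun q : Phase × ℝ =>
    ENNReal.ofReal (decay σ lam q.1.2 q.2) * F (stream (-q.2) q.1)) ?_
  exact (measurable_decay hσ).ennreal_ofReal.mul (hF.comp measurable_stream_neg)

lemma stronglyMeasurable_resolvFun (hσ : Measurable σ) {h : Phase → ℝ} (hh : StronglyMeasurable h) :
    StronglyMeasurable (resolvFun σ lam h) := by
  refine StronglyMeasurable.integral_prod_right' (f := fun q : Phase × ℝ =>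
    decay σ lam q.1.2 q.2 * h (stream (-q.2) q.1)) ?_
  exact (measurable_decay hσ).stronglyMeasurable.mul (hh.comp_measurable measurable_stream_neg)

/-- By Tonelli and invariance of the measure, the shift along the flow disappears, since velocities
do not change. The remaining time integral is `1/(λ + σ)` and cancels the weight. -/
lemma lintegral_resolvLintegral (hσ : Measurable σ) (hσ0 : ∀ v, 0 ≤ σ v) (hlam : 0 < lam)
    {F : Phase → ℝ≥0∞} (hF : Measurable F) {Φ : Vel → ℝ≥0∞} (hΦ : Measurable Φ) :
    ∫⁻ z, resolvLintegral σ lam F z * (ENNReal.ofReal (lam + σ z.2) * Φ z.2)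
      = ∫⁻ z, F z * Φ z.2 := by
  have hd := (measurable_decay (lam := lam) hσ).ennreal_ofReal
  have hw : Measurable fun z : Phase => ENNReal.ofReal (lam + σ z.2) * Φ z.2 := by fun_prop
  have e1 : ∫⁻ z, resolvLintegral σ lam F z * (ENNReal.ofReal (lam + σ z.2) * Φ z.2)
      = ∫⁻ z : Phase, ∫⁻ t in Ioi (0 : ℝ), ENNReal.ofReal (decay σ lam z.2 t) * F (stream (-t) z)
        * (ENNReal.ofReal (lam + σ z.2) * Φ z.2) := by
    refine lintegral_congr fun z => ?_
    rw [resolvLintegral, lintegral_mul_const]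
    exact (hd.comp measurable_prodMk_left).mul
      ((hF.comp measurable_stream_neg).comp measurable_prodMk_left)
  have e2 : ∀ t : ℝ, ∫⁻ z : Phase, ENNReal.ofReal (decay σ lam z.2 t) * F (stream (-t) z)
        * (ENNReal.ofReal (lam + σ z.2) * Φ z.2)
      = ∫⁻ z : Phase, ENNReal.ofReal (decay σ lam z.2 t) * F z
        * (ENNReal.ofReal (lam + σ z.2) * Φ z.2) := by
    intro t
    refine (measurePreserving_stream (-t)).lintegral_comp
      (f := fun z => ENNReal.ofReal (decay σ lam z.2 t) * F z
        * (ENNReal.ofReal (lam + σ z.2) * Φ z.2)) ?_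
    exact ((hd.comp measurable_prodMk_right).mul hF).mul hw
  rw [e1, lintegral_lintegral_swap]
  · simp_rw [e2]
    rw [lintegral_lintegral_swap]
    · refine lintegral_congr fun z => ?_
      have hpos : 0 < lam + σ z.2 := by linarith [hσ0 z.2]
      have e3 : ∀ t, ENNReal.ofReal (decay σ lam z.2 t) * F z
          * (ENNReal.ofReal (lam + σ z.2) * Φ z.2)
          = ENNReal.ofReal (decay σ lam z.2 t) * (ENNReal.ofReal (lam + σ z.2) * (F z * Φ z.2)) := by
        intro t
        ring
      simp_rw [e3]
      rw [lintegral_mul_const _ (show Measurable fun t => ENNReal.ofReal (decay σ lam z.2 t) from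
        hd.comp (measurable_prodMk_left (x := z))), ← mul_assoc]
      simp only [decay]
      rw [lintegral_exp_neg_mul_Ioi hpos, ← ENNReal.ofReal_mul (by positivity),
        inv_mul_cancel₀ hpos.ne', ENNReal.ofReal_one, one_mul]
    · refine Measurable.aemeasurable ?_
      exact ((hd.comp measurable_swap).mul (hF.comp measurable_snd)).mul (hw.comp measurable_snd)
  · exact ((hd.mul (hF.comp measurable_stream_neg)).mul (hw.comp measurable_fst)).aemeasurable

lemma enorm_resolvFun_le (h : Phase → ℝ) (z : Phase) :
    ‖resolvFun σ lam h z‖ₑ ≤ resolvLintegral σ lam (fun z => ‖h z‖ₑ) z := by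
  refine (enorm_integral_le_lintegral_enorm _).trans (le_of_eq ?_)
  refine lintegral_congr fun t => ?_
  rw [enorm_mul, Real.enorm_of_nonneg (decay_pos σ lam _ _).le]

lemma lintegral_resolvFun_le (hσ : Measurable σ) (hσ0 : ∀ v, 0 ≤ σ v) (hlam : 0 < lam)
    {h : Phase → ℝ} (hh : Measurable h) {Φ : Vel → ℝ≥0∞} (hΦ : Measurable Φ) :
    ∫⁻ z, ‖resolvFun σ lam h z‖ₑ * (ENNReal.ofReal (lam + σ z.2) * Φ z.2)
      ≤ ∫⁻ z, ‖h z‖ₑ * Φ z.2 := by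
  rw [← lintegral_resolvLintegral hσ hσ0 hlam hh.enorm hΦ]
  gcongr with z
  exact enorm_resolvFun_le h z

lemma integrable_rate_mul_resolvFun (hσ : Measurable σ) (hσ0 : ∀ v, 0 ≤ σ v) (hlam : 0 < lam)
    {h : Phase → ℝ} (hh : StronglyMeasurable h) (hi : Integrable h) :
    Integrable fun z => resolvFun σ lam h z * (lam + σ z.2) := by
  refine ⟨((stronglyMeasurable_resolvFun hσ hh).measurable.mul
    (by fun_prop)).aestronglyMeasurable, ?_⟩
  have h1 := lintegral_resolvFun_le hσ hσ0 hlam hh.measurable (Φ := fun _ => 1) measurable_const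
  simp only [mul_one] at h1
  refine lt_of_le_of_lt (le_of_eq ?_) (h1.trans_lt hi.2)
  refine lintegral_congr fun z => ?_
  rw [enorm_mul, Real.enorm_of_nonneg (r := lam + σ z.2) (by linarith [hσ0 z.2])]

/-- The resolvent gains a factor `λ + σ`, so multipliers as large as the collision frequency are
admissible. -/
lemma integrable_mul_resolvFun (hσ : Measurable σ) (hσ0 : ∀ v, 0 ≤ σ v) (hlam : 0 < lam)
    {h : Phase → ℝ} (hh : StronglyMeasurable h) (hi : Integrable h) {Ψ : Phase → ℝ} {C : ℝ}
    (hΨ : Measurable Ψ) (hC : ∀ z, |Ψ z| ≤ C * (lam + σ z.2)) :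
    Integrable fun z => resolvFun σ lam h z * Ψ z := by
  refine ((integrable_rate_mul_resolvFun hσ hσ0 hlam hh hi).norm.const_mul C).mono'
    ((stronglyMeasurable_resolvFun hσ hh).measurable.mul hΨ).aestronglyMeasurable
    (Eventually.of_forall fun z => ?_)
  have h1 := hC z
  have h2 : 0 < lam + σ z.2 := by linarith [hσ0 z.2]
  rw [norm_mul, norm_mul, Real.norm_eq_abs (Ψ z), Real.norm_of_nonneg h2.le]
  calc _ ≤ ‖resolvFun σ lam h z‖ * (C * (lam + σ z.2)) := by gcongr
    _ = _ := by ring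

lemma integrable_resolvFun (hσ : Measurable σ) (hσ0 : ∀ v, 0 ≤ σ v) (hlam : 0 < lam)
    {h : Phase → ℝ} (hh : StronglyMeasurable h) (hi : Integrable h) :
    Integrable (resolvFun σ lam h) := by
  have := integrable_mul_resolvFun hσ hσ0 hlam hh hi (Ψ := fun _ => 1) (C := lam⁻¹)
    measurable_const fun z => by
      rw [abs_one, inv_mul_eq_div, le_div_iff₀ hlam]
      linarith [hσ0 z.2]
  simpa using this

lemma ae_integrable_decay_mul (hσ : Measurable σ) (hσ0 : ∀ v, 0 ≤ σ v) (hlam : 0 < lam)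
    {h : Phase → ℝ} (hh : StronglyMeasurable h) (hi : Integrable h) :
    ∀ᵐ z, IntegrableOn (fun t => decay σ lam z.2 t * h (stream (-t) z)) (Ioi 0) := by
  have h1 := lintegral_resolvLintegral hσ hσ0 hlam hh.measurable.enorm (Φ := fun _ => 1)
    measurable_const
  simp only [mul_one] at h1
  have h2 : ∫⁻ z : Phase, resolvLintegral σ lam (fun z => ‖h z‖ₑ) z * ENNReal.ofReal (lam + σ z.2)
      ≠ ⊤ := by
    rw [h1]
    exact hi.2.ne
  have h3 := ae_lt_top ((measurable_resolvLintegral hσ hh.measurable.enorm).mul (by fun_prop)) h2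
  filter_upwards [h3] with z hz
  have hpos : 0 < lam + σ z.2 := by linarith [hσ0 z.2]
  have hz' : resolvLintegral σ lam (fun z => ‖h z‖ₑ) z < ⊤ := by
    by_contra hcon
    rw [not_lt, top_le_iff] at hcon
    simp [hcon, ENNReal.top_mul, hpos] at hz
  refine ⟨?_, ?_⟩
  · exact (((measurable_decay hσ).comp measurable_prodMk_left).stronglyMeasurable.mul
      ((hh.comp_measurable measurable_stream_neg).comp_measurable
        measurable_prodMk_left)).aestronglyMeasurable
  · refine lt_of_le_of_lt (le_of_eq ?_) hz'
    refine lintegral_congr fun t => ?_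
    rw [enorm_mul, Real.enorm_of_nonneg (decay_pos σ lam _ _).le]

/-- The adjoint of the resolvent is the resolvent of the backward flow. -/
lemma integral_resolvFun_mul (hσ : Measurable σ) (hσ0 : ∀ v, 0 ≤ σ v) (hlam : 0 < lam)
    {h : Phase → ℝ} (hh : StronglyMeasurable h) (hi : Integrable h) {Ψ : Phase → ℝ} {C : ℝ}
    (hΨ : Measurable Ψ) (hC : ∀ z, |Ψ z| ≤ C * (lam + σ z.2)) :
    ∫ z, resolvFun σ lam h z * Ψ z
      = ∫ z, h z * ∫ t in Ioi (0 : ℝ), decay σ lam z.2 t * Ψ (stream t z) := by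
  have hm : Measurable fun q : Phase × ℝ => decay σ lam q.1.2 q.2 * h (stream (-q.2) q.1) * Ψ q.1 :=
    ((measurable_decay hσ).mul (hh.measurable.comp measurable_stream_neg)).mul
      (hΨ.comp measurable_fst)
  have hC0 : 0 ≤ C := by
    have h1 := (abs_nonneg _).trans (hC 0)
    exact nonneg_of_mul_nonneg_left h1 (by linarith [hσ0 (0 : Phase).2])
  have hint : Integrable (fun q : Phase × ℝ => decay σ lam q.1.2 q.2 * h (stream (-q.2) q.1) * Ψ q.1)
      ((volume : Measure Phase).prod (volume.restrict (Ioi 0))) := by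
    refine ⟨hm.aestronglyMeasurable, ?_⟩
    rw [HasFiniteIntegral, lintegral_prod _ hm.enorm.aemeasurable]
    have h1 : ∫⁻ z : Phase, resolvLintegral σ lam (fun z => ‖h z‖ₑ) z
        * (ENNReal.ofReal (lam + σ z.2) * ENNReal.ofReal C) < ⊤ := by
      rw [lintegral_resolvLintegral hσ hσ0 hlam hh.measurable.enorm (Φ := fun _ => ENNReal.ofReal C)
        measurable_const, lintegral_mul_const _ hh.measurable.enorm]
      exact ENNReal.mul_lt_top hi.2 ENNReal.ofReal_lt_top
    refine lt_of_le_of_lt (lintegral_mono fun z => ?_) h1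
    have hpos : 0 < lam + σ z.2 := by linarith [hσ0 z.2]
    rw [resolvLintegral, ← lintegral_mul_const]
    · refine lintegral_mono fun t => ?_
      simp only
      rw [enorm_mul, enorm_mul, Real.enorm_of_nonneg (decay_pos σ lam _ _).le]
      gcongr
      rw [← ENNReal.ofReal_mul hpos.le, Real.enorm_eq_ofReal_abs, mul_comm _ C]
      exact ENNReal.ofReal_le_ofReal (hC z)
    · exact ((measurable_decay hσ).comp measurable_prodMk_left).ennreal_ofReal.mul
        ((hh.measurable.comp measurable_stream_neg).comp measurable_prodMk_left).enorm
  -- The substitution `z ↦ stream t z` at each time moves the flow from `h` to `Ψ`.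
  have hΘ : MeasurePreserving (fun q : Phase × ℝ => (stream q.2 q.1, q.2))
      ((volume : Measure Phase).prod (volume.restrict (Ioi 0)))
      ((volume : Measure Phase).prod (volume.restrict (Ioi 0))) := by
    have h1 : MeasurePreserving (fun q : ℝ × Phase => (q.1, stream q.1 q.2))
        ((volume.restrict (Ioi (0 : ℝ))).prod (volume : Measure Phase))
        ((volume.restrict (Ioi (0 : ℝ))).prod (volume : Measure Phase)) :=
      (MeasurePreserving.id (volume.restrict (Ioi (0 : ℝ)))).skew_product
        continuous_stream.measurable
        (Eventually.of_forall fun t => (measurePreserving_stream t).map_eq)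
    exact Measure.measurePreserving_swap.comp (h1.comp Measure.measurePreserving_swap)
  have e1 : ∫ z, resolvFun σ lam h z * Ψ z
      = ∫ q, decay σ lam q.1.2 q.2 * h (stream (-q.2) q.1) * Ψ q.1
        ∂((volume : Measure Phase).prod (volume.restrict (Ioi 0))) := by
    rw [integral_prod _ hint]
    refine integral_congr_ae (Eventually.of_forall fun z => ?_)
    simp only [resolvFun]
    rw [← integral_mul_const]
  have hint' := hΘ.integrable_comp_of_integrable hint
  have e2 : ∫ q, decay σ lam q.1.2 q.2 * h (stream (-q.2) q.1) * Ψ q.1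
        ∂((volume : Measure Phase).prod (volume.restrict (Ioi 0)))
      = ∫ q, ((fun q : Phase × ℝ => decay σ lam q.1.2 q.2 * h (stream (-q.2) q.1) * Ψ q.1) ∘
          fun q : Phase × ℝ => (stream q.2 q.1, q.2)) q
        ∂((volume : Measure Phase).prod (volume.restrict (Ioi 0))) := by
    conv_lhs => rw [← hΘ.map_eq]
    exact integral_map hΘ.measurable.aemeasurable hm.aestronglyMeasurable
  rw [e1, e2, integral_prod _ hint']
  refine integral_congr_ae (Eventually.of_forall fun z => ?_)
  simp only [Function.comp, stream_stream, neg_add_cancel, stream_zero, stream_snd]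
  rw [← integral_const_mul]
  refine integral_congr_ae (Eventually.of_forall fun t => ?_)
  simp only
  ring

lemma resolvFun_congr {h h' : Phase → ℝ} (hh : StronglyMeasurable h) (hh' : StronglyMeasurable h')
    (e : h =ᵐ[volume] h') : resolvFun σ lam h =ᵐ[volume] resolvFun σ lam h' := by
  filter_upwards [ae_stream (measurableSet_eq_fun hh.measurable hh'.measurable) e
    (volume.restrict (Ioi 0))] with z hz
  refine integral_congr_ae ?_
  filter_upwards [hz] with t ht
  rw [ht]

lemma resolvFun_nonneg {h : Phase → ℝ} (hh : StronglyMeasurable h) (h0 : ∀ᵐ z, 0 ≤ h z) :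
    ∀ᵐ z, 0 ≤ resolvFun σ lam h z := by
  filter_upwards [ae_stream (measurableSet_le measurable_const hh.measurable) h0
    (volume.restrict (Ioi 0))] with z hz
  refine integral_nonneg_of_ae ?_
  filter_upwards [hz] with t ht
  exact mul_nonneg (decay_pos σ lam _ _).le ht

lemma enorm_eq_lintegral (f : L1Phase) : ‖f‖ₑ = ∫⁻ z, ‖f z‖ₑ := by
  rw [Lp.enorm_def, eLpNorm_one_eq_lintegral_enorm]

variable (σ lam) in
/-- The resolvent `R` as a linear map on `L¹`. -/
def resolvLinear (hσ : Measurable σ) (hσ0 : ∀ v, 0 ≤ σ v) (hlam : 0 < lam) :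
    L1Phase →ₗ[ℝ] L1Phase where
  toFun h := (integrable_resolvFun hσ hσ0 hlam (Lp.stronglyMeasurable h)
    (L1.integrable_coeFn h)).toL1 (resolvFun σ lam h)
  map_add' h h' := by
    rw [← Integrable.toL1_add, Integrable.toL1_eq_toL1_iff]
    refine (resolvFun_congr (Lp.stronglyMeasurable _)
      ((Lp.stronglyMeasurable h).add (Lp.stronglyMeasurable h')) (Lp.coeFn_add h h')).trans ?_
    filter_upwards [ae_integrable_decay_mul hσ hσ0 hlam (Lp.stronglyMeasurable h)
      (L1.integrable_coeFn h), ae_integrable_decay_mul hσ hσ0 hlam (Lp.stronglyMeasurable h')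
      (L1.integrable_coeFn h')] with z h1 h2
    rw [Pi.add_apply, resolvFun, resolvFun, resolvFun, ← integral_add h1 h2]
    simp only [Pi.add_apply, mul_add]
  map_smul' r h := by
    rw [RingHom.id_apply, ← Integrable.toL1_smul, Integrable.toL1_eq_toL1_iff]
    refine (resolvFun_congr (Lp.stronglyMeasurable _)
      ((Lp.stronglyMeasurable h).const_smul r) (Lp.coeFn_smul r h)).trans ?_
    refine Eventually.of_forall fun z => ?_
    simp only [resolvFun, Pi.smul_apply, smul_eq_mul]
    rw [← integral_const_mul]
    refine integral_congr_ae (Eventually.of_forall fun t => ?_)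
    simp only
    ring

lemma coeFn_resolvLinear (hσ : Measurable σ) (hσ0 : ∀ v, 0 ≤ σ v) (hlam : 0 < lam) (h : L1Phase) :
    resolvLinear σ lam hσ hσ0 hlam h =ᵐ[volume] resolvFun σ lam h :=
  Integrable.coeFn_toL1 (integrable_resolvFun hσ hσ0 hlam (Lp.stronglyMeasurable h)
    (L1.integrable_coeFn h))

lemma lintegral_resolvLinear_le (hσ : Measurable σ) (hσ0 : ∀ v, 0 ≤ σ v) (hlam : 0 < lam)
    (h : L1Phase) {Φ : Vel → ℝ≥0∞} (hΦ : Measurable Φ) :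
    ENNReal.ofReal lam * (∫⁻ z, ‖resolvLinear σ lam hσ hσ0 hlam h z‖ₑ * Φ z.2)
        + ∫⁻ z, ‖resolvLinear σ lam hσ hσ0 hlam h z‖ₑ * (ENNReal.ofReal (σ z.2) * Φ z.2)
      ≤ ∫⁻ z, ‖h z‖ₑ * Φ z.2 := by
  have hm : Measurable fun z => ‖resolvLinear σ lam hσ hσ0 hlam h z‖ₑ :=
    (Lp.stronglyMeasurable _).measurable.enorm
  refine le_trans (le_of_eq ?_)
    (lintegral_resolvFun_le hσ hσ0 hlam (Lp.stronglyMeasurable h).measurable hΦ)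
  have hm' : Measurable fun z : Phase => ‖resolvLinear σ lam hσ hσ0 hlam h z‖ₑ * Φ z.2 := by
    fun_prop
  rw [← lintegral_const_mul _ hm', ← lintegral_add_left (hm'.const_mul _)]
  refine lintegral_congr_ae ?_
  filter_upwards [coeFn_resolvLinear hσ hσ0 hlam h] with z hz
  rw [hz, ENNReal.ofReal_add hlam.le (hσ0 _)]
  ring

lemma norm_resolvLinear_le (hσ : Measurable σ) (hσ0 : ∀ v, 0 ≤ σ v) (hlam : 0 < lam)
    (h : L1Phase) : lam * ‖resolvLinear σ lam hσ hσ0 hlam h‖ ≤ ‖h‖ := by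
  have h1 := le_self_add.trans
    (lintegral_resolvLinear_le hσ hσ0 hlam h (Φ := fun _ => 1) measurable_const)
  simp only [mul_one, ← enorm_eq_lintegral] at h1
  rwa [← ofReal_norm, ← ofReal_norm, ← ENNReal.ofReal_mul hlam.le,
    ENNReal.ofReal_le_ofReal_iff (norm_nonneg _)] at h1

variable (σ lam) in
/-- The resolvent `R` as a bounded operator on `L¹`. -/
def resolvL1 (hσ : Measurable σ) (hσ0 : ∀ v, 0 ≤ σ v) (hlam : 0 < lam) : L1Phase →L[ℝ] L1Phase :=
  (resolvLinear σ lam hσ hσ0 hlam).mkContinuous lam⁻¹ fun h => by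
    rw [inv_mul_eq_div, le_div_iff₀ hlam, mul_comm]
    exact norm_resolvLinear_le hσ hσ0 hlam h

lemma coeFn_resolvL1 (hσ : Measurable σ) (hσ0 : ∀ v, 0 ≤ σ v) (hlam : 0 < lam) (h : L1Phase) :
    resolvL1 σ lam hσ hσ0 hlam h =ᵐ[volume] resolvFun σ lam h :=
  coeFn_resolvLinear hσ hσ0 hlam h

lemma lintegral_resolvL1_le (hσ : Measurable σ) (hσ0 : ∀ v, 0 ≤ σ v) (hlam : 0 < lam)
    (h : L1Phase) {Φ : Vel → ℝ≥0∞} (hΦ : Measurable Φ) :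
    ENNReal.ofReal lam * (∫⁻ z, ‖resolvL1 σ lam hσ hσ0 hlam h z‖ₑ * Φ z.2)
        + ∫⁻ z, ‖resolvL1 σ lam hσ hσ0 hlam h z‖ₑ * (ENNReal.ofReal (σ z.2) * Φ z.2)
      ≤ ∫⁻ z, ‖h z‖ₑ * Φ z.2 :=
  lintegral_resolvLinear_le hσ hσ0 hlam h hΦ

lemma resolvL1_nonneg (hσ : Measurable σ) (hσ0 : ∀ v, 0 ≤ σ v) (hlam : 0 < lam) {h : L1Phase}
    (h0 : 0 ≤ h) : 0 ≤ resolvL1 σ lam hσ hσ0 hlam h := by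
  rw [← Lp.coeFn_nonneg] at h0 ⊢
  filter_upwards [coeFn_resolvL1 hσ hσ0 hlam h,
    resolvFun_nonneg (σ := σ) (lam := lam) (Lp.stronglyMeasurable h) h0] with z h1 h2
  rw [h1]
  exact h2

lemma integral_resolvL1_mul (hσ : Measurable σ) (hσ0 : ∀ v, 0 ≤ σ v) (hlam : 0 < lam)
    (h : L1Phase) {Ψ : Phase → ℝ} {C : ℝ} (hΨ : Measurable Ψ)
    (hC : ∀ z, |Ψ z| ≤ C * (lam + σ z.2)) :
    ∫ z, resolvL1 σ lam hσ hσ0 hlam h z * Ψ z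
      = ∫ z, h z * ∫ t in Ioi (0 : ℝ), decay σ lam z.2 t * Ψ (stream t z) := by
  rw [← integral_resolvFun_mul hσ hσ0 hlam (Lp.stronglyMeasurable h) (L1.integrable_coeFn h) hΨ hC]
  refine integral_congr_ae ?_
  filter_upwards [coeFn_resolvL1 hσ hσ0 hlam h] with z hz
  rw [hz]

lemma integrable_resolvL1_mul (hσ : Measurable σ) (hσ0 : ∀ v, 0 ≤ σ v) (hlam : 0 < lam)
    (h : L1Phase) {Ψ : Phase → ℝ} {C : ℝ} (hΨ : Measurable Ψ)
    (hC : ∀ z, |Ψ z| ≤ C * (lam + σ z.2)) :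
    Integrable fun z => resolvL1 σ lam hσ hσ0 hlam h z * Ψ z := by
  refine (integrable_mul_resolvFun hσ hσ0 hlam (Lp.stronglyMeasurable h) (L1.integrable_coeFn h)
    hΨ hC).congr ?_
  filter_upwards [coeFn_resolvL1 hσ hσ0 hlam h] with z hz
  rw [hz]

/-- Duality with `Ψ = λ + σ`, whose weighted time integral is `1`. Unlike the norm estimates this is
an identity for signed `h`, as exact mass balance requires. -/
lemma integral_rate_mul_resolvL1 (hσ : Measurable σ) (hσ0 : ∀ v, 0 ≤ σ v) (hlam : 0 < lam)
    (h : L1Phase) :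
    ∫ z, resolvL1 σ lam hσ hσ0 hlam h z * (lam + σ z.2) = ∫ z, h z := by
  have hpos : ∀ v, 0 < lam + σ v := fun v => by linarith [hσ0 v]
  rw [integral_resolvL1_mul hσ hσ0 hlam h (Ψ := fun z => lam + σ z.2) (C := 1) (by fun_prop)
    (fun z => by rw [abs_of_pos (hpos _), one_mul])]
  refine integral_congr_ae (Eventually.of_forall fun z => ?_)
  simp only [stream_snd, decay]
  rw [integral_mul_const, integral_exp_neg_mul_Ioi (hpos _), inv_mul_cancel₀ (hpos _).ne', mul_one]

/-! ### Strong continuity of the resolvent at infinity -/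

/-- After the substitution `t = s/λ` the integrand tends to `exp(-s) h(z)` and is dominated by `C
exp(-s)`. -/
lemma tendsto_smul_resolvFun (hσ0 : ∀ v, 0 ≤ σ v) {h : Phase → ℝ} (hc : Continuous h) {C : ℝ}
    (hC : ∀ z, |h z| ≤ C) (z : Phase) :
    Tendsto (fun n : ℕ => ((n : ℝ) + 1) * resolvFun σ (n + 1) h z) atTop (𝓝 (h z)) := by
  have e : ∀ n : ℕ, ((n : ℝ) + 1) * resolvFun σ (n + 1) h z = ∫ s in Ioi (0 : ℝ),
      Real.exp (-(1 + σ z.2 * ((n : ℝ) + 1)⁻¹) * s) * h (stream (-(((n : ℝ) + 1)⁻¹ * s)) z) := by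
    intro n
    have hn : (0 : ℝ) < n + 1 := by positivity
    have := integral_comp_mul_left_Ioi
      (fun t => decay σ (n + 1) z.2 t * h (stream (-t) z)) 0 (inv_pos.2 hn)
    rw [mul_zero, inv_inv, smul_eq_mul] at this
    rw [resolvFun, ← this]
    refine setIntegral_congr_fun measurableSet_Ioi fun s _ => ?_
    simp only [decay]
    congr 2
    field_simp
  simp_rw [e]
  have h1 : h z = ∫ s in Ioi (0 : ℝ), Real.exp (-1 * s) * h z := by
    rw [integral_mul_const, integral_exp_neg_mul_Ioi one_pos]
    simp
  rw [h1]
  refine tendsto_integral_of_dominated_convergence (fun s => Real.exp (-1 * s) * C) ?_ ?_ ?_ ?_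
  · intro n
    refine Continuous.aestronglyMeasurable ?_
    have h2 : Continuous fun s : ℝ => stream (-(((n : ℝ) + 1)⁻¹ * s)) z :=
      continuous_stream.comp (f := fun s : ℝ => (-(((n : ℝ) + 1)⁻¹ * s), z)) (by fun_prop)
    fun_prop
  · exact (integrableOn_exp_mul_Ioi (by norm_num) 0).mul_const C
  · intro n
    refine (ae_restrict_iff' measurableSet_Ioi).2 (Eventually.of_forall fun s hs => ?_)
    have hs' : (0 : ℝ) < s := hs
    have h3 : 0 ≤ σ z.2 * ((n : ℝ) + 1)⁻¹ * s := by
      have := hσ0 z.2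
      positivity
    rw [norm_mul, Real.norm_of_nonneg (Real.exp_pos _).le, Real.norm_eq_abs]
    refine mul_le_mul (Real.exp_le_exp.2 ?_) (hC _) (abs_nonneg _) (Real.exp_pos _).le
    linarith
  · refine Eventually.of_forall fun s => ?_
    have h4 : Tendsto (fun n : ℕ => ((n : ℝ) + 1)⁻¹) atTop (𝓝 0) := by
      simpa using tendsto_one_div_add_atTop_nhds_zero_nat (𝕜 := ℝ)
    have h5 : Continuous fun r : ℝ => Real.exp (-(1 + σ z.2 * r) * s) * h (stream (-(r * s)) z) := by
      have : Continuous fun r : ℝ => stream (-(r * s)) z :=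
        continuous_stream.comp (f := fun r : ℝ => (-(r * s), z)) (by fun_prop)
      fun_prop
    have h6 := (h5.tendsto 0).comp h4
    simpa [Function.comp_def] using h6

lemma tendsto_smul_resolvL1_of_hasCompactSupport (hσ : Measurable σ) (hσ0 : ∀ v, 0 ≤ σ v)
    {h : Phase → ℝ} (hc : Continuous h) (hs : HasCompactSupport h) (hi : Integrable h) :
    Tendsto (fun n : ℕ => ((n : ℝ) + 1) • resolvL1 σ (n + 1) hσ hσ0 (by positivity) (hi.toL1 h))
      atTop (𝓝 (hi.toL1 h)) := by
  obtain ⟨C, hC⟩ := hs.exists_bound_of_continuous hc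
  have hC0 : 0 ≤ C := (norm_nonneg _).trans (hC 0)
  -- The flow fixes velocities, so `K` is invariant and supports every `R h`; a constant on `K`
  -- therefore serves as dominating function.
  set K : Set Phase := univ ×ˢ (Prod.snd '' tsupport h) with hK
  have hKc : IsCompact K := isCompact_univ.prod (hs.isCompact.image continuous_snd)
  have hzero : ∀ z, z ∉ K → ∀ t, h (stream t z) = 0 := by
    intro z hz t
    apply image_eq_zero_of_notMem_tsupport
    intro ht
    exact hz ⟨mem_univ _, _, ht, rfl⟩
  rw [tendsto_iff_norm_sub_tendsto_zero]
  have e : ∀ n : ℕ, ‖((n : ℝ) + 1) • resolvL1 σ (n + 1) hσ hσ0 (by positivity) (hi.toL1 h)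
      - hi.toL1 h‖ = ∫ z, ‖((n : ℝ) + 1) * resolvFun σ (n + 1) h z - h z‖ := by
    intro n
    rw [L1.norm_eq_integral_norm]
    refine integral_congr_ae ?_
    filter_upwards [Lp.coeFn_sub (((n : ℝ) + 1) • resolvL1 σ (n + 1) hσ hσ0 (by positivity)
        (hi.toL1 h)) (hi.toL1 h), hi.coeFn_toL1, Lp.coeFn_smul ((n : ℝ) + 1)
        (resolvL1 σ (n + 1) hσ hσ0 (by positivity) (hi.toL1 h)),
      coeFn_resolvL1 hσ hσ0 (lam := n + 1) (by positivity) (hi.toL1 h),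
      resolvFun_congr (σ := σ) (lam := n + 1) (Lp.stronglyMeasurable (hi.toL1 h))
        hc.stronglyMeasurable hi.coeFn_toL1] with z h1 h2 h3 h4 h5
    rw [h1, Pi.sub_apply, h2, h3, Pi.smul_apply, h4, h5, smul_eq_mul]
  simp_rw [e]
  have h0 : ∫ _z : Phase, (0 : ℝ) = 0 := integral_zero _ _
  rw [← h0]
  refine tendsto_integral_of_dominated_convergence (K.indicator fun _ => 2 * C) ?_ ?_ ?_ ?_
  · intro n
    exact ((((stronglyMeasurable_resolvFun hσ hc.stronglyMeasurable).const_mul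
      ((n : ℝ) + 1)).sub hc.stronglyMeasurable).norm).aestronglyMeasurable
  · exact (integrable_indicator_iff hKc.measurableSet).2 (integrableOn_const hKc.measure_ne_top)
  · intro n
    refine Eventually.of_forall fun z => ?_
    have hn : (0 : ℝ) < n + 1 := by positivity
    rw [norm_norm]
    by_cases hz : z ∈ K
    · rw [indicator_of_mem hz]
      have h1 : ‖resolvFun σ (n + 1) h z‖ ≤ ((n : ℝ) + 1)⁻¹ * C := by
        rw [← integral_exp_neg_mul_Ioi hn, ← integral_mul_const]
        refine norm_integral_le_of_norm_le
          ((integrableOn_exp_mul_Ioi (by linarith) 0).mul_const C) ?_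
        refine (ae_restrict_iff' measurableSet_Ioi).2 (Eventually.of_forall fun s hs => ?_)
        have hs' : (0 : ℝ) < s := hs
        rw [norm_mul, Real.norm_of_nonneg (decay_pos _ _ _ _).le, decay]
        refine mul_le_mul (Real.exp_le_exp.2 ?_) (hC _) (norm_nonneg _) (Real.exp_pos _).le
        have := mul_nonneg (hσ0 z.2) hs'.le
        linarith
      calc _ ≤ ‖((n : ℝ) + 1) * resolvFun σ (n + 1) h z‖ + ‖h z‖ := norm_sub_le _ _
        _ ≤ C + C := by
            gcongr
            · rw [norm_mul, Real.norm_of_nonneg hn.le]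
              calc _ ≤ ((n : ℝ) + 1) * (((n : ℝ) + 1)⁻¹ * C) := by gcongr
                _ = C := by field_simp
            · exact hC z
        _ = 2 * C := by ring
    · rw [indicator_of_notMem hz]
      have h1 : resolvFun σ (n + 1) h z = 0 := by simp [resolvFun, hzero z hz]
      have h2 : h z = 0 := by simpa using hzero z hz 0
      simp [h1, h2]
  · refine Eventually.of_forall fun z => ?_
    have h1 := tendsto_smul_resolvFun hσ0 hc hC z
    have := (h1.sub_const (h z)).norm
    simpa using this

/-- The union of the ranges of the resolvents is dense. -/
lemma dense_of_range_resolvL1 (hσ : Measurable σ) (hσ0 : ∀ v, 0 ≤ σ v) {D : Submodule ℝ L1Phase}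
    (hD : ∀ (lam : ℝ) (hlam : 0 < lam) h, resolvL1 σ lam hσ hσ0 hlam h ∈ D) :
    Dense (D : Set L1Phase) := by
  intro f
  rw [Metric.mem_closure_iff]
  intro ε hε
  have : IsLocallyFiniteMeasure (volume : Measure Phase) :=
    inferInstanceAs (IsLocallyFiniteMeasure
      ((volume : Measure Torus).prod (volume : Measure Vel)))
  obtain ⟨h, hs, hle, hc, hi⟩ := (L1.integrable_coeFn f).exists_hasCompactSupport_integral_sub_le
    (show 0 < ε / 3 by positivity)
  obtain ⟨n, hn⟩ := ((Metric.tendsto_atTop.1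
    (tendsto_smul_resolvL1_of_hasCompactSupport hσ hσ0 hc hs hi)) (ε / 3) (by positivity))
  refine ⟨_, D.smul_mem ((n : ℝ) + 1) (hD (n + 1) (by positivity) (hi.toL1 h)), ?_⟩
  have h1 : dist f (hi.toL1 h) ≤ ε / 3 := by
    rw [dist_eq_norm, L1.norm_eq_integral_norm]
    refine le_trans (le_of_eq (integral_congr_ae ?_)) hle
    filter_upwards [Lp.coeFn_sub f (hi.toL1 h), hi.coeFn_toL1] with z h1 h2
    rw [h1, Pi.sub_apply, h2]
  have h2 := hn n le_rfl
  rw [dist_comm] at h2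
  linarith [dist_triangle f (hi.toL1 h) (((n : ℝ) + 1) • resolvL1 σ (n + 1) hσ hσ0 (by positivity)
    (hi.toL1 h))]

end LinBoltz

end

noncomputable section

namespace LinBoltz

open Filter Topology
open scoped ENNReal

/-! ### The resolvent solves the transport equation -/

lemma streamDeriv_eq (φ : Phase → ℝ) (z : Phase) :
    streamDeriv φ z = deriv (fun s => φ (stream s z)) 0 := rfl

lemma IsTestFunction.hasDerivAt_stream {φ : Phase → ℝ} (hφ : IsTestFunction φ) (z : Phase) (t : ℝ) :
    HasDerivAt (fun s => φ (stream s z)) (streamDeriv φ (stream t z)) t := by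
  have hd : ∀ z, DifferentiableAt ℝ (fun s => φ (stream s z)) 0 := by
    intro z
    obtain ⟨p, rfl⟩ := isOpenQuotientMap_cover.surjective z
    have h1 : (fun s => φ (stream s (cover p)))
        = (fun q => φ (cover q)) ∘ fun s : ℝ => (p.1 + fun i => s * p.2 i, p.2) := by
      funext s
      simp only [stream, cover, Function.comp, torusProj_add]
    rw [h1]
    exact ((hφ.1.differentiable (by simp)) _).comp _ (by fun_prop)
  have h2 := (hd (stream t z)).hasDerivAt
  rw [← streamDeriv_eq, ← sub_self t] at h2
  have h3 := h2.comp_sub_const t t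
  refine h3.congr_of_eventuallyEq (Eventually.of_forall fun s => ?_)
  simp [stream_stream]

lemma IsTestFunction.exists_bound {φ : Phase → ℝ} (hφ : IsTestFunction φ) :
    ∃ C, 0 ≤ C ∧ (∀ z, |φ z| ≤ C) ∧ ∀ z, |streamDeriv φ z| ≤ C := by
  obtain ⟨C₁, h₁⟩ := hφ.2.exists_bound_of_continuous hφ.continuous
  obtain ⟨C₂, h₂⟩ := hφ.hasCompactSupport_streamDeriv.exists_bound_of_continuous
    hφ.continuous_streamDeriv
  exact ⟨max C₁ C₂, (norm_nonneg _).trans ((h₁ 0).trans (le_max_left _ _)),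
    fun z => (h₁ z).trans (le_max_left _ _), fun z => (h₂ z).trans (le_max_right _ _)⟩

/-- The integrand is the time derivative of `exp(-(λ + σ) t) φ(x + t v, v)`, so only the boundary
term at `t = 0` remains. -/
lemma integral_decay_mul_test {σ : Vel → ℝ} {lam : ℝ} (hσ0 : ∀ v, 0 ≤ σ v) (hlam : 0 < lam)
    {φ : Phase → ℝ} (hφ : IsTestFunction φ) (z : Phase) :
    ∫ t in Ioi (0 : ℝ), decay σ lam z.2 t * (streamDeriv φ (stream t z)
      - (lam + σ z.2) * φ (stream t z)) = -φ z := by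
  obtain ⟨C, hC0, hC, hC'⟩ := hφ.exists_bound
  have hpos : 0 < lam + σ z.2 := by linarith [hσ0 z.2]
  have hcs : Continuous fun t : ℝ => stream t z :=
    continuous_stream.comp (f := fun t : ℝ => (t, z)) (by fun_prop)
  have hexp : Tendsto (fun t => decay σ lam z.2 t) atTop (𝓝 0) := by
    unfold decay
    refine Real.tendsto_exp_atBot.comp ?_
    exact tendsto_id.const_mul_atTop_of_neg (by linarith)
  have hd : ∀ t, HasDerivAt (fun t => decay σ lam z.2 t * φ (stream t z))
      (decay σ lam z.2 t * (streamDeriv φ (stream t z) - (lam + σ z.2) * φ (stream t z))) t := by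
    intro t
    have h1 : HasDerivAt (fun t => decay σ lam z.2 t) (decay σ lam z.2 t * (-(lam + σ z.2))) t := by
      unfold decay
      have h0 := ((hasDerivAt_id t).const_mul (-(lam + σ z.2))).exp
      simpa using h0
    have h2 := h1.mul (hφ.hasDerivAt_stream z t)
    refine h2.congr_deriv ?_
    ring
  have hint : IntegrableOn (fun t => decay σ lam z.2 t * (streamDeriv φ (stream t z)
      - (lam + σ z.2) * φ (stream t z))) (Ioi 0) := by
    have h1 : IntegrableOn (fun t => decay σ lam z.2 t * (C + (lam + σ z.2) * C)) (Ioi 0) :=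
      (integrableOn_exp_mul_Ioi (by linarith) 0).mul_const _
    refine h1.mono' ?_ (Eventually.of_forall fun t => ?_)
    · refine Continuous.aestronglyMeasurable ?_
      have h2 := hφ.continuous_streamDeriv
      have h3 := hφ.continuous
      unfold decay
      fun_prop
    · rw [norm_mul, Real.norm_of_nonneg (decay_pos _ _ _ _).le]
      refine mul_le_mul_of_nonneg_left ?_ (decay_pos _ _ _ _).le
      refine (norm_sub_le _ _).trans (add_le_add (hC' _) ?_)
      rw [norm_mul, Real.norm_of_nonneg hpos.le]
      exact mul_le_mul_of_nonneg_left (hC _) hpos.le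
  have htend : Tendsto (fun t => decay σ lam z.2 t * φ (stream t z)) atTop (𝓝 0) := by
    refine squeeze_zero_norm (fun t => ?_) (by simpa using hexp.mul_const C)
    rw [norm_mul, Real.norm_of_nonneg (decay_pos _ _ _ _).le]
    exact mul_le_mul_of_nonneg_left (hC _) (decay_pos _ _ _ _).le
  rw [integral_Ioi_of_hasDerivAt_of_tendsto (hd 0).continuousAt.continuousWithinAt
    (fun t _ => hd t) hint htend]
  simp [decay]

lemma integrable_mul_transport_test {g : L1Vel} (lam : ℝ) {f : L1Phase}
    (hf : LocallyIntegrable (loss g f) volume) {φ : Phase → ℝ} (hφ : IsTestFunction φ) :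
    Integrable fun z : Phase => f z * (streamDeriv φ z - (lam + collRate g z.2) * φ z) := by
  have i1 := integrable_mul_test (locallyIntegrable_coe f) hφ.continuous_streamDeriv
    hφ.hasCompactSupport_streamDeriv
  have i2 := integrable_mul_test hf hφ.continuous hφ.2
  have i3 := integrable_mul_test (locallyIntegrable_coe f) hφ.continuous hφ.2
  refine ((i1.sub i2).sub (i3.const_mul lam)).congr (Eventually.of_forall fun z => ?_)
  simp only [loss, Pi.sub_apply]
  ring

lemma integral_mul_transport_test {g : L1Vel} (lam : ℝ) {f : L1Phase}
    (hf : LocallyIntegrable (loss g f) volume) {φ : Phase → ℝ} (hφ : IsTestFunction φ) :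
    ∫ z, f z * (streamDeriv φ z - (lam + collRate g z.2) * φ z)
      = (∫ z, f z * streamDeriv φ z) - (∫ z, loss g f z * φ z) - lam * ∫ z, f z * φ z := by
  have i1 := integrable_mul_test (locallyIntegrable_coe f) hφ.continuous_streamDeriv
    hφ.hasCompactSupport_streamDeriv
  have i2 := integrable_mul_test hf hφ.continuous hφ.2
  have i3 := integrable_mul_test (locallyIntegrable_coe f) hφ.continuous hφ.2
  have i12 : Integrable fun z => f z * streamDeriv φ z - loss g f z * φ z := i1.sub i2
  rw [← integral_const_mul, ← integral_sub i1 i2, ← integral_sub i12 (i3.const_mul lam)]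
  refine integral_congr_ae (Eventually.of_forall fun z => ?_)
  simp only [loss]
  ring

lemma integral_phase_symm {f : Phase → ℝ} (hf : Integrable f) :
    ∫ z, f z = ∫ v : Vel, ∫ x : Torus, f (x, v) :=
  integral_prod_symm f hf

/-- The weak equation is the adjoint formula for `R` tested with `v · ∂ₓφ - (λ + σ) φ`, whose
backward resolvent is `-φ`. -/
lemma isTransportLoss_resolvL1 {g : L1Vel} {lam : ℝ} (hσ : Measurable (collRate g))
    (hσ0 : ∀ v, 0 ≤ collRate g v) (hlam : 0 < lam) (h : L1Phase) :
    IsTransportLoss g (resolvL1 (collRate g) lam hσ hσ0 hlam h)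
      (lam • resolvL1 (collRate g) lam hσ hσ0 hlam h - h) := by
  set f := resolvL1 (collRate g) lam hσ hσ0 hlam h with hf
  have hloss : Integrable (loss g f) :=
    integrable_resolvL1_mul hσ hσ0 hlam h (Ψ := fun z => collRate g z.2) (C := 1)
      (by fun_prop) fun z => by rw [abs_of_nonneg (hσ0 _)]; linarith
  refine ⟨hloss.locallyIntegrable, fun φ hφ => ?_⟩
  obtain ⟨C, hC0, hC, hC'⟩ := hφ.exists_bound
  have hpos : ∀ v, 0 < lam + collRate g v := fun v => by linarith [hσ0 v]
  have key := integral_resolvL1_mul hσ hσ0 hlam h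
    (Ψ := fun z => streamDeriv φ z - (lam + collRate g z.2) * φ z) (C := C / lam + C)
    (hφ.continuous_streamDeriv.measurable.sub
      (Measurable.mul (by fun_prop) hφ.continuous.measurable)) fun z => by
      refine (abs_sub _ _).trans ?_
      rw [abs_mul, abs_of_pos (hpos _), add_mul (C / lam)]
      refine add_le_add ((hC' z).trans ?_) ?_
      · rw [div_mul_eq_mul_div, le_div_iff₀ hlam]
        gcongr
        linarith [hσ0 z.2]
      · rw [mul_comm]
        exact mul_le_mul_of_nonneg_right (hC z) (hpos _).le
  simp only [stream_snd] at key
  simp_rw [integral_decay_mul_test hσ0 hlam hφ] at key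
  have i3 := integrable_mul_test (locallyIntegrable_coe f) hφ.continuous hφ.2
  have i4 := integrable_mul_test (locallyIntegrable_coe h) hφ.continuous hφ.2
  have e1 := integral_mul_transport_test lam hloss.locallyIntegrable hφ
  have e2 : ∫ z, (lam • f - h) z * φ z = lam * (∫ z, f z * φ z) - ∫ z, h z * φ z := by
    rw [← integral_const_mul, ← integral_sub (i3.const_mul lam) i4]
    refine integral_congr_ae ?_
    filter_upwards [Lp.coeFn_sub (lam • f) h, Lp.coeFn_smul lam f] with z h1 h2
    rw [h1, Pi.sub_apply, h2, Pi.smul_apply, smul_eq_mul]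
    ring
  have e3 : ∫ z, h z * -φ z = -∫ z, h z * φ z := by
    rw [← integral_neg]
    refine integral_congr_ae (Eventually.of_forall fun z => ?_)
    simp only
    ring
  rw [e3] at key
  rw [e2]
  linarith [key.symm.trans e1]

/-! ### Uniqueness for the transport equation, by Fourier series in the position -/

/-- `2π k · y` -/
def phaseDot (k : Fin 3 → ℤ) (y : Fin 3 → ℝ) : ℝ := 2 * Real.pi * ∑ i, k i * y i

lemma mFourier_add_torusProj (k : Fin 3 → ℤ) (x : Torus) (y : Fin 3 → ℝ) :
    UnitAddTorus.mFourier k (x + torusProj y)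
      = UnitAddTorus.mFourier k x * Complex.exp (phaseDot k y * Complex.I) := by
  have h1 : Complex.exp (phaseDot k y * Complex.I)
      = ∏ i, fourier (T := 1) (k i) ((y i : ℝ) : UnitAddCircle) := by
    simp only [fourier_coe_apply]
    rw [← Complex.exp_sum]
    congr 1
    simp only [phaseDot, Complex.ofReal_mul, Complex.ofReal_sum, Finset.mul_sum, Finset.sum_mul]
    refine Finset.sum_congr rfl fun i _ => ?_
    push_cast
    ring
  rw [h1]
  simp only [UnitAddTorus.mFourier, ContinuousMap.coe_mk]
  rw [← Finset.prod_mul_distrib]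
  refine Finset.prod_congr rfl fun i _ => ?_
  simp only [Pi.add_apply, torusProj, fourier_apply, smul_add, AddCircle.toCircle_add,
    Circle.coe_mul]

/-- The real part of the character `exp(2π i k · x)`. -/
def fourierRe (k : Fin 3 → ℤ) (x : Torus) : ℝ := (UnitAddTorus.mFourier k x).re

/-- The imaginary part of the character `exp(2π i k · x)`. -/
def fourierIm (k : Fin 3 → ℤ) (x : Torus) : ℝ := (UnitAddTorus.mFourier k x).im

lemma continuous_fourierRe (k : Fin 3 → ℤ) : Continuous (fourierRe k) :=
  Complex.continuous_re.comp (UnitAddTorus.mFourier k).continuous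

lemma continuous_fourierIm (k : Fin 3 → ℤ) : Continuous (fourierIm k) :=
  Complex.continuous_im.comp (UnitAddTorus.mFourier k).continuous

lemma fourierRe_add (k : Fin 3 → ℤ) (x : Torus) (y : Fin 3 → ℝ) :
    fourierRe k (x + torusProj y)
      = fourierRe k x * Real.cos (phaseDot k y) - fourierIm k x * Real.sin (phaseDot k y) := by
  simp only [fourierRe, fourierIm, mFourier_add_torusProj, Complex.mul_re,
    Complex.exp_ofReal_mul_I_re, Complex.exp_ofReal_mul_I_im]

lemma fourierIm_add (k : Fin 3 → ℤ) (x : Torus) (y : Fin 3 → ℝ) :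
    fourierIm k (x + torusProj y)
      = fourierRe k x * Real.sin (phaseDot k y) + fourierIm k x * Real.cos (phaseDot k y) := by
  simp only [fourierRe, fourierIm, mFourier_add_torusProj, Complex.mul_im,
    Complex.exp_ofReal_mul_I_re, Complex.exp_ofReal_mul_I_im]

lemma contDiff_phaseDot (k : Fin 3 → ℤ) : ContDiff ℝ ∞ (phaseDot k) := by
  unfold phaseDot
  fun_prop

lemma contDiff_fourierRe (k : Fin 3 → ℤ) : ContDiff ℝ ∞ fun y => fourierRe k (torusProj y) := by
  have h := contDiff_phaseDot k
  have e : (fun y => fourierRe k (torusProj y)) = fun y =>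
      fourierRe k 0 * Real.cos (phaseDot k y) - fourierIm k 0 * Real.sin (phaseDot k y) := by
    funext y
    rw [← fourierRe_add, zero_add]
  rw [e]
  fun_prop

lemma contDiff_fourierIm (k : Fin 3 → ℤ) : ContDiff ℝ ∞ fun y => fourierIm k (torusProj y) := by
  have h := contDiff_phaseDot k
  have e : (fun y => fourierIm k (torusProj y)) = fun y =>
      fourierRe k 0 * Real.sin (phaseDot k y) + fourierIm k 0 * Real.cos (phaseDot k y) := by
    funext y
    rw [← fourierIm_add, zero_add]
  rw [e]
  fun_prop

lemma isTestFunction_mul {c : Torus → ℝ} (hc : ContDiff ℝ ∞ fun y => c (torusProj y)) {χ : Vel → ℝ}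
    (hχ : ContDiff ℝ ∞ χ) (hs : HasCompactSupport χ) :
    IsTestFunction fun z => c z.1 * χ z.2 := by
  refine ⟨?_, ?_⟩
  · exact (hc.comp contDiff_fst).mul (hχ.comp contDiff_snd)
  · refine HasCompactSupport.intro (isCompact_univ.prod hs.isCompact) ?_
    rintro ⟨x, v⟩ hz
    have : χ v = 0 := image_eq_zero_of_notMem_tsupport fun h => hz ⟨mem_univ _, h⟩
    simp [this]

lemma phaseDot_smul (k : Fin 3 → ℤ) (s : ℝ) (v : Fin 3 → ℝ) :
    phaseDot k (fun i => s * v i) = s * phaseDot k v := by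
  simp only [phaseDot, Finset.mul_sum]
  refine Finset.sum_congr rfl fun i _ => ?_
  ring

lemma streamDeriv_fourierRe (k : Fin 3 → ℤ) (χ : Vel → ℝ) (z : Phase) :
    streamDeriv (fun z => fourierRe k z.1 * χ z.2) z
      = -(phaseDot k (fun i => z.2 i) * fourierIm k z.1 * χ z.2) := by
  unfold streamDeriv
  simp only [fourierRe_add, phaseDot_smul]
  set κ := phaseDot k fun i => z.2 i
  have h1 : HasDerivAt (fun s : ℝ => (fourierRe k z.1 * Real.cos (s * κ)
      - fourierIm k z.1 * Real.sin (s * κ)) * χ z.2)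
      ((fourierRe k z.1 * (-Real.sin (0 * κ) * (1 * κ))
        - fourierIm k z.1 * (Real.cos (0 * κ) * (1 * κ))) * χ z.2) 0 :=
    (((((hasDerivAt_id (0 : ℝ)).mul_const κ).cos).const_mul _).sub
      ((((hasDerivAt_id (0 : ℝ)).mul_const κ).sin).const_mul _)).mul_const _
  rw [h1.deriv, zero_mul, Real.sin_zero, Real.cos_zero]
  ring

lemma streamDeriv_fourierIm (k : Fin 3 → ℤ) (χ : Vel → ℝ) (z : Phase) :
    streamDeriv (fun z => fourierIm k z.1 * χ z.2) z
      = phaseDot k (fun i => z.2 i) * fourierRe k z.1 * χ z.2 := by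
  unfold streamDeriv
  simp only [fourierIm_add, phaseDot_smul]
  set κ := phaseDot k fun i => z.2 i
  have h1 : HasDerivAt (fun s : ℝ => (fourierRe k z.1 * Real.sin (s * κ)
      + fourierIm k z.1 * Real.cos (s * κ)) * χ z.2)
      ((fourierRe k z.1 * (Real.cos (0 * κ) * (1 * κ))
        + fourierIm k z.1 * (-Real.sin (0 * κ) * (1 * κ))) * χ z.2) 0 :=
    (((((hasDerivAt_id (0 : ℝ)).mul_const κ).sin).const_mul _).add
      ((((hasDerivAt_id (0 : ℝ)).mul_const κ).cos).const_mul _)).mul_const _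
  rw [h1.deriv, zero_mul, Real.sin_zero, Real.cos_zero]
  ring

/-- An integrable function on the torus with vanishing Fourier coefficients is orthogonal to all
continuous functions. -/
lemma integral_mul_eq_zero_of_fourier {d : Torus → ℝ} (hd : Integrable d)
    (hRe : ∀ k, ∫ x, d x * fourierRe k x = 0) (hIm : ∀ k, ∫ x, d x * fourierIm k x = 0)
    {ψ : Torus → ℝ} (hψ : Continuous ψ) : ∫ x, d x * ψ x = 0 := by
  have hint : ∀ p : C(UnitAddTorus (Fin 3), ℂ), Integrable fun x : Torus => d x • p x := by
    intro p
    refine hd.smul_bdd ‖p‖ p.continuous.aestronglyMeasurable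
      (Eventually.of_forall fun x => p.norm_coe_le_norm x)
  let Λ : C(UnitAddTorus (Fin 3), ℂ) →L[ℂ] ℂ := LinearMap.mkContinuous
    { toFun := fun p => ∫ x : Torus, d x • p x
      map_add' := fun p q => by
        rw [← integral_add (hint p) (hint q)]
        simp
      map_smul' := fun r p => by
        rw [RingHom.id_apply, ← integral_smul]
        refine integral_congr_ae (Eventually.of_forall fun x => ?_)
        simp only [ContinuousMap.smul_apply]
        rw [smul_comm] } (∫ x, ‖d x‖) (fun p => by
      rw [← integral_mul_const]
      refine norm_integral_le_of_norm_le (hd.norm.mul_const _) (Eventually.of_forall fun x => ?_)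
      rw [norm_smul]
      gcongr
      exact p.norm_coe_le_norm x)
  have hΛ : ∀ k, Λ (UnitAddTorus.mFourier k) = 0 := by
    intro k
    have h0 := hint (UnitAddTorus.mFourier k)
    apply Complex.ext
    · refine (Complex.reCLM.integral_comp_comm h0).symm.trans (Eq.trans ?_ (hRe k))
      refine integral_congr_ae (Eventually.of_forall fun x => ?_)
      simp [fourierRe]
    · refine (Complex.imCLM.integral_comp_comm h0).symm.trans (Eq.trans ?_ (hIm k))
      refine integral_congr_ae (Eventually.of_forall fun x => ?_)
      simp [fourierIm]
  -- The kernel of `Λ` is closed and contains the characters, whose span is dense.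
  have hker : (⊤ : Submodule ℂ C(UnitAddTorus (Fin 3), ℂ)) ≤ Λ.ker := by
    rw [← UnitAddTorus.span_mFourier_closure_eq_top]
    refine Submodule.topologicalClosure_minimal _ (Submodule.span_le.2 ?_) Λ.isClosed_ker
    rintro _ ⟨k, rfl⟩
    exact hΛ k
  have h1 : Λ ⟨fun x => (ψ x : ℂ), Complex.continuous_ofReal.comp hψ⟩ = 0 := hker trivial
  have h2 : ((∫ x, d x * ψ x : ℝ) : ℂ) = 0 := by
    rw [← h1, ← integral_complex_ofReal]
    refine integral_congr_ae (Eventually.of_forall fun x => ?_)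
    simp
  exact_mod_cast h2

lemma integrable_mul_comp_fst {d : Phase → ℝ} (hd : Integrable d) {c : Torus → ℝ}
    (hc : Continuous c) : Integrable fun z : Phase => d z * c z.1 := by
  obtain ⟨C, hC⟩ := (isCompact_univ : IsCompact (univ : Set Torus)).exists_bound_of_continuousOn
    hc.continuousOn
  exact hd.mul_bdd (c := C) (hc.comp continuous_fst).aestronglyMeasurable
    (Eventually.of_forall fun z => hC z.1 (mem_univ _))

/-- A first-order relation between two Fourier modes, tested against all `χ`. -/
lemma ae_eq_of_forall_test {σ : Vel → ℝ} (hσ : Measurable σ) {C : ℝ}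
    (hC : ∀ v, |σ v| ≤ C * (1 + ‖v‖)) {a b : Vel → ℝ} (ha : Integrable a) (hb : Integrable b)
    (k : Fin 3 → ℤ)
    (h : ∀ χ : Vel → ℝ, ContDiff ℝ ∞ χ → HasCompactSupport χ →
      ∫ v, χ v * (phaseDot k (fun i => v i) * b v - σ v * a v) = 0) :
    ∀ᵐ v, phaseDot k (fun i => v i) * b v - σ v * a v = 0 := by
  have hk : Continuous fun v : Vel => phaseDot k (fun i => v i) :=
    (contDiff_phaseDot k).continuous.comp (by fun_prop)
  have hloc : ∀ {w : Vel → ℝ}, Continuous w → ∀ {u : Vel → ℝ}, Integrable u →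
      LocallyIntegrable fun v => w v * u v := by
    intro w hw u hu
    have := (hu.locallyIntegrable.locallyIntegrableOn univ).continuousOn_mul hw.continuousOn
      isOpen_univ.isLocallyClosed
    exact locallyIntegrableOn_univ.1 this
  refine ae_eq_zero_of_integral_contDiff_smul_eq_zero ?_ h
  refine (hloc hk hb).sub ?_
  refine (hloc (w := fun v => C * (1 + ‖v‖)) (by fun_prop) ha).mono
    (hσ.aestronglyMeasurable.mul ha.1) (Eventually.of_forall fun v => ?_)
  rw [norm_mul, norm_mul, Real.norm_eq_abs (σ v), Real.norm_eq_abs (C * _)]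
  exact mul_le_mul_of_nonneg_right ((hC v).trans (le_abs_self _)) (norm_nonneg _)

/-- A Fourier transform in `x` turns the equation into `(λ + collRate + 2πi k·v) d̂(k, v) = 0` for
almost every `v`. The factor has positive real part, so all coefficients vanish. No regularisation
along characteristics is needed. -/
lemma eq_zero_of_isTransportLoss {g : L1Vel} {lam C : ℝ} (hσ : Measurable (collRate g))
    (hσ0 : ∀ v, 0 ≤ collRate g v) (hC : ∀ v, collRate g v ≤ C * (1 + ‖v‖)) (hlam : 0 < lam)
    {d : L1Phase} (hd : IsTransportLoss g d (lam • d)) : d = 0 := by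
  set σ : Vel → ℝ := fun v => lam + collRate g v with hσdef
  have hpos : ∀ v, 0 < σ v := fun v => by simp only [hσdef]; linarith [hσ0 v]
  have hσC : ∀ v, |σ v| ≤ (lam + C) * (1 + ‖v‖) := by
    intro v
    rw [abs_of_pos (hpos v), add_mul]
    refine add_le_add ?_ (hC v)
    nlinarith [norm_nonneg v]
  have hdi := L1.integrable_coeFn d
  set a : (Fin 3 → ℤ) → Vel → ℝ := fun k v => ∫ x, d (x, v) * fourierRe k x with ha
  set b : (Fin 3 → ℤ) → Vel → ℝ := fun k v => ∫ x, d (x, v) * fourierIm k x with hb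
  have hai : ∀ k, Integrable (a k) := fun k =>
    (integrable_mul_comp_fst hdi (continuous_fourierRe k)).integral_prod_right
  have hbi : ∀ k, Integrable (b k) := fun k =>
    (integrable_mul_comp_fst hdi (continuous_fourierIm k)).integral_prod_right
  have hweak : ∀ φ, IsTestFunction φ → ∫ z : Phase, d z * (streamDeriv φ z - σ z.2 * φ z) = 0 := by
    intro φ hφ
    have e1 := integral_mul_transport_test lam hd.1 hφ
    have e2 : ∫ z, (lam • d) z * φ z = lam * ∫ z, d z * φ z := by
      rw [← integral_const_mul]
      refine integral_congr_ae ?_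
      filter_upwards [Lp.coeFn_smul lam d] with z hz
      rw [hz, Pi.smul_apply, smul_eq_mul, mul_assoc]
    rw [e1, hd.2 φ hφ, e2, sub_self]
  have hweaki : ∀ φ, IsTestFunction φ →
      Integrable fun z : Phase => d z * (streamDeriv φ z - σ z.2 * φ z) := fun φ hφ =>
    integrable_mul_transport_test lam hd.1 hφ
  have hslice : ∀ᵐ v, Integrable fun x => d (x, v) := hdi.prod_left_ae
  have hslice' : ∀ᵐ v, ∀ {c : Torus → ℝ}, Continuous c → Integrable fun x => d (x, v) * c x := by
    filter_upwards [hslice] with v hv c hc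
    obtain ⟨C, hC⟩ := (isCompact_univ : IsCompact (univ : Set Torus)).exists_bound_of_continuousOn
      hc.continuousOn
    exact hv.mul_bdd (c := C) hc.aestronglyMeasurable (Eventually.of_forall fun z => hC z (mem_univ _))
  -- The real and imaginary parts of the `k`-th mode are tested separately, against a cosine here
  -- and a sine in `h2`. The coupling terms cancel in `a · h1 + b · h2`.
  have h1 : ∀ k, ∀ᵐ v : Vel, phaseDot k (fun i => v i) * (-b k v) - σ v * a k v = 0 := by
    intro k
    refine ae_eq_of_forall_test (by fun_prop) hσC (hai k) (hbi k).neg k fun χ hχ hs => ?_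
    have hφ := isTestFunction_mul (contDiff_fourierRe k) hχ hs
    rw [← hweak _ hφ, integral_phase_symm (hweaki _ hφ)]
    refine integral_congr_ae ?_
    filter_upwards [hslice'] with v hv
    simp only [streamDeriv_fourierRe, ha, hb, Pi.neg_apply]
    have e : ∀ x : Torus, d (x, v) * (-(phaseDot k (fun i => v i) * fourierIm k x * χ v)
        - σ v * (fourierRe k x * χ v))
        = (-(χ v * phaseDot k (fun i => v i))) * (d (x, v) * fourierIm k x)
          - (χ v * σ v) * (d (x, v) * fourierRe k x) := fun x => by ring
    simp_rw [e]
    rw [integral_sub ((hv (continuous_fourierIm k)).const_mul _)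
      ((hv (continuous_fourierRe k)).const_mul _), integral_const_mul, integral_const_mul]
    ring
  have h2 : ∀ k, ∀ᵐ v : Vel, phaseDot k (fun i => v i) * a k v - σ v * b k v = 0 := by
    intro k
    refine ae_eq_of_forall_test (by fun_prop) hσC (hbi k) (hai k) k fun χ hχ hs => ?_
    have hφ := isTestFunction_mul (contDiff_fourierIm k) hχ hs
    rw [← hweak _ hφ, integral_phase_symm (hweaki _ hφ)]
    refine integral_congr_ae ?_
    filter_upwards [hslice'] with v hv
    simp only [streamDeriv_fourierIm, ha, hb]
    have e : ∀ x : Torus, d (x, v) * (phaseDot k (fun i => v i) * fourierRe k x * χ v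
        - σ v * (fourierIm k x * χ v))
        = (χ v * phaseDot k (fun i => v i)) * (d (x, v) * fourierRe k x)
          - (χ v * σ v) * (d (x, v) * fourierIm k x) := fun x => by ring
    simp_rw [e]
    rw [integral_sub ((hv (continuous_fourierRe k)).const_mul _)
      ((hv (continuous_fourierIm k)).const_mul _), integral_const_mul, integral_const_mul]
    ring
  have h3 : ∀ᵐ v : Vel, ∀ k, a k v = 0 ∧ b k v = 0 := by
    rw [ae_all_iff]
    intro k
    filter_upwards [h1 k, h2 k] with v hv1 hv2
    have hsum : σ v * (a k v ^ 2 + b k v ^ 2) = 0 := by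
      linear_combination (-(a k v)) * hv1 - b k v * hv2
    have hsq : a k v ^ 2 + b k v ^ 2 = 0 := (mul_eq_zero.1 hsum).resolve_left (hpos v).ne'
    exact ⟨by nlinarith [sq_nonneg (a k v), sq_nonneg (b k v)],
      by nlinarith [sq_nonneg (a k v), sq_nonneg (b k v)]⟩
  refine eq_zero_of_integral_test d fun φ hφ => ?_
  rw [integral_phase_symm (integrable_mul_test (locallyIntegrable_coe d) hφ.continuous hφ.2)]
  refine integral_eq_zero_of_ae ?_
  filter_upwards [h3, hslice] with v hv hvi
  exact integral_mul_eq_zero_of_fourier hvi (fun k => (hv k).1) (fun k => (hv k).2)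
    (hφ.continuous.comp (by fun_prop : Continuous fun x : Torus => (x, v)))

end LinBoltz

end

noncomputable section

namespace LinBoltz

open Filter Topology
open scoped ENNReal Pointwise

/-! ### The collision transformation preserves the measure -/

/-- The surface measure is defined through the volume of cones, and volume is invariant under `v ↦
-v`. -/
lemma measurePreserving_neg_sphere : MeasurePreserving (fun ν : Sph => -ν) sphMeasure sphMeasure := by
  refine ⟨continuous_neg.measurable, Measure.ext fun s hs => ?_⟩
  rw [Measure.map_apply continuous_neg.measurable hs,
    Measure.toSphere_apply' _ (continuous_neg.measurable hs), Measure.toSphere_apply' _ hs]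
  congr 1
  have e : Ioo (0 : ℝ) 1 • ((↑) '' ((fun ν : Sph => -ν) ⁻¹' s) : Set Vel)
      = (fun v => -v) ⁻¹' (Ioo (0 : ℝ) 1 • ((↑) '' s : Set Vel)) := by
    ext v
    simp only [Set.mem_smul, mem_image, mem_preimage]
    constructor
    · rintro ⟨r, hr, _, ⟨ν, hν, rfl⟩, rfl⟩
      exact ⟨r, hr, _, ⟨-ν, hν, rfl⟩, by simp⟩
    · rintro ⟨r, hr, _, ⟨ν, hν, rfl⟩, h⟩
      refine ⟨r, hr, _, ⟨-ν, by simpa using hν, rfl⟩, ?_⟩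
      rw [coe_neg_sphere, smul_neg, h, neg_neg]
  rw [e]
  exact (Measure.measurePreserving_neg (volume : Measure Vel)).measure_preimage_equiv
    (f := MeasurableEquiv.neg Vel) _

lemma inner_self_sphere (ν : Sph) : inner ℝ (ν : Vel) (ν : Vel) = (1 : ℝ) := by
  rw [real_inner_self_eq_norm_sq, norm_eq_of_mem_sphere]
  norm_num

/-- For a unit vector `ν` the collision map is a linear involution, so its determinant is `±1`. -/
lemma measurePreserving_collMap (ν : Sph) :
    MeasurePreserving (collMap (ν : Vel))
      ((volume : Measure Vel).prod volume) ((volume : Measure Vel).prod volume) := by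
  have hν := inner_self_sphere ν
  have hinv : collMap (ν : Vel) ∘ₗ collMap (ν : Vel) = LinearMap.id := by
    refine LinearMap.ext fun q => Prod.ext ?_ ?_ <;>
    · simp only [collMap, LinearMap.comp_apply, LinearMap.coe_mk, AddHom.coe_mk, LinearMap.id_apply,
        inner_add_right, inner_sub_right, inner_smul_right, hν]
      module
  have hdet : LinearMap.det (collMap (ν : Vel)) * LinearMap.det (collMap (ν : Vel)) = 1 := by
    rw [← LinearMap.det_comp, hinv, LinearMap.det_id]
  have habs : |LinearMap.det (collMap (ν : Vel))| = 1 := by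
    rcases mul_self_eq_one_iff.1 hdet with h | h <;> rw [h] <;> simp
  refine ⟨(LinearMap.continuous_of_finiteDimensional _).measurable, ?_⟩
  rw [Measure.map_linearMap_addHaar_eq_smul_addHaar _ (by
    intro h0
    rw [h0] at hdet
    norm_num at hdet), abs_inv, habs]
  simp

/-- The collision `(v, ν, v̄) ↦ (v', -ν, v̄')`, at a fixed position. -/
def collFlip (q : Phase × (Sph × Vel)) : Phase × (Sph × Vel) :=
  ((q.1.1, preVel q.1.2 q.2), (-q.2.1, preVelBar q.1.2 q.2))

lemma preVel_flip (v : Vel) (p : Sph × Vel) :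
    preVel (preVel v p) (-p.1, preVelBar v p) = v := by
  have hν := inner_self_sphere p.1
  simp only [preVel, preVelBar, coe_neg_sphere, inner_neg_left, inner_sub_right,
    inner_add_right, inner_smul_right, hν]
  module

/-- A collision reverses the normal component of the relative velocity. Replacing `ν` by `-ν`
restores its sign, which is why `collFlip` contains that reflection. -/
lemma collKernel_flip (v : Vel) (p : Sph × Vel) :
    collKernel (preVel v p) (-p.1, preVelBar v p) = collKernel v p := by
  have hν := inner_self_sphere p.1
  have h1 : inner ℝ v (p.1 : Vel) = inner ℝ (p.1 : Vel) v := real_inner_comm _ _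
  have h2 : inner ℝ p.2 (p.1 : Vel) = inner ℝ (p.1 : Vel) p.2 := real_inner_comm _ _
  unfold collKernel
  congr 1
  simp only [preVel, preVelBar, coe_neg_sphere, inner_neg_right, inner_sub_left,
    inner_add_left, inner_sub_right, real_inner_smul_left, hν, h1, h2]
  ring

lemma measurePreserving_collFlip :
    MeasurePreserving collFlip ((volume : Measure Phase).prod collMeasure)
      ((volume : Measure Phase).prod collMeasure) := by
  have h1 : MeasurePreserving (fun q : Sph × (Vel × Vel) => (-q.1, collMap (q.1 : Vel) q.2))
      (sphMeasure.prod ((volume : Measure Vel).prod (volume : Measure Vel)))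
      (sphMeasure.prod ((volume : Measure Vel).prod (volume : Measure Vel))) := by
    refine measurePreserving_neg_sphere.skew_product
      (μc := (volume : Measure Vel).prod (volume : Measure Vel))
      (μd := (volume : Measure Vel).prod (volume : Measure Vel))
      (g := fun ν q => collMap (ν : Vel) q) ?_ ?_
    · simp only [Function.uncurry_def, collMap, LinearMap.coe_mk, AddHom.coe_mk]
      fun_prop
    · exact Eventually.of_forall fun ν => (measurePreserving_collMap ν).map_eq
  have a := (measurePreserving_prodAssoc (volume : Measure Vel) sphMeasure
    (volume : Measure Vel)).symm MeasurableEquiv.prodAssoc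
  have b := (Measure.measurePreserving_swap (μ := (volume : Measure Vel))
    (ν := sphMeasure)).prod (MeasurePreserving.id (volume : Measure Vel))
  have c := measurePreserving_prodAssoc sphMeasure (volume : Measure Vel) (volume : Measure Vel)
  have h2 := c.comp (b.comp a)
  have a' := (measurePreserving_prodAssoc sphMeasure (volume : Measure Vel)
    (volume : Measure Vel)).symm MeasurableEquiv.prodAssoc
  have b' := (Measure.measurePreserving_swap (μ := sphMeasure)
    (ν := (volume : Measure Vel))).prod (MeasurePreserving.id (volume : Measure Vel))
  have c' := measurePreserving_prodAssoc (volume : Measure Vel) sphMeasure (volume : Measure Vel)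
  have h3 := c'.comp (b'.comp a')
  have h4 := h3.comp (h1.comp h2)
  have h5 := (MeasurePreserving.id (volume : Measure Torus)).prod h4
  have d := measurePreserving_prodAssoc (volume : Measure Torus) (volume : Measure Vel) collMeasure
  exact (d.symm MeasurableEquiv.prodAssoc).comp (h5.comp d)

/-! ### Estimates of the collision kernel -/

lemma measurable_collKernel : Measurable fun q : Vel × (Sph × Vel) => collKernel q.1 q.2 := by
  unfold collKernel
  fun_prop

lemma collKernel_nonneg (v : Vel) (p : Sph × Vel) : 0 ≤ collKernel v p := le_max_right _ _

lemma collKernel_le (v : Vel) (p : Sph × Vel) : collKernel v p ≤ ‖v - p.2‖ := by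
  refine max_le ?_ (norm_nonneg _)
  refine (real_inner_le_norm _ _).trans ?_
  rw [norm_eq_of_mem_sphere, mul_one]

lemma collKernel_le' (v : Vel) (p : Sph × Vel) :
    collKernel v p ≤ 2 * (1 + ‖v‖) * (1 + ‖p.2‖ ^ 2) := by
  refine (collKernel_le v p).trans ((norm_sub_le _ _).trans ?_)
  have h1 := norm_nonneg v
  have h2 := norm_nonneg p.2
  nlinarith [sq_nonneg (‖p.2‖ - 1), mul_nonneg h1 (sq_nonneg ‖p.2‖)]

/-- A collision increases the speed by a bounded amount relative to the background velocity. -/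
lemma collKernel_mul_preVel_le (v : Vel) (p : Sph × Vel) :
    collKernel v p * (1 + ‖preVel v p‖) ≤ collKernel v p * (1 + ‖v‖) + 4 * (1 + ‖p.2‖ ^ 2) := by
  have hν := inner_self_sphere p.1
  have hν1 : ‖(p.1 : Vel)‖ = 1 := norm_eq_of_mem_sphere _
  set a : ℝ := inner ℝ (p.1 : Vel) v with ha
  set b : ℝ := inner ℝ (p.1 : Vel) p.2 with hb
  have hk : collKernel v p = max (a - b) 0 := by
    unfold collKernel
    rw [inner_sub_left, real_inner_comm, real_inner_comm (p.1 : Vel) p.2]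
  have hv' : preVel v p = v + (b - a) • (p.1 : Vel) := by
    unfold preVel
    rw [inner_sub_right]
  have hb2 : |b| ≤ ‖p.2‖ := by
    have := abs_real_inner_le_norm (p.1 : Vel) p.2
    rwa [hν1, one_mul] at this
  -- The collision exchanges only the normal components `a` and `b`.
  have hsq : ‖preVel v p‖ ^ 2 = ‖v‖ ^ 2 - a ^ 2 + b ^ 2 := by
    rw [hv', norm_add_sq_real, inner_smul_right, norm_smul, hν1, real_inner_comm, ← ha,
      Real.norm_eq_abs, mul_one, sq_abs]
    ring
  have hdist : ‖preVel v p‖ ≤ ‖v‖ + |b - a| := by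
    rw [hv']
    refine (norm_add_le _ _).trans ?_
    rw [norm_smul, hν1, mul_one, Real.norm_eq_abs]
  rw [hk]
  have hn := norm_nonneg v
  have hn' := norm_nonneg (preVel v p)
  have hb3 : b ^ 2 ≤ ‖p.2‖ ^ 2 := by
    rw [← sq_abs b]
    exact pow_le_pow_left₀ (abs_nonneg _) hb2 2
  rcases le_or_gt a b with hab | hab
  · rw [max_eq_right (by linarith)]
    nlinarith [sq_nonneg ‖p.2‖]
  rw [max_eq_left (by linarith)]
  rcases le_or_gt ‖preVel v p‖ ‖v‖ with hle | hgt
  · nlinarith [sq_nonneg ‖p.2‖, mul_le_mul_of_nonneg_left hle (sub_nonneg.2 hab.le)]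
  -- If the speed rises then `|a| < |b|`, so the kernel `a - b` is at most `2|b|`. The increase of
  -- speed is also at most `a - b`, and the product is at most `4b² ≤ 4‖v̄‖²`.
  · have hba : a ^ 2 < b ^ 2 := by nlinarith
    have h1 : |a| < |b| := sq_lt_sq.1 hba
    have h2 : a - b ≤ 2 * |b| := by
      have := le_abs_self a
      have := neg_abs_le b
      linarith
    have h3 : |b - a| = a - b := by
      rw [abs_sub_comm, abs_of_pos (by linarith)]
    rw [h3] at hdist
    have h4 : (a - b) * (a - b) ≤ 4 * b ^ 2 := by
      rw [← sq_abs b]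
      nlinarith [abs_nonneg b]
    nlinarith [mul_le_mul_of_nonneg_left hdist (sub_nonneg.2 hab.le)]

/-- The second moment `∫ g(v̄) (1 + |v̄|²) dv̄ dν`. -/
def collMoment (g : L1Vel) : ℝ := ∫ p, g p.2 * (1 + ‖p.2‖ ^ 2) ∂collMeasure

lemma ae_nonneg_coll {g : L1Vel} (hg0 : 0 ≤ g) : ∀ᵐ p ∂collMeasure, 0 ≤ g p.2 :=
  Measure.quasiMeasurePreserving_snd.ae ((Lp.coeFn_nonneg g).2 hg0)

lemma integrable_moment_coll {g : L1Vel}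
    (hg : Integrable (fun v : Vel => g v * (1 + ‖v‖ ^ 2)) volume) :
    Integrable (fun p : Sph × Vel => g p.2 * (1 + ‖p.2‖ ^ 2)) collMeasure :=
  hg.comp_snd sphMeasure

lemma stronglyMeasurable_coll (g : L1Vel) :
    StronglyMeasurable fun q : Vel × (Sph × Vel) => g q.2.2 * collKernel q.1 q.2 :=
  ((Lp.stronglyMeasurable g).comp_measurable measurable_snd.snd).mul
    measurable_collKernel.stronglyMeasurable

lemma measurable_collRate (g : L1Vel) : Measurable (collRate g) :=
  (StronglyMeasurable.integral_prod_right' (stronglyMeasurable_coll g)).measurable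

lemma integrable_coll {g : L1Vel} (hg0 : 0 ≤ g)
    (hg : Integrable (fun v : Vel => g v * (1 + ‖v‖ ^ 2)) volume) (v : Vel) :
    Integrable (fun p : Sph × Vel => g p.2 * collKernel v p) collMeasure := by
  refine ((integrable_moment_coll hg).const_mul (2 * (1 + ‖v‖))).mono'
    ((stronglyMeasurable_coll g).comp_measurable measurable_prodMk_left).aestronglyMeasurable ?_
  filter_upwards [ae_nonneg_coll hg0] with p hp
  rw [norm_mul, Real.norm_of_nonneg hp, Real.norm_of_nonneg (collKernel_nonneg _ _)]
  calc _ ≤ g p.2 * (2 * (1 + ‖v‖) * (1 + ‖p.2‖ ^ 2)) := by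
        gcongr
        exact collKernel_le' v p
    _ = _ := by ring

lemma collRate_nonneg {g : L1Vel} (hg0 : 0 ≤ g) (v : Vel) : 0 ≤ collRate g v := by
  refine integral_nonneg_of_ae ?_
  filter_upwards [ae_nonneg_coll hg0] with p hp
  exact mul_nonneg hp (collKernel_nonneg _ _)

lemma collMoment_nonneg {g : L1Vel} (hg0 : 0 ≤ g) : 0 ≤ collMoment g := by
  refine integral_nonneg_of_ae ?_
  filter_upwards [ae_nonneg_coll hg0] with p hp
  exact mul_nonneg hp (by positivity)

lemma collRate_le {g : L1Vel} (hg0 : 0 ≤ g)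
    (hg : Integrable (fun v : Vel => g v * (1 + ‖v‖ ^ 2)) volume) (v : Vel) : collRate g v ≤ 2 * collMoment g * (1 + ‖v‖) := by
  have h : collRate g v ≤ ∫ p, 2 * (1 + ‖v‖) * (g p.2 * (1 + ‖p.2‖ ^ 2)) ∂collMeasure := by
    refine integral_mono_ae (integrable_coll hg0 hg v) ((integrable_moment_coll hg).const_mul _) ?_
    filter_upwards [ae_nonneg_coll hg0] with p hp
    calc _ ≤ g p.2 * (2 * (1 + ‖v‖) * (1 + ‖p.2‖ ^ 2)) := by
          gcongr
          exact collKernel_le' v p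
      _ = _ := by ring
  rw [integral_const_mul] at h
  refine h.trans (le_of_eq ?_)
  unfold collMoment
  ring

lemma lintegral_coll {g : L1Vel} (hg0 : 0 ≤ g)
    (hg : Integrable (fun v : Vel => g v * (1 + ‖v‖ ^ 2)) volume) (v : Vel) :
    ∫⁻ p, ‖g p.2 * collKernel v p‖ₑ ∂collMeasure = ENNReal.ofReal (collRate g v) := by
  rw [collRate, ofReal_integral_eq_lintegral_ofReal (integrable_coll hg0 hg v)]
  · refine lintegral_congr_ae ?_
    filter_upwards [ae_nonneg_coll hg0] with p hp
    rw [Real.enorm_of_nonneg (mul_nonneg hp (collKernel_nonneg _ _))]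
  · filter_upwards [ae_nonneg_coll hg0] with p hp
    exact mul_nonneg hp (collKernel_nonneg _ _)

lemma lintegral_coll_preVel_le {g : L1Vel} (hg0 : 0 ≤ g)
    (hg : Integrable (fun v : Vel => g v * (1 + ‖v‖ ^ 2)) volume) (v : Vel) :
    ∫⁻ p, ‖g p.2 * collKernel v p‖ₑ * ENNReal.ofReal (1 + ‖preVel v p‖) ∂collMeasure
      ≤ ENNReal.ofReal (collRate g v) * ENNReal.ofReal (1 + ‖v‖)
        + ENNReal.ofReal (4 * collMoment g) := by
  have hm : Measurable fun p : Sph × Vel => ‖g p.2 * collKernel v p‖ₑ :=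
    ((stronglyMeasurable_coll g).measurable.comp measurable_prodMk_left).enorm
  rw [← lintegral_coll hg0 hg, ← lintegral_mul_const _ hm, collMoment, ← integral_const_mul,
    ofReal_integral_eq_lintegral_ofReal ((integrable_moment_coll hg).const_mul 4),
    ← lintegral_add_left (hm.mul_const _)]
  · refine lintegral_mono_ae ?_
    filter_upwards [ae_nonneg_coll hg0] with p hp
    have hk := collKernel_nonneg v p
    rw [Real.enorm_of_nonneg (mul_nonneg hp hk), ← ENNReal.ofReal_mul (mul_nonneg hp hk),
      ← ENNReal.ofReal_mul (mul_nonneg hp hk),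
      ← ENNReal.ofReal_add (by positivity) (by positivity)]
    refine ENNReal.ofReal_le_ofReal ?_
    have := mul_le_mul_of_nonneg_left (collKernel_mul_preVel_le v p) hp
    calc _ = g p.2 * (collKernel v p * (1 + ‖preVel v p‖)) := by ring
      _ ≤ _ := this
      _ = _ := by ring
  · filter_upwards [ae_nonneg_coll hg0] with p hp
    positivity

end LinBoltz

end

noncomputable section

namespace LinBoltz

open Filter Topology
open scoped ENNReal

/-! ### The gain term -/

/-- The density `f(x, v) g(v̄) [(v - v̄) · ν]₊` of collisions. -/
def collDensity (g : L1Vel) (f : L1Phase) (q : Phase × (Sph × Vel)) : ℝ :=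
  f q.1 * (g q.2.2 * collKernel q.1.2 q.2)

lemma stronglyMeasurable_collDensity (g : L1Vel) (f : L1Phase) :
    StronglyMeasurable (collDensity g f) :=
  ((Lp.stronglyMeasurable f).comp_measurable measurable_fst).mul
    ((stronglyMeasurable_coll g).comp_measurable (measurable_fst.snd.prodMk measurable_snd))

lemma gainIntegrand_eq (g : L1Vel) (f : L1Phase) (z : Phase) (p : Sph × Vel) :
    gainIntegrand g f z p = collDensity g f (collFlip (z, p)) := by
  simp only [gainIntegrand, collDensity, collFlip, collKernel_flip]
  ring

lemma gain_eq (g : L1Vel) (f : L1Phase) (z : Phase) :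
    gain g f z = ∫ p, collDensity g f (collFlip (z, p)) ∂collMeasure := by
  simp only [gain, gainIntegrand_eq]

/-- The change of variables `collFlip` turns the gain into the collision density of `f`, and the
weight `Φ(v)` into `Φ(v')`. With `Φ = 1` the right side is the norm of the loss; with `Φ = 1 + |v|`
the kernel estimate bounds the change of weight. -/
lemma lintegral_gain_le (g : L1Vel) (f : L1Phase) {Φ : Vel → ℝ≥0∞} (hΦ : Measurable Φ) :
    ∫⁻ z, ‖gain g f z‖ₑ * Φ z.2
      ≤ ∫⁻ z, ‖f z‖ₑ * ∫⁻ p, ‖g p.2 * collKernel z.2 p‖ₑ * Φ (preVel z.2 p) ∂collMeasure := by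
  have hm := (stronglyMeasurable_collDensity g f).measurable.enorm
  have hmf := measurePreserving_collFlip.measurable
  have hpre : Measurable fun q : Phase × (Sph × Vel) => preVel q.1.2 q.2 :=
    measurable_preVel.comp (measurable_fst.snd.prodMk measurable_snd)
  calc ∫⁻ z, ‖gain g f z‖ₑ * Φ z.2
      ≤ ∫⁻ z, ∫⁻ p, ‖collDensity g f (collFlip (z, p))‖ₑ * Φ z.2 ∂collMeasure := by
        refine lintegral_mono fun z => ?_
        have hmz : Measurable fun p => ‖collDensity g f (collFlip (z, p))‖ₑ :=
          (hm.comp hmf).comp (measurable_prodMk_left (x := z))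
        rw [lintegral_mul_const _ hmz, gain_eq]
        gcongr
        exact enorm_integral_le_lintegral_enorm _
    _ = ∫⁻ q, ‖collDensity g f (collFlip q)‖ₑ * Φ q.1.2
          ∂((volume : Measure Phase).prod collMeasure) := by
        rw [lintegral_prod]
        exact ((hm.comp hmf).mul (hΦ.comp measurable_fst.snd)).aemeasurable
    _ = ∫⁻ q, ‖collDensity g f (collFlip q)‖ₑ * Φ (preVel (collFlip q).1.2 (collFlip q).2)
          ∂((volume : Measure Phase).prod collMeasure) := by
        refine lintegral_congr fun q => ?_
        simp only [collFlip, preVel_flip]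
    _ = ∫⁻ q, ‖collDensity g f q‖ₑ * Φ (preVel q.1.2 q.2)
          ∂((volume : Measure Phase).prod collMeasure) :=
        measurePreserving_collFlip.lintegral_comp
          (f := fun q => ‖collDensity g f q‖ₑ * Φ (preVel q.1.2 q.2)) (hm.mul (hΦ.comp hpre))
    _ = ∫⁻ z, ∫⁻ p, ‖collDensity g f (z, p)‖ₑ * Φ (preVel z.2 p) ∂collMeasure := by
        rw [lintegral_prod]
        exact (hm.mul (hΦ.comp hpre)).aemeasurable
    _ = _ := by
        refine lintegral_congr fun z => ?_
        rw [← lintegral_const_mul]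
        · refine lintegral_congr fun p => ?_
          simp only [collDensity, enorm_mul, mul_assoc]
        · exact ((stronglyMeasurable_coll g).measurable.comp
            (measurable_prodMk_left (x := z.2))).enorm.mul
            (hΦ.comp (measurable_preVel.comp measurable_prodMk_left))

lemma lintegral_enorm_gain_le {g : L1Vel} (hg0 : 0 ≤ g)
    (hg : Integrable (fun v : Vel => g v * (1 + ‖v‖ ^ 2)) volume) (f : L1Phase) :
    ∫⁻ z, ‖gain g f z‖ₑ ≤ ∫⁻ z, ‖f z‖ₑ * ENNReal.ofReal (collRate g z.2) := by
  have h := lintegral_gain_le g f (Φ := fun _ => 1) measurable_const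
  simpa only [mul_one, lintegral_coll hg0 hg] using h

lemma lintegral_gain_weight_le {g : L1Vel} (hg0 : 0 ≤ g)
    (hg : Integrable (fun v : Vel => g v * (1 + ‖v‖ ^ 2)) volume) (f : L1Phase) :
    ∫⁻ z, ‖gain g f z‖ₑ * ENNReal.ofReal (1 + ‖z.2‖)
      ≤ (∫⁻ z, ‖f z‖ₑ * (ENNReal.ofReal (collRate g z.2) * ENNReal.ofReal (1 + ‖z.2‖)))
        + ENNReal.ofReal (4 * collMoment g) * ‖f‖ₑ := by
  have hmf : Measurable fun z => ‖f z‖ₑ := (Lp.stronglyMeasurable f).measurable.enorm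
  have hmr := measurable_collRate g
  refine (lintegral_gain_le g f (Φ := fun v => ENNReal.ofReal (1 + ‖v‖)) (by fun_prop)).trans ?_
  rw [enorm_eq_lintegral, ← lintegral_const_mul _ hmf, ← lintegral_add_left (by fun_prop)]
  refine lintegral_mono fun z => ?_
  calc _ ≤ ‖f z‖ₑ * (ENNReal.ofReal (collRate g z.2) * ENNReal.ofReal (1 + ‖z.2‖)
        + ENNReal.ofReal (4 * collMoment g)) := by
        gcongr
        exact lintegral_coll_preVel_le hg0 hg z.2
    _ = _ := by ring

lemma integrable_collDensity {g : L1Vel} (hg0 : 0 ≤ g)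
    (hg : Integrable (fun v : Vel => g v * (1 + ‖v‖ ^ 2)) volume) {f : L1Phase}
    (hf : Integrable (loss g f)) :
    Integrable (collDensity g f) ((volume : Measure Phase).prod collMeasure) := by
  have hm := stronglyMeasurable_collDensity g f
  refine ⟨hm.aestronglyMeasurable, ?_⟩
  rw [HasFiniteIntegral, lintegral_prod _ hm.measurable.enorm.aemeasurable]
  refine lt_of_le_of_lt (le_of_eq (lintegral_congr fun z => ?_)) hf.2
  simp only [collDensity, enorm_mul (f z)]
  rw [lintegral_const_mul, lintegral_coll hg0 hg, loss, enorm_mul,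
    Real.enorm_of_nonneg (collRate_nonneg hg0 _)]
  exact ((stronglyMeasurable_coll g).measurable.comp (measurable_prodMk_left (x := z.2))).enorm

lemma gainIntegrable_of_loss {g : L1Vel} (hg0 : 0 ≤ g)
    (hg : Integrable (fun v : Vel => g v * (1 + ‖v‖ ^ 2)) volume) {f : L1Phase}
    (hf : Integrable (loss g f)) : GainIntegrable g f := by
  have h := measurePreserving_collFlip.integrable_comp_of_integrable
    (integrable_collDensity hg0 hg hf)
  refine ⟨?_, ?_⟩
  · filter_upwards [h.prod_right_ae] with z hz
    exact hz.congr (Eventually.of_forall fun p => (gainIntegrand_eq g f z p).symm)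
  · exact h.integral_prod_left.congr (Eventually.of_forall fun z => (gain_eq g f z).symm)

lemma integral_gain {g : L1Vel} (hg0 : 0 ≤ g)
    (hg : Integrable (fun v : Vel => g v * (1 + ‖v‖ ^ 2)) volume) {f : L1Phase}
    (hf : Integrable (loss g f)) : ∫ z, gain g f z = ∫ z, loss g f z := by
  have h0 := integrable_collDensity hg0 hg hf
  have h := measurePreserving_collFlip.integrable_comp_of_integrable h0
  calc ∫ z, gain g f z = ∫ q, (collDensity g f ∘ collFlip) q
        ∂((volume : Measure Phase).prod collMeasure) := by
        rw [integral_prod _ h]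
        exact integral_congr_ae (Eventually.of_forall fun z => gain_eq g f z)
    _ = ∫ q, collDensity g f q ∂((volume : Measure Phase).prod collMeasure) := by
        conv_rhs => rw [← measurePreserving_collFlip.map_eq]
        rw [integral_map measurePreserving_collFlip.measurable.aemeasurable
          (stronglyMeasurable_collDensity g f).aestronglyMeasurable]
        rfl
    _ = ∫ z, loss g f z := by
        rw [integral_prod _ h0]
        refine integral_congr_ae (Eventually.of_forall fun z => ?_)
        simp only [collDensity, loss, collRate]
        rw [integral_const_mul]

lemma gain_nonneg {g : L1Vel} (hg0 : 0 ≤ g) {f : L1Phase} (hf : 0 ≤ f) :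
    ∀ᵐ z, 0 ≤ gain g f z := by
  have h1 : ∀ᵐ q ∂((volume : Measure Phase).prod collMeasure), 0 ≤ collDensity g f q := by
    filter_upwards [Measure.quasiMeasurePreserving_fst.ae ((Lp.coeFn_nonneg f).2 hf),
      Measure.quasiMeasurePreserving_snd.ae (ae_nonneg_coll hg0)] with q h1 h2
    exact mul_nonneg h1 (mul_nonneg h2 (collKernel_nonneg _ _))
  have h2 := measurePreserving_collFlip.quasiMeasurePreserving.ae h1
  filter_upwards [Measure.ae_ae_of_ae_prod h2] with z hz
  rw [gain_eq]
  exact integral_nonneg_of_ae hz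

/-! ### The weighted norm -/

/-- The extended norm `∫ |f| (1 + |v|)`. -/
def weightNorm (f : L1Phase) : ℝ≥0∞ := ∫⁻ z, ‖f z‖ₑ * ENNReal.ofReal (1 + ‖z.2‖)

lemma measurable_weight_mul (f : L1Phase) :
    Measurable fun z : Phase => ‖f z‖ₑ * ENNReal.ofReal (1 + ‖z.2‖) := by
  have := (Lp.stronglyMeasurable f).measurable
  fun_prop

/-- Lower semicontinuity is Fatou's lemma along an almost everywhere convergent subsequence. -/
lemma isLscSeminorm_weightNorm : IsLscSeminorm weightNorm where
  add_le f f' := by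
    unfold weightNorm
    rw [← lintegral_add_left (measurable_weight_mul f)]
    refine lintegral_mono_ae ?_
    filter_upwards [Lp.coeFn_add f f'] with z hz
    rw [hz, Pi.add_apply, ← add_mul]
    gcongr
    exact enorm_add_le _ _
  smul_le r f := by
    unfold weightNorm
    rw [← lintegral_const_mul _ (measurable_weight_mul f)]
    refine lintegral_mono_ae ?_
    filter_upwards [Lp.coeFn_smul r f] with z hz
    rw [hz, Pi.smul_apply, smul_eq_mul, enorm_mul, Real.enorm_eq_ofReal_abs, mul_assoc]
  lsc := by
    rw [lowerSemicontinuous_iff_isClosed_preimage]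
    intro c
    refine IsSeqClosed.isClosed fun f f₀ hf hlim => ?_
    obtain ⟨ns, _, hns⟩ := (tendstoInMeasure_of_tendsto_Lp hlim).exists_seq_tendsto_ae
    have h1 : weightNorm f₀ ≤ liminf (fun i => weightNorm (f (ns i))) atTop := by
      refine le_trans (lintegral_mono_ae ?_)
        (lintegral_liminf_le fun i => measurable_weight_mul (f (ns i)))
      filter_upwards [hns] with z hz
      refine le_of_eq (Tendsto.liminf_eq ?_).symm
      exact ENNReal.Tendsto.mul_const hz.enorm (Or.inr ENNReal.ofReal_ne_top)
    refine mem_preimage.2 (mem_Iic.2 (h1.trans ?_))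
    exact liminf_le_of_le (by isBoundedDefault) fun b hb => by
      obtain ⟨i, hi⟩ := hb.exists
      exact hi.trans (hf (ns i))

lemma enorm_le_weightNorm (f : L1Phase) : ‖f‖ₑ ≤ weightNorm f := by
  rw [enorm_eq_lintegral]
  refine lintegral_mono fun z => ?_
  refine le_mul_of_one_le_right zero_le ?_
  rw [ENNReal.one_le_ofReal]
  linarith [norm_nonneg z.2]

lemma weightNorm_lt_top_iff (f : L1Phase) :
    weightNorm f < ⊤ ↔ Integrable fun z : Phase => f z * (1 + ‖z.2‖) := by
  have e : ∫⁻ z : Phase, ‖f z * (1 + ‖z.2‖)‖ₑ = weightNorm f := by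
    refine lintegral_congr fun z => ?_
    rw [enorm_mul, Real.enorm_of_nonneg (r := 1 + ‖z.2‖) (by positivity)]
  constructor
  · intro h
    refine ⟨?_, ?_⟩
    · have := (Lp.stronglyMeasurable f).measurable
      exact Measurable.aestronglyMeasurable (by fun_prop)
    · rw [HasFiniteIntegral, e]
      exact h
  · intro h
    rw [← e]
    exact h.2

lemma dense_weightNorm_lt_top : Dense {f : L1Phase | weightNorm f < ⊤} := by
  intro f
  rw [Metric.mem_closure_iff]
  intro ε hε
  have : IsLocallyFiniteMeasure (volume : Measure Phase) :=
    inferInstanceAs (IsLocallyFiniteMeasure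
      ((volume : Measure Torus).prod (volume : Measure Vel)))
  obtain ⟨h, hs, hle, hc, hi⟩ := (L1.integrable_coeFn f).exists_hasCompactSupport_integral_sub_le
    (show 0 < ε / 2 by positivity)
  refine ⟨hi.toL1 h, ?_, ?_⟩
  · refine (weightNorm_lt_top_iff _).2 ?_
    have hc' : Continuous fun z : Phase => h z * (1 + ‖z.2‖) := by fun_prop
    refine (hc'.integrable_of_hasCompactSupport hs.mul_right).congr ?_
    filter_upwards [hi.coeFn_toL1] with z hz
    rw [hz]
  · rw [dist_eq_norm, L1.norm_eq_integral_norm]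
    refine lt_of_le_of_lt (le_trans (le_of_eq (integral_congr_ae ?_)) hle) (by linarith)
    filter_upwards [Lp.coeFn_sub f (hi.toL1 h), hi.coeFn_toL1] with z h1 h2
    rw [h1, Pi.sub_apply, h2]

lemma integrable_loss_of_weightNorm {g : L1Vel} (hg0 : 0 ≤ g)
    (hg : Integrable (fun v : Vel => g v * (1 + ‖v‖ ^ 2)) volume) {f : L1Phase}
    (hf : weightNorm f < ⊤) : Integrable (loss g f) := by
  refine (((weightNorm_lt_top_iff f).1 hf).norm.const_mul (2 * collMoment g)).mono' ?_
    (Eventually.of_forall fun z => ?_)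
  · exact ((Lp.stronglyMeasurable f).measurable.mul
      ((measurable_collRate g).comp measurable_snd)).aestronglyMeasurable
  · rw [loss, norm_mul, norm_mul, Real.norm_of_nonneg (collRate_nonneg hg0 _),
      Real.norm_of_nonneg (r := 1 + ‖z.2‖) (by positivity)]
    calc _ ≤ ‖f z‖ * (2 * collMoment g * (1 + ‖z.2‖)) := by
          gcongr
          exact collRate_le hg0 hg z.2
      _ = _ := by ring

/-! ### The resolvent of `A` and its composition with `B` -/

lemma mem_graph_add {X : Type*} [AddCommGroup X] [Module ℝ X] {A B : X →ₗ.[ℝ] X} {x y : X} :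
    (x, y) ∈ (A + B).graph ↔ ∃ a b, (x, a) ∈ A.graph ∧ (x, b) ∈ B.graph ∧ y = a + b := by
  constructor
  · intro h
    rw [LinearPMap.mem_graph_iff] at h
    obtain ⟨w, rfl, rfl⟩ := h
    exact ⟨A ⟨w, w.2.1⟩, B ⟨w, w.2.2⟩, A.mem_graph ⟨w, w.2.1⟩, B.mem_graph ⟨w, w.2.2⟩,
      LinearPMap.add_apply A B w⟩
  · rintro ⟨a, b, ha, hb, rfl⟩
    rw [LinearPMap.mem_graph_iff] at ha hb
    obtain ⟨u, hu, rfl⟩ := ha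
    obtain ⟨w, hw, rfl⟩ := hb
    simp only at hu hw
    have hu' : x ∈ A.domain := hu ▸ u.2
    have hw' : x ∈ B.domain := hw ▸ w.2
    have h := (A + B).mem_graph ⟨x, hu', hw'⟩
    have e1 : u = ⟨x, hu'⟩ := Subtype.ext hu
    have e2 : w = ⟨x, hw'⟩ := Subtype.ext hw
    rw [e1, e2]
    exact h

variable {g : L1Vel} {lam : ℝ}

/-- The resolvent of `A` at `λ`. -/
def resolvA (hg0 : 0 ≤ g) (hlam : 0 < lam) : L1Phase →L[ℝ] L1Phase :=
  resolvL1 (collRate g) lam (measurable_collRate g) (collRate_nonneg hg0) hlam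

lemma integrable_loss_resolvA (hg0 : 0 ≤ g) (hlam : 0 < lam) (h : L1Phase) :
    Integrable (loss g (resolvA hg0 hlam h)) :=
  integrable_resolvL1_mul _ _ hlam h (Ψ := fun z => collRate g z.2) (C := 1)
    ((measurable_collRate g).comp measurable_snd) fun z => by
      rw [abs_of_nonneg (collRate_nonneg hg0 _)]
      linarith

lemma resolvA_mem_domain (hg0 : 0 ≤ g)
    (hg : Integrable (fun v : Vel => g v * (1 + ‖v‖ ^ 2)) volume) (hlam : 0 < lam) (h : L1Phase) :
    GainIntegrable g (resolvA hg0 hlam h) :=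
  gainIntegrable_of_loss hg0 hg (integrable_loss_resolvA hg0 hlam h)

/-- The gain of `R h` is bounded in norm by `‖σ R h‖`, which is the part of `‖h‖` that `λ‖R h‖`
leaves over. -/
lemma norm_resolvA_add_le (hg0 : 0 ≤ g)
    (hg : Integrable (fun v : Vel => g v * (1 + ‖v‖ ^ 2)) volume) (hlam : 0 < lam) (h : L1Phase) :
    lam * ‖resolvA hg0 hlam h‖ + ‖(resolvA_mem_domain hg0 hg hlam h).toL1‖ ≤ ‖h‖ := by
  have h1 := lintegral_resolvL1_le (measurable_collRate g) (collRate_nonneg hg0) hlam h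
    (Φ := fun _ => 1) measurable_const
  simp only [mul_one, ← enorm_eq_lintegral] at h1
  have h2 := lintegral_enorm_gain_le hg0 hg (resolvA hg0 hlam h)
  have h3 : ‖(resolvA_mem_domain hg0 hg hlam h).toL1‖ₑ = ∫⁻ z, ‖gain g (resolvA hg0 hlam h) z‖ₑ := by
    rw [enorm_eq_lintegral]
    refine lintegral_congr_ae ?_
    filter_upwards [(resolvA_mem_domain hg0 hg hlam h).coeFn_toL1] with z hz
    rw [hz]
  have h4 : ENNReal.ofReal lam * ‖resolvA hg0 hlam h‖ₑ
      + ‖(resolvA_mem_domain hg0 hg hlam h).toL1‖ₑ ≤ ‖h‖ₑ := by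
    rw [h3]
    exact (add_le_add le_rfl h2).trans h1
  rwa [← ofReal_norm, ← ofReal_norm, ← ofReal_norm, ← ENNReal.ofReal_mul hlam.le,
    ← ENNReal.ofReal_add (by positivity) (norm_nonneg _),
    ENNReal.ofReal_le_ofReal_iff (norm_nonneg _)] at h4

/-- The composition of `B` with the resolvent of `A` at `λ`. -/
def gainResolvA (hg0 : 0 ≤ g) (hg : Integrable (fun v : Vel => g v * (1 + ‖v‖ ^ 2)) volume)
    (hlam : 0 < lam) : L1Phase →L[ℝ] L1Phase :=
  LinearMap.mkContinuous
    ((opB g).toFun.comp ((resolvA hg0 hlam : L1Phase →ₗ[ℝ] L1Phase).codRestrict (opB g).domain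
      fun h => resolvA_mem_domain hg0 hg hlam h)) 1 fun h => by
    rw [one_mul]
    have h1 := norm_resolvA_add_le hg0 hg hlam h
    have h2 : 0 ≤ lam * ‖resolvA hg0 hlam h‖ := by positivity
    have h3 : ‖(resolvA_mem_domain hg0 hg hlam h).toL1‖ ≤ ‖h‖ := by linarith
    exact h3

lemma coeFn_gainResolvA (hg0 : 0 ≤ g)
    (hg : Integrable (fun v : Vel => g v * (1 + ‖v‖ ^ 2)) volume) (hlam : 0 < lam) (h : L1Phase) :
    gainResolvA hg0 hg hlam h =ᵐ[volume] gain g (resolvA hg0 hlam h) :=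
  (resolvA_mem_domain hg0 hg hlam h).coeFn_toL1

/-- In `weight_le` the leading term `∫ |R h| σ (1 + |v|)` of the gain is absorbed by the absorption
part of the resolvent estimate, leaving only `4 collMoment g ‖R h‖`. In `enorm_le` the linear growth
of the collision frequency is used. -/
lemma isKatoPair (hg0 : 0 ≤ g) (hg : Integrable (fun v : Vel => g v * (1 + ‖v‖ ^ 2)) volume)
    (hlam : 0 < lam) :
    IsKatoPair (opA g + opB g) weightNorm (4 * collMoment g) (2 * collMoment g) lam
      (resolvA hg0 hlam) (gainResolvA hg0 hg hlam) where
  norm_le h := norm_resolvA_add_le hg0 hg hlam h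
  mem_graph h := mem_graph_add.2 ⟨_, _,
    opA_graph.2 (isTransportLoss_resolvL1 (measurable_collRate g) (collRate_nonneg hg0) hlam h),
    opB_graph.2 ⟨resolvA_mem_domain hg0 hg hlam h, coeFn_gainResolvA hg0 hg hlam h⟩, rfl⟩
  exists_of_mem := by
    rintro ⟨x, y⟩ hxy
    obtain ⟨a, b, ha, hb, rfl⟩ := mem_graph_add.1 hxy
    have hA := opA_graph.1 ha
    have hR := isTransportLoss_resolvL1 (measurable_collRate g) (collRate_nonneg hg0) hlam
      (lam • x - a)
    -- The difference `d` of the two sides solves `A d = λ d`, hence vanishes by injectivity.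
    have hx : x = resolvA hg0 hlam (lam • x - a) := by
      rw [← sub_eq_zero]
      refine eq_zero_of_isTransportLoss (measurable_collRate g) (collRate_nonneg hg0)
        (collRate_le hg0 hg) hlam ?_
      have h1 := hA.add (hR.smul (-1))
      convert h1 using 1
      · rw [sub_eq_add_neg, neg_one_smul]
        rfl
      · rw [smul_sub]
        change lam • x - lam • resolvA hg0 hlam (lam • x - a) = a + (-1 : ℝ) •
          (lam • resolvA hg0 hlam (lam • x - a) - (lam • x - a))
        module
    refine ⟨lam • x - a, hx, ?_⟩
    have hb' : b = gainResolvA hg0 hg hlam (lam • x - a) := by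
      refine Lp.ext ((opB_graph.1 hb).2.trans ?_)
      refine EventuallyEq.trans ?_ (coeFn_gainResolvA hg0 hg hlam (lam • x - a)).symm
      rw [← hx]
    simp only [hb', sub_sub_cancel]
  weight_le h := by
    have h1 := lintegral_resolvL1_le (measurable_collRate g) (collRate_nonneg hg0) hlam h
      (Φ := fun v => ENNReal.ofReal (1 + ‖v‖)) (by fun_prop)
    have h2 := lintegral_gain_weight_le hg0 hg (resolvA hg0 hlam h)
    have h3 : weightNorm (gainResolvA hg0 hg hlam h)
        = ∫⁻ z, ‖gain g (resolvA hg0 hlam h) z‖ₑ * ENNReal.ofReal (1 + ‖z.2‖) := by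
      refine lintegral_congr_ae ?_
      filter_upwards [coeFn_gainResolvA hg0 hg hlam h] with z hz
      rw [hz]
    rw [h3]
    calc _ ≤ ((∫⁻ z, ‖resolvA hg0 hlam h z‖ₑ
            * (ENNReal.ofReal (collRate g z.2) * ENNReal.ofReal (1 + ‖z.2‖)))
          + ENNReal.ofReal (4 * collMoment g) * ‖resolvA hg0 hlam h‖ₑ)
          + ENNReal.ofReal lam * weightNorm (resolvA hg0 hlam h) := add_le_add h2 le_rfl
      _ = (ENNReal.ofReal lam * weightNorm (resolvA hg0 hlam h)
          + ∫⁻ z, ‖resolvA hg0 hlam h z‖ₑ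
            * (ENNReal.ofReal (collRate g z.2) * ENNReal.ofReal (1 + ‖z.2‖)))
          + ENNReal.ofReal (4 * collMoment g) * ‖resolvA hg0 hlam h‖ₑ := by ring
      _ ≤ _ := add_le_add h1 le_rfl
  enorm_le h := by
    have hC := collMoment_nonneg hg0
    have h2 := lintegral_enorm_gain_le hg0 hg (resolvA hg0 hlam h)
    have h3 : ‖gainResolvA hg0 hg hlam h‖ₑ = ∫⁻ z, ‖gain g (resolvA hg0 hlam h) z‖ₑ := by
      rw [enorm_eq_lintegral]
      refine lintegral_congr_ae ?_
      filter_upwards [coeFn_gainResolvA hg0 hg hlam h] with z hz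
      rw [hz]
    rw [h3, weightNorm, ← lintegral_const_mul _ (measurable_weight_mul _)]
    refine h2.trans (lintegral_mono fun z => ?_)
    calc _ ≤ ‖resolvA hg0 hlam h z‖ₑ * ENNReal.ofReal (2 * collMoment g * (1 + ‖z.2‖)) := by
          gcongr
          exact collRate_le hg0 hg z.2
      _ = _ := by
          rw [ENNReal.ofReal_mul (by positivity)]
          ring

/-! ### Mass balance and positivity. -/

/-- The total mass as a continuous functional. -/
def mass : L1Phase →L[ℝ] ℝ := L1.integralCLM

lemma mass_apply (f : L1Phase) : mass f = ∫ z, f z := by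
  rw [← L1.integral_eq_integral, L1.integral_eq]
  rfl

lemma mass_balance (hg0 : 0 ≤ g) (hg : Integrable (fun v : Vel => g v * (1 + ‖v‖ ^ 2)) volume)
    (hlam : 0 < lam) (h : L1Phase) :
    lam * mass (resolvA hg0 hlam h) + mass (gainResolvA hg0 hg hlam h) = mass h := by
  have hl := integrable_loss_resolvA hg0 hlam h
  have e1 : ∫ z, gainResolvA hg0 hg hlam h z = ∫ z, loss g (resolvA hg0 hlam h) z := by
    rw [← integral_gain hg0 hg hl]
    exact integral_congr_ae (coeFn_gainResolvA hg0 hg hlam h)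
  rw [mass_apply, mass_apply, mass_apply, e1, ← integral_rate_mul_resolvL1 (measurable_collRate g)
    (collRate_nonneg hg0) hlam h, ← integral_const_mul,
    ← integral_add ((L1.integrable_coeFn _).const_mul lam) hl]
  refine integral_congr_ae (Eventually.of_forall fun z => ?_)
  simp only [loss, resolvA]
  ring

lemma gainResolvA_nonneg (hg0 : 0 ≤ g)
    (hg : Integrable (fun v : Vel => g v * (1 + ‖v‖ ^ 2)) volume) (hlam : 0 < lam) {h : L1Phase}
    (h0 : 0 ≤ h) : 0 ≤ gainResolvA hg0 hg hlam h := by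
  rw [← Lp.coeFn_nonneg]
  filter_upwards [coeFn_gainResolvA hg0 hg hlam h,
    gain_nonneg hg0 (resolvL1_nonneg (measurable_collRate g) (collRate_nonneg hg0) hlam h0)]
    with z h1 h2
  rw [h1]
  exact h2

/-! ### The resolvent of `A + B` -/

/-- The resolvent of the closure of `A + B`, set to zero for `λ ≤ 0`. -/
def resolvAB (hg0 : 0 ≤ g) (hg : Integrable (fun v : Vel => g v * (1 + ‖v‖ ^ 2)) volume)
    (lam : ℝ) : L1Phase →L[ℝ] L1Phase :=
  if hlam : 0 < lam then (isKatoPair hg0 hg hlam).resolvent hlam else 0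

lemma resolvAB_of_pos (hg0 : 0 ≤ g) (hg : Integrable (fun v : Vel => g v * (1 + ‖v‖ ^ 2)) volume)
    (hlam : 0 < lam) : resolvAB hg0 hg lam = (isKatoPair hg0 hg hlam).resolvent hlam :=
  dif_pos hlam

lemma isResolventFamily_resolvAB (hg0 : 0 ≤ g)
    (hg : Integrable (fun v : Vel => g v * (1 + ‖v‖ ^ 2)) volume) :
    IsResolventFamily (opA g + opB g) (resolvAB hg0 hg) where
  norm_le lam hlam x := by
    rw [resolvAB_of_pos hg0 hg hlam]
    exact (isKatoPair hg0 hg hlam).norm_resolvent_le hlam x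
  mem_closure lam hlam x := by
    rw [resolvAB_of_pos hg0 hg hlam]
    exact (isKatoPair hg0 hg hlam).resolvent_mem_closure hlam dense_weightNorm_lt_top x
  left_inv lam hlam p hp := by
    rw [resolvAB_of_pos hg0 hg hlam]
    exact (isKatoPair hg0 hg hlam).resolvent_left_inv hlam dense_weightNorm_lt_top hp
  dense := dense_of_range_resolvL1 (measurable_collRate g) (collRate_nonneg hg0)
    fun _ hlam h => LinearPMap.mem_domain_of_mem_graph ((isKatoPair hg0 hg hlam).mem_graph h)

end LinBoltz

end

noncomputable section

namespace LinBoltz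

open Filter Topology
open scoped ENNReal

/-! ### The Yosida approximations and the mild solution -/

variable {g : L1Vel}

/-- The additive monoid of nonnegative elements of `L¹`. -/
def nonnegL1 : AddSubmonoid L1Phase where
  carrier := {f : L1Phase | 0 ≤ f}
  add_mem' := fun {a b} (h : 0 ≤ a) (h' : 0 ≤ b) => show 0 ≤ a + b from add_nonneg h h'
  zero_mem' := le_refl (0 : L1Phase)

lemma isClosed_nonnegL1 : IsClosed (nonnegL1 : Set L1Phase) :=
  isClosed_Ici (a := (0 : L1Phase))

lemma smul_mem_nonnegL1 (r : ℝ) (hr : 0 ≤ r) (f : L1Phase) (hf : f ∈ nonnegL1) :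
    r • f ∈ nonnegL1 := by
  have hf' : 0 ≤ f := hf
  change 0 ≤ r • f
  rw [← Lp.coeFn_nonneg]
  filter_upwards [Lp.coeFn_smul r f, (Lp.coeFn_nonneg f).2 hf'] with z h1 h2
  rw [h1]
  exact mul_nonneg hr h2

lemma yosidaExp_nonneg (hg0 : 0 ≤ g) (hg : Integrable (fun v : Vel => g v * (1 + ‖v‖ ^ 2)) volume)
    {lam t : ℝ} (hlam : 0 < lam) (ht : 0 ≤ t) {f : L1Phase} (hf : 0 ≤ f) :
    0 ≤ yosidaExp (resolvAB hg0 hg lam) lam t f := by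
  refine yosidaExp_mem _ hlam ht isClosed_nonnegL1 smul_mem_nonnegL1 (fun x hx => ?_)
    (show f ∈ nonnegL1 from hf)
  rw [resolvAB_of_pos hg0 hg hlam]
  exact (isKatoPair hg0 hg hlam).resolvent_mem hlam isClosed_nonnegL1
    (fun x hx => resolvL1_nonneg (measurable_collRate g) (collRate_nonneg hg0) hlam hx)
    (fun x hx => gainResolvA_nonneg hg0 hg hlam hx) hx

lemma mass_yosidaExp (hg0 : 0 ≤ g) (hg : Integrable (fun v : Vel => g v * (1 + ‖v‖ ^ 2)) volume)
    {lam : ℝ} (hlam : 0 < lam) (t : ℝ) (f : L1Phase) :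
    mass (yosidaExp (resolvAB hg0 hg lam) lam t f) = mass f := by
  refine map_yosidaExp _ hlam t mass (fun x => ?_) f
  rw [resolvAB_of_pos hg0 hg hlam]
  exact (isKatoPair hg0 hg hlam).map_resolvent hlam dense_weightNorm_lt_top mass
    (mass_balance hg0 hg hlam) x

lemma weightNorm_yosidaExp_le (hg0 : 0 ≤ g)
    (hg : Integrable (fun v : Vel => g v * (1 + ‖v‖ ^ 2)) volume) {lam t : ℝ} (hlam : 0 < lam)
    (ht : 0 ≤ t) (f : L1Phase) :
    weightNorm (yosidaExp (resolvAB hg0 hg lam) lam t f)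
      ≤ ENNReal.ofReal (Real.exp (t * (4 * collMoment g))) * weightNorm f := by
  have hC : 0 ≤ 4 * collMoment g := mul_nonneg (by norm_num) (collMoment_nonneg hg0)
  refine isLscSeminorm_weightNorm.yosidaExp_le _ hC hlam ht (fun x => ?_) f
  rw [resolvAB_of_pos hg0 hg hlam]
  exact (isKatoPair hg0 hg hlam).weight_resolvent_le hlam hC isLscSeminorm_weightNorm
    enorm_le_weightNorm x

lemma weightNorm_lt_top_of_moment {f : L1Phase}
    (hf : Integrable (fun z : Phase => f z * (1 + ‖z.2‖ ^ 2)) volume) : weightNorm f < ⊤ := by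
  refine (weightNorm_lt_top_iff f).2 ((hf.norm.const_mul 2).mono' ?_
    (Eventually.of_forall fun z => ?_))
  · have := (Lp.stronglyMeasurable f).measurable
    exact Measurable.aestronglyMeasurable (by fun_prop)
  · rw [norm_mul, norm_mul, Real.norm_of_nonneg (r := 1 + ‖z.2‖) (by positivity),
      Real.norm_of_nonneg (r := 1 + ‖z.2‖ ^ 2) (by positivity)]
    have h1 : 1 + ‖z.2‖ ≤ 2 * (1 + ‖z.2‖ ^ 2) := by nlinarith [sq_nonneg (‖z.2‖ - 1)]
    calc ‖f z‖ * (1 + ‖z.2‖) ≤ ‖f z‖ * (2 * (1 + ‖z.2‖ ^ 2)) := by gcongr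
      _ = _ := by ring

/-! ### Mild solutions for `A + B` and for its closure. -/

lemma IsMildSolution.mem_graph {L : L1Phase →ₗ.[ℝ] L1Phase} {u₀ : L1Phase} {T : ℝ}
    {u : ℝ → L1Phase} (hu : IsMildSolution L u₀ T u) {t : ℝ} (ht : t ∈ Icc 0 T) :
    (∫ θ in (0 : ℝ)..t, u θ, u t - u₀) ∈ L.graph := by
  obtain ⟨hd, he⟩ := hu.mild t ht
  rw [← he]
  exact L.mem_graph ⟨_, hd⟩

/-- Mild solutions for the closure of `L` are unique. -/
lemma IsResolventFamily.eqOn_mild {L : L1Phase →ₗ.[ℝ] L1Phase} {J : ℝ → L1Phase →L[ℝ] L1Phase}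
    (hJ : IsResolventFamily L J) {u₀ : L1Phase} {T : ℝ} {u f : ℝ → L1Phase}
    (hu : IsMildSolution L.closure u₀ T u) (hf : IntegrableOn f (Icc 0 T))
    (hfmem : ∀ t ∈ Icc 0 T, (∫ s in (0 : ℝ)..t, f s, f t - u₀) ∈
      closure (L.graph : Set (L1Phase × L1Phase))) : EqOn u f (Icc 0 T) := by
  intro t ht
  rw [← sub_eq_zero]
  refine hJ.mild_unique (w := fun s => u s - f s) (hu.integrable.sub hf) (fun t ht => ?_) t ht
  have hi : ∀ {w : ℝ → L1Phase}, IntegrableOn w (Icc 0 T) → IntervalIntegrable w volume 0 t :=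
    fun hw => (intervalIntegrable_iff_integrableOn_Ioc_of_le ht.1).2
      (hw.mono_set (Ioc_subset_Icc_self.trans (Icc_subset_Icc le_rfl ht.2)))
  have h1 := hJ.mem_graph_closure_iff.1 (hu.mem_graph ht)
  have h2 := L.graph.topologicalClosure.sub_mem h1 (hfmem t ht)
  rw [Prod.mk_sub_mk, sub_sub_sub_cancel_right,
    ← intervalIntegral.integral_sub (hi hu.integrable) (hi hf)] at h2
  exact h2

/-- An element of the closure of the graph of `A + B` with finite weighted norms on both sides lies
in the graph itself. -/
lemma mem_graph_of_weightNorm (hg0 : 0 ≤ g)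
    (hg : Integrable (fun v : Vel => g v * (1 + ‖v‖ ^ 2)) volume) {x y : L1Phase}
    (h : (x, y) ∈ closure ((opA g + opB g).graph : Set (L1Phase × L1Phase)))
    (hx : weightNorm x < ⊤) (hy : weightNorm y < ⊤) : (x, y) ∈ (opA g + opB g).graph := by
  have hJ := isResolventFamily_resolvAB hg0 hg
  have h1 := (hJ.mem_closure_iff one_pos).1 h
  rw [resolvAB_of_pos hg0 hg one_pos] at h1
  -- By `h1`, `x` is the resolvent at `λ = 1` of `x - y`, which has finite weight.
  have hd : x ∈ (opA g + opB g).domain := by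
    rw [← show _ = x from h1]
    exact (isKatoPair hg0 hg one_pos).resolvent_mem_domain one_pos
      (isLscSeminorm_weightNorm.sub_lt_top (isLscSeminorm_weightNorm.smul_lt_top 1 hx) hy)
  obtain ⟨y', hy'⟩ := LinearPMap.mem_domain_iff.1 hd
  -- The value of `A + B` at `x` is `y`, since the difference `(0, y - y')` lies in the closed
  -- graph.
  have h2 := (opA g + opB g).graph.topologicalClosure.sub_mem h (subset_closure hy')
  rw [Prod.mk_sub_mk, sub_self] at h2
  rwa [sub_eq_zero.1 (hJ.snd_eq_zero h2)]

theorem exists_mild_solution (T : ℝ) (f₀ : L1Phase) (g₀ : L1Vel)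
    (hf0 : 0 ≤ f₀) (hf1 : ∫ z, f₀ z = 1) (hg0 : 0 ≤ g₀)
    (hf : Integrable (fun z : Phase => f₀ z * (1 + ‖z.2‖ ^ 2)) volume)
    (hg : Integrable (fun v : Vel => g₀ v * (1 + ‖v‖ ^ 2)) volume) :
    ∃ f : ℝ → L1Phase, IsMildSolution (opA g₀ + opB g₀) f₀ T f ∧
      (∀ u : ℝ → L1Phase, IsMildSolution (opA g₀ + opB g₀).closure f₀ T u → EqOn u f (Icc 0 T)) ∧
      ContinuousOn f (Icc 0 T) ∧
      ∀ t ∈ Icc 0 T, 0 ≤ f t ∧ ∫ z, f t z = 1 ∧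
        Integrable (fun z : Phase => f t z * (1 + ‖z.2‖)) volume ∧ f t ∈ (opB g₀).domain := by
  have hJ := isResolventFamily_resolvAB hg0 hg
  have hpos : ∀ n : ℕ, (0 : ℝ) < n + 1 := fun n => by positivity
  have hC : 0 ≤ 4 * collMoment g₀ := mul_nonneg (by norm_num) (collMoment_nonneg hg0)
  obtain ⟨f, hfc, hflim, hfmem⟩ := hJ.exists_mild f₀ T
  have hw0 := weightNorm_lt_top_of_moment hf
  have hcT : ENNReal.ofReal (Real.exp (T * (4 * collMoment g₀))) * weightNorm f₀ < ⊤ :=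
    ENNReal.mul_lt_top ENNReal.ofReal_lt_top hw0
  -- The bound is uniform in `t`, as needed for the weight of the time integral.
  have hw : ∀ t ∈ Icc 0 T,
      weightNorm (f t) ≤ ENNReal.ofReal (Real.exp (T * (4 * collMoment g₀))) * weightNorm f₀ :=
    fun t ht => isLscSeminorm_weightNorm.le_of_tendsto (hflim t ht)
      (Eventually.of_forall fun n => (weightNorm_yosidaExp_le hg0 hg (hpos n) ht.1 f₀).trans (by
        gcongr
        exact ht.2))
  have hwt : ∀ t ∈ Icc 0 T, weightNorm (f t) < ⊤ := fun t ht => (hw t ht).trans_lt hcT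
  have hfi := hfc.integrableOn_Icc (μ := volume)
  refine ⟨f, ⟨hfi, fun t ht => ?_⟩, fun u hu => hJ.eqOn_mild hu hfi hfmem, hfc,
    fun t ht => ⟨?_, ?_, (weightNorm_lt_top_iff _).1 (hwt t ht),
      gainIntegrable_of_loss hg0 hg (integrable_loss_of_weightNorm hg0 hg (hwt t ht))⟩⟩
  · have hF : weightNorm (∫ s in (0 : ℝ)..t, f s) < ⊤ :=
      isLscSeminorm_weightNorm.intervalIntegral_lt_top ht.1
        (hfi.mono_set (Ioc_subset_Icc_self.trans (Icc_subset_Icc le_rfl ht.2))) hcT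
        fun s hs => hw s ⟨hs.1.le, hs.2.trans ht.2⟩
    have hm := mem_graph_of_weightNorm hg0 hg (hfmem t ht) hF
      (isLscSeminorm_weightNorm.sub_lt_top (hwt t ht) hw0)
    have hd := LinearPMap.mem_domain_of_mem_graph hm
    exact ⟨hd, LinearPMap.mem_graph_snd_inj _ (LinearPMap.mem_graph _ ⟨_, hd⟩) hm rfl⟩
  · exact isClosed_nonnegL1.mem_of_tendsto (hflim t ht)
      (Eventually.of_forall fun n => yosidaExp_nonneg hg0 hg (hpos n) ht.1 hf0)
  · refine Eq.trans ?_ hf1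
    rw [← mass_apply, ← mass_apply]
    refine tendsto_nhds_unique ((mass.continuous.tendsto _).comp (hflim t ht))
      (tendsto_const_nhds.congr fun n => ?_)
    exact (mass_yosidaExp hg0 hg (hpos n) t f₀).symm

end LinBoltz

end

/-! ### The main theorem. -/

theorem proposition3p4 (T : ℝ) (hT : 0 < T) (η : ℝ) (hη : 0 < η)
    (f₀ : LinBoltz.L1Phase) (g₀ : LinBoltz.L1Vel) (h : LinBoltz.Admissible η f₀ g₀) :
    (LinBoltz.opA g₀ + LinBoltz.opB g₀).IsClosable ∧
    ∃ f : ℝ → LinBoltz.L1Phase,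
      LinBoltz.IsMildSolution (LinBoltz.opA g₀ + LinBoltz.opB g₀) f₀ T f ∧
      (∀ u : ℝ → LinBoltz.L1Phase,
        LinBoltz.IsMildSolution (LinBoltz.opA g₀ + LinBoltz.opB g₀).closure f₀ T u →
          Set.EqOn u f (Set.Icc 0 T)) ∧
      ContinuousOn f (Set.Icc 0 T) ∧
      ∀ t ∈ Set.Icc 0 T,
        0 ≤ f t ∧
        ∫ z, f t z = 1 ∧
        Integrable (fun z : LinBoltz.Phase => f t z * (1 + ‖z.2‖)) volume ∧
        f t ∈ (LinBoltz.opB g₀).domain :=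
  ⟨(LinBoltz.isResolventFamily_resolvAB h.g_nonneg h.g_moment).isClosable,
    LinBoltz.exists_mild_solution T f₀ g₀ h.f_nonneg h.f_mass h.g_nonneg h.f_moment h.g_moment⟩
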